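/- An instance $I$ of SEFE is a pair of finite simple graphs $G_1=(V_1,E_1)$, $G_2=(V_2,E_2)$; its common graph is $G=G_1\cap G_2$ and its union graph is $G^\cup=G_1\cup G_2$. It admits a SEFE if there are planar drawings of $G_1$ and of $G_2$ (vertices are distinct points of the plane, edges are Jordan arcs that meet vertices and each other only in common end vertices) that coincide on all vertices and edges of $G$. A union cutvertex of $I$ is a cutvertex of $G^\cup$. A block of $G^\cup$ is a maximal connected subgraph $B$ without a cutvertex of its own; it induces the SEFE instance $I|_B=(G_1\cap B,\,G_2\cap B)$ with union graph $B$. Instances are encoded as their union graphs, given by the list of vertices and the list of edges, each labelled $\{1\}$, $\{2\}$ or $\{1,2\}$; the vertices of an input instance are numbered $0,\dots,n-1$. Theorem. There are a program for a random access machine (indirect addressing, addition, truncated subtraction, test for zero) and a constant $K$ such that, for every SEFE instance $I$ and every code of $I$, of length $N$, the program halts after at most $K(N+1)$ operations, using only numbers that are at most $K(N+1)$ (that is, words of $\log N+O(1)$ bits), and outputs a code, of length at most $K(N+1)$, of a list of SEFE instances such that 1. the list consists of the instances $I|_B$ for the blocks $B$ of $G^\cup$, each exactly once; 2. none of the instances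 in the list has a union cutvertex; 3. $I$ admits a SEFE if and only if every instance in the list admits a SEFE. -/

import Mathlib

/-! ### Graphs: cutvertices and biconnectivity -/

/-- `v` is a cutvertex of the graph `H`: its removal separates two vertices that are joined by a
path of `H`. For a connected `H` this says that the removal of `v` disconnects `H`. -/
def IsCutvertex {V : Type*} (H : (⊤ : SimpleGraph V).Subgraph) (v : V) : Prop :=
  v ∈ H.verts ∧ ∃ x ∈ H.verts, ∃ y ∈ H.verts, x ≠ v ∧ y ≠ v ∧
    H.spanningCoe.Reachable x y ∧ ¬ (H.deleteVerts {v}).spanningCoe.Reachable x y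

/-- A graph is biconnected if it is connected and has no cutvertex. -/
def Biconnected {V : Type*} (H : (⊤ : SimpleGraph V).Subgraph) : Prop :=
  H.Connected ∧ ∀ v, ¬ IsCutvertex H v

/-- The blocks of `U` are its maximal biconnected subgraphs. -/
def IsBlock {V : Type*} (U B : (⊤ : SimpleGraph V).Subgraph) : Prop :=
  Maximal (fun H => H ≤ U ∧ Biconnected H) B

/-! ### Planar drawings -/

/-- The Euclidean plane. -/
abbrev Plane : Type := EuclideanSpace ℝ (Fin 2)

/-- `S` is a Jordan arc (the image of an injective path) with end points `p` and `q`. -/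
def IsArc (S : Set Plane) (p q : Plane) : Prop :=
  ∃ γ : Path p q, Function.Injective γ ∧ Set.range γ = S

/-- A planar drawing of `H`: distinct vertices are distinct points, edges are Jordan arcs between
the points of their end vertices, an arc contains no point of another vertex, and two arcs meet
only in points of common end vertices. (The values of `pos` and `arc` outside `H` are irrelevant.)
-/
structure PlanarDrawing {V : Type*} (H : (⊤ : SimpleGraph V).Subgraph) where
  pos : V → Plane
  arc : Sym2 V → Set Plane
  pos_injOn : Set.InjOn pos H.verts
  isArc : ∀ u v, H.Adj u v → IsArc (arc s(u, v)) (pos u) (pos v)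
  vertex_mem_arc : ∀ e ∈ H.edgeSet, ∀ w ∈ H.verts, pos w ∈ arc e → w ∈ e
  arc_inter_arc : ∀ e ∈ H.edgeSet, ∀ f ∈ H.edgeSet, e ≠ f →
    arc e ∩ arc f ⊆ pos '' {v | v ∈ e ∧ v ∈ f}

/-! ### Instances of SEFE -/

/-- An instance of SEFE: two simple graphs, each with its own vertex set, which may share vertices
and edges. -/
@[ext]
structure SefeInstance (V : Type*) where
  G₁ : (⊤ : SimpleGraph V).Subgraph
  G₂ : (⊤ : SimpleGraph V).Subgraph

namespace SefeInstance

/-- The common graph. -/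
def common {V : Type*} (I : SefeInstance V) : (⊤ : SimpleGraph V).Subgraph := I.G₁ ⊓ I.G₂

/-- The union graph. -/
def union {V : Type*} (I : SefeInstance V) : (⊤ : SimpleGraph V).Subgraph := I.G₁ ⊔ I.G₂

/-- The instance that a subgraph `B` of the union graph induces: vertices and edges of `B` keep
their membership in the two graphs. -/
def restrict {V : Type*} (I : SefeInstance V) (B : (⊤ : SimpleGraph V).Subgraph) :
    SefeInstance V :=
  ⟨I.G₁ ⊓ B, I.G₂ ⊓ B⟩

/-- `I` admits a SEFE: there are planar drawings of the two graphs that coincide on the common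
graph. -/
def AdmitsSefe {V : Type*} (I : SefeInstance V) : Prop :=
  ∃ (D₁ : PlanarDrawing I.G₁) (D₂ : PlanarDrawing I.G₂),
    (∀ v ∈ I.common.verts, D₁.pos v = D₂.pos v) ∧
    (∀ e ∈ I.common.edgeSet, D₁.arc e = D₂.arc e)

/-- The number `ℓ ∈ {1, 2, 3}` encodes the label `{1}`, `{2}` or `{1, 2}` of a vertex or an edge of
the union graph, where `p` and `q` say that it belongs to the first and to the second graph. -/
def IsLabel (p q : Prop) (ℓ : ℕ) : Prop :=
  (p ∧ ¬ q ∧ ℓ = 1) ∨ (¬ p ∧ q ∧ ℓ = 2) ∨ (p ∧ q ∧ ℓ = 3)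

/-- The word `w` encodes `I` as labelled union graph: the numbers of vertices and of edges, then the
vertices (name, label) and then the edges (end vertex, end vertex, label), each listed exactly once
and in any order. -/
def IsCode (I : SefeInstance ℕ) (w : List ℕ) : Prop :=
  ∃ (vs : List (ℕ × ℕ)) (es : List (ℕ × ℕ × ℕ)),
    w = vs.length :: es.length ::
      (vs.flatMap (fun a => [a.1, a.2]) ++ es.flatMap (fun a => [a.1, a.2.1, a.2.2])) ∧
    (vs.map (fun a => a.1)).Nodup ∧
    (∀ v ∈ I.union.verts, ∃ a ∈ vs, a.1 = v) ∧
    (∀ a ∈ vs, IsLabel (a.1 ∈ I.G₁.verts) (a.1 ∈ I.G₂.verts) a.2) ∧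
    (es.map (fun a => s(a.1, a.2.1))).Nodup ∧
    (∀ e ∈ I.union.edgeSet, ∃ a ∈ es, s(a.1, a.2.1) = e) ∧
    (∀ a ∈ es, IsLabel (I.G₁.Adj a.1 a.2.1) (I.G₂.Adj a.1 a.2.1) a.2.2)

/-- The word `w` encodes the list `Js` of instances: their number, followed by their codes. -/
def IsListCode (Js : List (SefeInstance ℕ)) (w : List ℕ) : Prop :=
  ∃ ws : List (List ℕ), w = ws.length :: ws.flatten ∧ List.Forall₂ IsCode Js ws

end SefeInstance

/-! ### Random access machines

Structured programs for a random access machine with registers, indirectly addressed arrays (a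
program mentions finitely many of both), addition, truncated subtraction and a test for zero. All
numbers have to stay below a bound `W`, the word size being `log W`. -/

namespace RAM

/-- A memory state: the registers, and the cells of the arrays. -/
structure State where
  reg : ℕ → ℕ
  arr : ℕ → ℕ → ℕ

/-- Expressions; `load a e` reads the cell with address `e` of the array `a`. -/
inductive Expr where
  | const (k : ℕ)
  | reg (x : ℕ)
  | load (a : ℕ) (e : Expr)
  | add (e f : Expr)
  | sub (e f : Expr)

/-- The value of an expression. -/
def Expr.eval (s : State) : Expr → ℕ
  | const k => k
  | reg x => s.reg x
  | load a e => s.arr a (e.eval s)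
  | add e f => e.eval s + f.eval s
  | sub e f => e.eval s - f.eval s

/-- The number of operations that the evaluation of an expression takes. -/
def Expr.cost : Expr → ℕ
  | const _ => 1
  | reg _ => 1
  | load _ e => e.cost + 1
  | add e f => e.cost + f.cost + 1
  | sub e f => e.cost + f.cost + 1

/-- All numbers (values and addresses) in the evaluation of an expression are at most `W`. -/
def Expr.Fits (W : ℕ) (s : State) : Expr → Prop
  | const k => k ≤ W
  | reg x => s.reg x ≤ W
  | load a e => e.Fits W s ∧ s.arr a (e.eval s) ≤ W
  | add e f => e.Fits W s ∧ f.Fits W s ∧ e.eval s + f.eval s ≤ W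
  | sub e f => e.Fits W s ∧ f.Fits W s

/-- Programs; `assign x e` sets the register `x`, `store a e f` writes the value of `f` into the
cell with address `e` of the array `a`; conditions count as true if they are not zero. -/
inductive Program where
  | skip
  | assign (x : ℕ) (e : Expr)
  | store (a : ℕ) (e f : Expr)
  | seq (c d : Program)
  | ite (e : Expr) (c d : Program)
  | loop (e : Expr) (c : Program)

/-- `Exec W c s t s'`: started in the state `s`, the program `c` halts in the state `s'` after
exactly `t` operations, with all numbers at most `W`. -/
inductive Exec (W : ℕ) : Program → State → ℕ → State → Prop where
  | skip (s : State) : Exec W .skip s 1 s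
  | assign (x : ℕ) (e : Expr) (s : State) (he : e.Fits W s) :
      Exec W (.assign x e) s (e.cost + 1) ⟨Function.update s.reg x (e.eval s), s.arr⟩
  | store (a : ℕ) (e f : Expr) (s : State) (he : e.Fits W s) (hf : f.Fits W s) :
      Exec W (.store a e f) s (e.cost + f.cost + 1)
        ⟨s.reg, Function.update s.arr a (Function.update (s.arr a) (e.eval s) (f.eval s))⟩
  | seq {c d : Program} {s s' s'' : State} {t t' : ℕ} (hc : Exec W c s t s')
      (hd : Exec W d s' t' s'') : Exec W (.seq c d) s (t + t') s''
  | ite_true {e : Expr} {c d : Program} {s s' : State} {t : ℕ} (he : e.Fits W s)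
      (h : e.eval s ≠ 0) (hc : Exec W c s t s') : Exec W (.ite e c d) s (e.cost + 1 + t) s'
  | ite_false {e : Expr} {c d : Program} {s s' : State} {t : ℕ} (he : e.Fits W s)
      (h : e.eval s = 0) (hd : Exec W d s t s') : Exec W (.ite e c d) s (e.cost + 1 + t) s'
  | loop_true {e : Expr} {c : Program} {s s' s'' : State} {t t' : ℕ} (he : e.Fits W s)
      (h : e.eval s ≠ 0) (hc : Exec W c s t s') (hl : Exec W (.loop e c) s' t' s'') :
      Exec W (.loop e c) s (e.cost + 1 + t + t') s''
  | loop_false {e : Expr} {c : Program} {s : State} (he : e.Fits W s) (h : e.eval s = 0) :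
      Exec W (.loop e c) s (e.cost + 1) s

/-- The initial state for the input word `w`: it stands in array 0, its length in register 0, and
everything else is zero. -/
def init (w : List ℕ) : State where
  reg x := if x = 0 then w.length else 0
  arr a i := if a = 0 then w.getD i 0 else 0

/-- The output word of a final state: it stands in array 1, its length in register 0. -/
def output (s : State) : List ℕ :=
  (List.range (s.reg 0)).map (s.arr 1)

/-- On the input word `w`, the program `c` halts with the output word `w'` after at most
`K * (|w| + 1)` operations on numbers that are at most `K * (|w| + 1)`. -/
def OutputsWithin (K : ℕ) (c : Program) (w w' : List ℕ) : Prop :=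
  ∃ (t : ℕ) (s : State), Exec (K * (w.length + 1)) c (init w) t s ∧
    t ≤ K * (w.length + 1) ∧ output s = w'

end RAM

/-! ### Jordan arcs and planar drawings in a topological space -/

/-! Restricting drawings gives one direction of the equivalence, so its topological content is that
simultaneous embeddings can be glued at a single vertex. A SEFE is treated as one position map and
one arc map that draw both graphs planarly (`SefeInstance.admitsSefe_iff`). Edges of different
graphs may meet in any way, so the union has no outer face to which a vertex `v` could be moved.
Instead `v` is freed locally. A small disc around `v` meets, in the graphs that contain `v`, only
edges at `v`. Move `v` to a point `c` of the disc that avoids the graphs without `v` (Jordan arcs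
have empty interior), and let each edge at `v` run straight from `c` to the point where it last
leaves the disc. Only finitely many directions are used at `c`, so some short slit from `c` to `c +
d` meets the drawings at most in `c`. The principal square root of `(z - c) / (z - (c + d))` sends
the complement of the slit injectively into the right half plane and `c` to 0
(`SefeInstance.AdmitsSefe.exists_halfPlane`). A second drawing, turned by 180 degrees, fits into the
left half plane, and the two touch only at `v` (`SefeInstance.restrict_sup_admitsSefe`). A graph
that is not biconnected is the union of two smaller ones that share at most one vertex, so induction
reduces every instance to its biconnected subgraphs
(`SefeInstance.restrict_admitsSefe_of_biconnected`), each of which lies in a block.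

The blocks are found by depth-first search and lowpoints. In a depth-first tree every edge joins an
ancestor to a descendant. A non-root vertex opens a block if no edge from its subtree goes beyond
its parent; every other non-root vertex joins the block of its parent. An edge belongs to the block
of its later end vertex, and a block consists of the vertices with its number together with the
parent of its opening vertex. `IsBlockNumbering.isBlock_iff` shows that these are exactly the
maximal biconnected subgraphs: inside a block every vertex can be bypassed by an edge that jumps
over it, and a biconnected subgraph cannot cross the parent of an opening vertex. A root without
edges opens a block of its own.

For the machine, a weakest-precondition calculus handles code without loops (`RAM.Runs.of_wp`), and
a potential argument handles loops (`RAM.Runs.loop`). Stored numbers stay below a bound `M` that is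
linear in the input length; intermediate values exceed it by at most a constant factor. The search
starts at an artificial node 0 with arcs to all vertices, so one search treats all components and
parent number 0 marks the roots. Vertices and edges are sorted into linked lists by block, and each
list is walked once to write the output. -/

/-- `S` is the image of a compact interval under an injective continuous map that starts at `p` and
ends at `q`. -/
def IsJordanArc {E : Type*} [TopologicalSpace E] (S : Set E) (p q : E) : Prop :=
  ∃ (f : ℝ → E) (a b : ℝ), a < b ∧ ContinuousOn f (Set.Icc a b) ∧ Set.InjOn f (Set.Icc a b) ∧
    f a = p ∧ f b = q ∧ f '' Set.Icc a b = S

/-- A drawing of `H` in the space `E` with vertex positions `pos` and edges `arc`. -/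
structure IsDrawing {V E : Type*} [TopologicalSpace E] (H : (⊤ : SimpleGraph V).Subgraph)
    (pos : V → E) (arc : Sym2 V → Set E) : Prop where
  pos_injOn : Set.InjOn pos H.verts
  isArc : ∀ u v, H.Adj u v → IsJordanArc (arc s(u, v)) (pos u) (pos v)
  vertex_mem_arc : ∀ e ∈ H.edgeSet, ∀ w ∈ H.verts, pos w ∈ arc e → w ∈ e
  arc_inter_arc : ∀ e ∈ H.edgeSet, ∀ f ∈ H.edgeSet, e ≠ f →
    arc e ∩ arc f ⊆ pos '' {v | v ∈ e ∧ v ∈ f}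

section JordanArc

variable {E : Type*} [TopologicalSpace E]

theorem IsJordanArc.isCompact {S : Set E} {p q : E} (h : IsJordanArc S p q) : IsCompact S := by
  obtain ⟨f, a, b, -, hc, -, -, -, rfl⟩ := h
  exact isCompact_Icc.image_of_continuousOn hc

theorem IsJordanArc.symm {S : Set E} {p q : E} (h : IsJordanArc S p q) : IsJordanArc S q p := by
  obtain ⟨f, a, b, hab, hc, hi, rfl, rfl, rfl⟩ := h
  have hm : Set.MapsTo (fun t : ℝ => -t) (Set.Icc (-b) (-a)) (Set.Icc a b) := by
    intro t ht
    exact ⟨by linarith [ht.2], by linarith [ht.1]⟩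
  refine ⟨fun t => f (-t), -b, -a, by linarith, hc.comp continuous_neg.continuousOn hm, ?_,
    by simp, by simp, ?_⟩
  · intro s hs t ht hst
    exact neg_injective (hi (hm hs) (hm ht) hst)
  · ext z
    constructor
    · rintro ⟨t, ht, rfl⟩
      exact ⟨-t, hm ht, rfl⟩
    · rintro ⟨t, ht, rfl⟩
      exact ⟨-t, ⟨by linarith [ht.2], by linarith [ht.1]⟩, by simp⟩

theorem IsJordanArc.map {E' : Type*} [TopologicalSpace E'] {S T : Set E} {p q : E}
    (h : IsJordanArc S p q) {φ : E → E'} (hST : S ⊆ T) (hc : ContinuousOn φ T)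
    (hi : Set.InjOn φ T) : IsJordanArc (φ '' S) (φ p) (φ q) := by
  obtain ⟨f, a, b, hab, hfc, hfi, rfl, rfl, rfl⟩ := h
  have hm : Set.MapsTo f (Set.Icc a b) T := fun t ht => hST ⟨t, ht, rfl⟩
  exact ⟨φ ∘ f, a, b, hab, hc.comp hfc hm, hi.comp hfi hm, rfl, rfl, Set.image_comp _ _ _⟩

theorem isJordanArc_range_path {p q : E} (γ : Path p q) (hγ : Function.Injective γ) :
    IsJordanArc (Set.range γ) p q := by
  refine ⟨γ.extend, 0, 1, one_pos, γ.continuous_extend.continuousOn, ?_, by simp, by simp, ?_⟩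
  · intro s hs t ht h
    rw [γ.extend_apply hs, γ.extend_apply ht] at h
    exact congrArg Subtype.val (hγ h)
  · ext z
    constructor
    · rintro ⟨t, ht, rfl⟩
      exact ⟨⟨t, ht⟩, (γ.extend_apply ht).symm⟩
    · rintro ⟨t, rfl⟩
      exact ⟨t, t.2, by simp⟩

theorem IsJordanArc.exists_path {S : Set E} {p q : E} (h : IsJordanArc S p q) :
    ∃ γ : Path p q, Function.Injective γ ∧ Set.range γ = S := by
  obtain ⟨f, a, b, hab, hc, hi, rfl, rfl, rfl⟩ := h
  have hba : 0 < b - a := sub_pos.2 hab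
  have hm : ∀ t : unitInterval, a + (b - a) * t ∈ Set.Icc a b := fun t =>
    ⟨by nlinarith [t.2.1], by nlinarith [t.2.2]⟩
  refine ⟨⟨⟨fun t : unitInterval => f (a + (b - a) * t), ?_⟩, by simp, by simp⟩, ?_, ?_⟩
  · exact hc.comp_continuous (by fun_prop) hm
  · intro s t hst
    have h1 := hi (hm s) (hm t) hst
    have h2 : (b - a) * (s : ℝ) = (b - a) * t := by linarith
    exact Subtype.ext (mul_left_cancel₀ hba.ne' h2)
  · ext z
    constructor
    · rintro ⟨t, rfl⟩
      exact ⟨_, hm t, rfl⟩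
    · rintro ⟨t, ht, rfl⟩
      refine ⟨⟨(t - a) / (b - a), div_nonneg (by linarith [ht.1]) hba.le,
        (div_le_one hba).2 (by linarith [ht.2])⟩, ?_⟩
      change f (a + (b - a) * ((t - a) / (b - a))) = f t
      congr 1
      field_simp
      ring

end JordanArc

theorem IsArc.isJordanArc {S : Set Plane} {p q : Plane} (h : IsArc S p q) : IsJordanArc S p q := by
  obtain ⟨γ, hγ, rfl⟩ := h
  exact isJordanArc_range_path γ hγ

theorem PlanarDrawing.isDrawing {V : Type*} {H : (⊤ : SimpleGraph V).Subgraph}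
    (D : PlanarDrawing H) : IsDrawing H D.pos D.arc :=
  ⟨D.pos_injOn, fun u v h => (D.isArc u v h).isJordanArc, D.vertex_mem_arc, D.arc_inter_arc⟩

namespace IsDrawing

variable {V E : Type*} [TopologicalSpace E] {H : (⊤ : SimpleGraph V).Subgraph}
  {pos : V → E} {arc : Sym2 V → Set E}

/-- A planar drawing in the sense of `PlanarDrawing`. -/
def toPlanarDrawing {pos : V → Plane} {arc : Sym2 V → Set Plane} (h : IsDrawing H pos arc) :
    PlanarDrawing H :=
  ⟨pos, arc, h.pos_injOn, fun u v huv => (h.isArc u v huv).exists_path, h.vertex_mem_arc,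
    h.arc_inter_arc⟩

theorem mono {H' : (⊤ : SimpleGraph V).Subgraph} (h : IsDrawing H pos arc) (hle : H' ≤ H) :
    IsDrawing H' pos arc where
  pos_injOn := h.pos_injOn.mono hle.1
  isArc u v huv := h.isArc u v (hle.2 huv)
  vertex_mem_arc e he w hw := h.vertex_mem_arc e (SimpleGraph.Subgraph.edgeSet_mono hle he) w
    (hle.1 hw)
  arc_inter_arc e he f hf := h.arc_inter_arc e (SimpleGraph.Subgraph.edgeSet_mono hle he) f
    (SimpleGraph.Subgraph.edgeSet_mono hle hf)

theorem congr {pos' : V → E} {arc' : Sym2 V → Set E} (h : IsDrawing H pos arc)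
    (hpos : ∀ v ∈ H.verts, pos' v = pos v) (harc : ∀ e ∈ H.edgeSet, arc' e = arc e) :
    IsDrawing H pos' arc' where
  pos_injOn := h.pos_injOn.congr fun v hv => (hpos v hv).symm
  isArc u v huv := by
    rw [harc s(u, v) huv, hpos u huv.fst_mem, hpos v huv.snd_mem]
    exact h.isArc u v huv
  vertex_mem_arc e he w hw := by
    rw [harc e he, hpos w hw]
    exact h.vertex_mem_arc e he w hw
  arc_inter_arc e he f hf hef := by
    rw [harc e he, harc f hf]
    refine (h.arc_inter_arc e he f hf hef).trans ?_
    rintro _ ⟨v, ⟨hve, hvf⟩, rfl⟩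
    exact ⟨v, ⟨hve, hvf⟩, hpos v (H.mem_verts_of_mem_edge he hve)⟩

theorem isCompact_arc (h : IsDrawing H pos arc) {e : Sym2 V} (he : e ∈ H.edgeSet) :
    IsCompact (arc e) := by
  induction e with | _ u v => exact (h.isArc u v he).isCompact

/-- Continuity and injectivity are asked for only on a set that contains the drawing, because
`halfPlaneMap` is used only off a slit. -/
theorem map {E' : Type*} [TopologicalSpace E'] (h : IsDrawing H pos arc) {T : Set E} {φ : E → E'}
    (hpos : ∀ v ∈ H.verts, pos v ∈ T) (harc : ∀ e ∈ H.edgeSet, arc e ⊆ T)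
    (hc : ContinuousOn φ T) (hi : Set.InjOn φ T) :
    IsDrawing H (fun v => φ (pos v)) (fun e => φ '' arc e) where
  pos_injOn u hu v hv huv := h.pos_injOn hu hv (hi (hpos u hu) (hpos v hv) huv)
  isArc u v huv := (h.isArc u v huv).map (harc s(u, v) huv) hc hi
  vertex_mem_arc := by
    rintro e he w hw ⟨z, hz, hzw⟩
    rw [hi (harc e he hz) (hpos w hw) hzw] at hz
    exact h.vertex_mem_arc e he w hw hz
  arc_inter_arc := by
    rintro e he f hf hef _ ⟨⟨z, hz, rfl⟩, z', hz', hzz⟩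
    rw [hi (harc f hf hz') (harc e he hz) hzz] at hz'
    obtain ⟨v, hv, rfl⟩ := h.arc_inter_arc e he f hf hef ⟨hz, hz'⟩
    exact ⟨v, hv, rfl⟩

end IsDrawing

namespace SefeInstance

variable {V : Type*}

/-- A simultaneous embedding, with one map for the positions and one map for the arcs of both
graphs. -/
def IsSefe {E : Type*} [TopologicalSpace E] (I : SefeInstance V) (pos : V → E)
    (arc : Sym2 V → Set E) : Prop :=
  IsDrawing I.G₁ pos arc ∧ IsDrawing I.G₂ pos arc

/-- Two drawings that agree on the common graph merge into one pair of maps. The compatibility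
condition then disappears, and any modification of these maps acts on both graphs consistently. -/
theorem admitsSefe_iff_plane (I : SefeInstance V) :
    I.AdmitsSefe ↔ ∃ (pos : V → Plane) (arc : Sym2 V → Set Plane), I.IsSefe pos arc := by
  classical
  constructor
  · rintro ⟨D₁, D₂, hpos, harc⟩
    refine ⟨fun v => if v ∈ I.G₁.verts then D₁.pos v else D₂.pos v,
      fun e => if e ∈ I.G₁.edgeSet then D₁.arc e else D₂.arc e,
      D₁.isDrawing.congr (fun v hv => if_pos hv) (fun e he => if_pos he),
      D₂.isDrawing.congr (fun v hv => ?_) (fun e he => ?_)⟩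
    · split_ifs with h
      · exact hpos v ⟨h, hv⟩
      · rfl
    · split_ifs with h
      · refine harc e ?_
        rw [common, SimpleGraph.Subgraph.edgeSet_inf]
        exact ⟨h, he⟩
      · rfl
  · rintro ⟨pos, arc, h₁, h₂⟩
    exact ⟨h₁.toPlanarDrawing, h₂.toPlanarDrawing, fun _ _ => rfl, fun _ _ => rfl⟩

theorem IsSefe.map_homeomorph {E E' : Type*} [TopologicalSpace E] [TopologicalSpace E']
    {I : SefeInstance V} {pos : V → E} {arc : Sym2 V → Set E} (h : I.IsSefe pos arc)
    (φ : E ≃ₜ E') : I.IsSefe (fun v => φ (pos v)) (fun e => φ '' arc e) :=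
  ⟨h.1.map (T := Set.univ) (by simp) (by simp) φ.continuous.continuousOn φ.injective.injOn,
    h.2.map (T := Set.univ) (by simp) (by simp) φ.continuous.continuousOn φ.injective.injOn⟩

/-- The complex plane is needed for the square root that opens the slit. -/
theorem admitsSefe_iff (I : SefeInstance V) :
    I.AdmitsSefe ↔ ∃ (pos : V → ℂ) (arc : Sym2 V → Set ℂ), I.IsSefe pos arc := by
  rw [admitsSefe_iff_plane]
  let φ : ℂ ≃ₜ Plane := Complex.orthonormalBasisOneI.repr.toHomeomorph
  constructor
  · rintro ⟨pos, arc, h⟩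
    exact ⟨_, _, h.map_homeomorph φ.symm⟩
  · rintro ⟨pos, arc, h⟩
    exact ⟨_, _, h.map_homeomorph φ⟩

theorem restrict_mono {I : SefeInstance V} {A B : (⊤ : SimpleGraph V).Subgraph} (h : A ≤ B)
    (hB : (I.restrict B).AdmitsSefe) : (I.restrict A).AdmitsSefe := by
  rw [admitsSefe_iff] at *
  obtain ⟨pos, arc, h₁, h₂⟩ := hB
  exact ⟨pos, arc, h₁.mono (inf_le_inf_left _ h), h₂.mono (inf_le_inf_left _ h)⟩

theorem union_restrict {I : SefeInstance V} {B : (⊤ : SimpleGraph V).Subgraph}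
    (h : B ≤ I.union) : (I.restrict B).union = B := by
  change (I.G₁ ⊓ B) ⊔ (I.G₂ ⊓ B) = B
  rw [← inf_sup_right]
  exact inf_eq_right.2 h

theorem restrict_union (I : SefeInstance V) : I.restrict I.union = I := by
  ext1
  · exact inf_eq_left.2 le_sup_left
  · exact inf_eq_left.2 le_sup_right

end SefeInstance

/-! ### Jordan arcs in the plane -/

/-- Among three points with distinct values, one value lies strictly between the others. Without
that point the plane is still connected, so the value is attained a second time. -/
theorem Complex.not_injective_of_continuous_real {g : ℂ → ℝ} (hg : Continuous g) :
    ¬ Function.Injective g := by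
  intro hi
  have key : ∀ x y z : ℂ, g x < g y → g y < g z → False := by
    intro x y z hxy hyz
    have hc : IsPreconnected ({y}ᶜ : Set ℂ) :=
      (isConnected_compl_singleton_of_one_lt_rank (by simp) y).isPreconnected
    have ho := (hc.image g hg.continuousOn).ordConnected
    obtain ⟨w, hw, hwy⟩ := ho.out ⟨x, by rintro rfl; exact lt_irrefl _ hxy, rfl⟩
      ⟨z, by rintro rfl; exact lt_irrefl _ hyz, rfl⟩ ⟨hxy.le, hyz.le⟩
    exact hw (hi hwy)
  have h01 : g 0 ≠ g 1 := hi.ne zero_ne_one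
  have h02 : g 0 ≠ g 2 := hi.ne two_ne_zero.symm
  have h12 : g 1 ≠ g 2 := hi.ne (by norm_num)
  rcases lt_or_gt_of_ne h01 with a | a <;> rcases lt_or_gt_of_ne h02 with b | b <;>
    rcases lt_or_gt_of_ne h12 with c | c <;>
    first
      | exact key _ _ _ a c
      | exact key _ _ _ c a
      | exact key _ _ _ a b
      | exact key _ _ _ b a
      | exact key _ _ _ b c
      | exact key _ _ _ c b

/-- A disc inside an arc would be parametrized by the whole plane through
`OpenPartialHomeomorph.univBall`. The inverse of the arc's parametrization would turn this into a
continuous injection of the plane into an interval. -/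
theorem IsJordanArc.interior_eq_empty {S : Set ℂ} {p q : ℂ} (h : IsJordanArc S p q) :
    interior S = ∅ := by
  obtain ⟨γ, hγ, rfl⟩ := h.exists_path
  by_contra hne
  obtain ⟨z, hz⟩ := Set.nonempty_iff_ne_empty.2 hne
  obtain ⟨r, hr, hball⟩ := Metric.isOpen_iff.1 isOpen_interior z hz
  let φ := (γ.continuous.isClosedEmbedding hγ).isEmbedding.toHomeomorph
  have hmem : ∀ w : ℂ, OpenPartialHomeomorph.univBall z r w ∈ Set.range γ := fun w => by
    have := (OpenPartialHomeomorph.univBall z r).map_source (x := w) (by simp)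
    rw [OpenPartialHomeomorph.univBall_target z hr] at this
    exact interior_subset (hball this)
  let g : ℂ → ℝ := fun w => (φ.symm ⟨_, hmem w⟩ : unitInterval)
  have hg : Continuous g :=
    continuous_subtype_val.comp (φ.symm.continuous.comp
      ((OpenPartialHomeomorph.continuous_univBall z r).subtype_mk hmem))
  refine Complex.not_injective_of_continuous_real hg fun a b hab => ?_
  have h1 := congrArg Subtype.val (φ.symm.injective (Subtype.ext hab))
  exact (OpenPartialHomeomorph.univBall z r).injOn (by simp) (by simp) h1

theorem interior_biUnion_eq_empty {X ι : Type*} [TopologicalSpace X] {s : Set ι} (hs : s.Finite)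
    {f : ι → Set X} (hc : ∀ i ∈ s, IsClosed (f i)) (hi : ∀ i ∈ s, interior (f i) = ∅) :
    interior (⋃ i ∈ s, f i) = ∅ := by
  induction s, hs using Set.Finite.induction_on with
  | empty => simp
  | @insert a s _ hs ih =>
    rw [Set.biUnion_insert, interior_union_isClosed_of_interior_empty (hc a (by simp))
      (ih (fun i hi => hc i (by simp [hi])) (fun i his => hi i (by simp [his])))]
    exact hi a (by simp)

/-- A Jordan arc from the centre of a closed disc to a point outside can be rerouted within the disc
so that it starts at a given inner point and leaves the disc by a straight segment. -/
theorem IsJordanArc.exists_reroute {S : Set ℂ} {p u c : ℂ} {r : ℝ} (h : IsJordanArc S p u)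
    (hu : u ∉ Metric.closedBall p r) (hc : c ∈ Metric.ball p r) :
    ∃ (S' : Set ℂ) (q : ℂ), q ∈ S ∧ dist q p = r ∧ IsJordanArc S' c u ∧
      S' ⊆ segment ℝ c q ∪ (S \ Metric.closedBall p r) := by
  obtain ⟨f, a, b, hab, hfc, hfi, rfl, rfl, rfl⟩ := h
  set p := f a
  have hr : 0 < r := dist_nonneg.trans_lt hc
  -- The last parameter `t₀` at which the arc lies in the closed disc exists by compactness. The
  -- part after `t₀` is kept and everything before it is discarded, however often it crosses the
  -- circle.
  have hT : IsCompact (Set.Icc a b ∩ f ⁻¹' Metric.closedBall p r) :=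
    isCompact_Icc.of_isClosed_subset
      (hfc.preimage_isClosed_of_isClosed isClosed_Icc Metric.isClosed_closedBall)
      Set.inter_subset_left
  obtain ⟨t₀, ⟨ht₀, ht₀r⟩, hmax⟩ := hT.exists_isGreatest
    ⟨a, Set.left_mem_Icc.2 hab.le, Metric.mem_closedBall_self hr.le⟩
  have hout : ∀ t ∈ Set.Icc a b, t₀ < t → f t ∉ Metric.closedBall p r := fun t ht h h' =>
    (hmax ⟨ht, h'⟩).not_gt h
  have ht₀b : t₀ < b := lt_of_le_of_ne ht₀.2 (by rintro rfl; exact hu ht₀r)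
  have hq : dist (f t₀) p = r := by
    -- `f t₀` is a limit of points outside the disc, so it lies on the circle.
    refine le_antisymm ht₀r ?_
    have hcl : IsClosed {z : ℂ | r ≤ dist z p} := isClosed_le continuous_const (by fun_prop)
    have hsub : Set.Ioc t₀ b ⊆ Set.Icc a b := fun t ht => ⟨ht₀.1.trans ht.1.le, ht.2⟩
    have h1 : ContinuousWithinAt f (Set.Ioc t₀ b) t₀ := (hfc t₀ ht₀).mono hsub
    have h2 := h1.mem_closure (t := {z : ℂ | r ≤ dist z p})
      (by rw [closure_Ioc ht₀b.ne]; exact Set.left_mem_Icc.2 ht₀b.le)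
      (fun t ht => by
        have := hout t (hsub ht) ht.1
        rw [Metric.mem_closedBall, not_le] at this
        exact this.le)
    rwa [hcl.closure_eq] at h2
  have hcq : c ≠ f t₀ := by
    rintro rfl
    exact (Metric.mem_ball.1 hc).ne hq
  -- The segment is run through on `[t₀ - 1, t₀]`, so that the rest of the arc keeps its parameters.
  set g : ℝ → ℂ := fun t => if t ≤ t₀ then AffineMap.lineMap c (f t₀) (t - (t₀ - 1)) else f t
    with hg
  have hg1 : ∀ t ≤ t₀, g t = AffineMap.lineMap c (f t₀) (t - (t₀ - 1)) := fun t ht => if_pos ht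
  have hg2 : ∀ t, t₀ ≤ t → g t = f t := by
    intro t ht
    rcases ht.eq_or_lt with rfl | ht
    · rw [hg1 _ le_rfl]
      simp
    · exact if_neg ht.not_ge
  have hseg : ∀ t ∈ Set.Icc (t₀ - 1) t₀, g t ∈ segment ℝ c (f t₀) := by
    intro t ht
    rw [hg1 t ht.2, segment_eq_image_lineMap]
    exact ⟨_, ⟨by linarith [ht.1], by linarith [ht.2]⟩, rfl⟩
  have hball : segment ℝ c (f t₀) ⊆ Metric.closedBall p r :=
    (convex_closedBall p r).segment_subset (Metric.ball_subset_closedBall hc) ht₀r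
  have hunion : Set.Icc (t₀ - 1) b = Set.Icc (t₀ - 1) t₀ ∪ Set.Icc t₀ b :=
    (Set.Icc_union_Icc_eq_Icc (by linarith) ht₀b.le).symm
  have hsub : Set.Icc t₀ b ⊆ Set.Icc a b := Set.Icc_subset_Icc_left ht₀.1
  refine ⟨g '' Set.Icc (t₀ - 1) b, f t₀, ⟨t₀, ht₀, rfl⟩, hq,
    ⟨g, t₀ - 1, b, by linarith, ?_, ?_, by rw [hg1 _ (by linarith)]; simp, hg2 b ht₀b.le, rfl⟩, ?_⟩
  · rw [hunion]
    refine ContinuousOn.union_of_isClosed ?_ ?_ isClosed_Icc isClosed_Icc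
    · refine ContinuousOn.congr (f := fun t => AffineMap.lineMap c (f t₀) (t - (t₀ - 1))) ?_
        fun t ht => hg1 t ht.2
      exact (AffineMap.lineMap_continuous.comp (by fun_prop)).continuousOn
    · exact (hfc.mono hsub).congr fun t ht => hg2 t ht.1
  · have hcross : ∀ s ∈ Set.Icc (t₀ - 1) b, ∀ t ∈ Set.Icc (t₀ - 1) b, s ≤ t₀ → t₀ < t →
        g s ≠ g t := by
      intro s hs t ht hs' ht' h
      rw [hg2 t ht'.le] at h
      exact hout t (hsub ⟨ht'.le, ht.2⟩) ht' (h ▸ hball (hseg s ⟨hs.1, hs'⟩))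
    intro s hs t ht hst
    rcases le_or_gt s t₀ with hs' | hs' <;> rcases le_or_gt t t₀ with ht' | ht'
    · rw [hg1 s hs', hg1 t ht'] at hst
      have := AffineMap.lineMap_injective ℝ hcq hst
      linarith
    · exact absurd hst (hcross s hs t ht hs' ht')
    · exact absurd hst.symm (hcross t ht s hs ht' hs')
    · rw [hg2 s hs'.le, hg2 t ht'.le] at hst
      exact hfi (hsub ⟨hs'.le, hs.2⟩) (hsub ⟨ht'.le, ht.2⟩) hst
  · rintro _ ⟨t, ht, rfl⟩
    rcases le_or_gt t t₀ with ht' | ht'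
    · exact Or.inl (hseg t ⟨ht.1, ht'⟩)
    · rw [hg2 t ht'.le]
      have := hsub ⟨ht'.le, ht.2⟩
      exact Or.inr ⟨⟨t, this, rfl⟩, hout t this ht'⟩

/-- Two segments from an inner point of a disc to different boundary points meet only in that
point. -/
theorem segment_inter_segment_of_mem_ball {p c q q' z : ℂ} {r : ℝ} (hc : c ∈ Metric.ball p r)
    (hq : dist q p = r) (hq' : dist q' p = r) (hne : q ≠ q') (hz : z ∈ segment ℝ c q)
    (hz' : z ∈ segment ℝ c q') : z = c := by
  rw [segment_eq_image_lineMap] at hz hz'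
  obtain ⟨s, hs, rfl⟩ := hz
  obtain ⟨t, ht, hst⟩ := hz'
  simp only [AffineMap.lineMap_apply, vsub_eq_sub, vadd_eq_add] at hst ⊢
  have hst' : t • (q' - c) = s • (q - c) := add_right_cancel hst
  by_contra hsc
  have hs0 : 0 < s := lt_of_le_of_ne hs.1 (by rintro rfl; simp at hsc)
  have ht0 : 0 < t := lt_of_le_of_ne ht.1 (by
    rintro rfl
    rw [zero_smul] at hst'
    exact hsc (by rw [← hst', zero_add]))
  -- If the segments share a point other than `c`, then they have the same direction, and the
  -- shorter one ends in the open segment from `c` to the end of the longer one. By convexity that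
  -- point is interior to the disc, not on the circle.
  have key : ∀ (x y : ℂ) (s t : ℝ), 0 < s → 0 < t → dist x p = r → dist y p = r →
      t • (y - c) = s • (x - c) → s < t → False := by
    intro x y s t hs ht hx hy h hlt
    have h1 : y = AffineMap.lineMap c x (s / t) := by
      simp only [AffineMap.lineMap_apply, vsub_eq_sub, vadd_eq_add]
      rw [div_eq_inv_mul, mul_smul, ← h, smul_smul, inv_mul_cancel₀ ht.ne', one_smul,
        sub_add_cancel]
    have h2 : y ∈ interior (Metric.closedBall p r) := by
      refine (convex_closedBall p r).openSegment_interior_self_subset_interior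
        (Metric.ball_subset_interior_closedBall hc) (Metric.mem_closedBall.2 hx.le) ?_
      rw [openSegment_eq_image_lineMap, h1]
      exact ⟨_, ⟨div_pos hs ht, (div_lt_one ht).2 hlt⟩, rfl⟩
    rw [interior_closedBall p (dist_nonneg.trans_lt hc).ne'] at h2
    exact (Metric.mem_ball.1 h2).ne hy
  rcases lt_trichotomy s t with h | rfl | h
  · exact key q q' s t hs0 ht0 hq hq' hst' h
  · exact hne (sub_left_injective (smul_right_injective ℂ hs0.ne' hst'.symm))
  · exact key q' q t s ht0 hs0 hq' hq hst'.symm h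

/-- From every point there starts a short segment that avoids finitely many given segments from the
same point. -/
theorem exists_segment_avoiding (c : ℂ) {Q : Set ℂ} (hQ : Q.Finite) {ρ : ℝ} (hρ : 0 < ρ) :
    ∃ d : ℂ, d ≠ 0 ∧ ‖d‖ < ρ ∧ ∀ t ∈ Set.Icc (0 : ℝ) 1, ∀ q ∈ Q, c + t * d ∈ segment ℝ c q →
      c + t * d = c := by
  -- The directions `1 + k * I` have infinitely many slopes, and each given segment forbids at most
  -- one. For vertical segments the quotient is the default value 0; excluding it is harmless, since
  -- `1 + k * I` is never vertical.
  have hinf : (Set.range (fun k : ℕ => (k : ℝ))).Infinite :=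
    Set.infinite_range_of_injective Nat.cast_injective
  obtain ⟨_, ⟨k, rfl⟩, hk⟩ := (hinf.sdiff
    (hQ.image fun q => (q - c).im / (q - c).re)).nonempty
  have hk0 : (1 + k * Complex.I : ℂ) ≠ 0 := by
    intro h
    simpa using congrArg Complex.re h
  have hn : 0 < ‖(1 + k * Complex.I : ℂ)‖ := norm_pos_iff.2 hk0
  set δ : ℝ := ρ / 2 / ‖(1 + k * Complex.I : ℂ)‖ with hδ
  have hδ0 : 0 < δ := by positivity
  refine ⟨δ * (1 + k * Complex.I), mul_ne_zero (by exact_mod_cast hδ0.ne') hk0, ?_, ?_⟩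
  · rw [norm_mul, Complex.norm_real, Real.norm_of_nonneg hδ0.le, hδ, div_mul_cancel₀ _ hn.ne']
    linarith
  · intro t ht q hq hmem
    rcases ht.1.eq_or_lt with rfl | ht0
    · simp
    exfalso
    rw [segment_eq_image_lineMap] at hmem
    obtain ⟨s, hs, hst⟩ := hmem
    simp only [AffineMap.lineMap_apply, vsub_eq_sub, vadd_eq_add] at hst
    have h1 : s • (q - c) = t * (δ * (1 + k * Complex.I)) := by
      rw [add_comm] at hst
      exact add_left_cancel hst
    have hre := congrArg Complex.re h1
    have him := congrArg Complex.im h1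
    simp [-Complex.sub_re, -Complex.sub_im] at hre him
    have htδ : 0 < t * δ := mul_pos ht0 hδ0
    have hs0 : s ≠ 0 := by
      rintro rfl
      rw [zero_mul] at hre
      exact htδ.ne hre
    have hre0 : (q - c).re ≠ 0 := by
      intro h
      rw [h] at hre
      linarith
    refine hk ⟨q, hq, ?_⟩
    change (q - c).im / (q - c).re = k
    rw [div_eq_iff hre0]
    apply mul_left_cancel₀ hs0
    rw [him]
    calc t * (δ * k) = k * (t * δ) := by ring
      _ = k * (s * (q - c).re) := by rw [hre]
      _ = _ := by ring

/-- The complement of the segment from `c` to `c + d`. -/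
def slitComplement (c d : ℂ) : Set ℂ :=
  {z | ∀ t ∈ Set.Icc (0 : ℝ) 1, z ≠ c + t * d}

/-- An injective continuous map that takes the complement of a slit into the right half plane and
the starting point of the slit to zero. -/
noncomputable def halfPlaneMap (c d z : ℂ) : ℂ :=
  ((z - c) / (z - (c + d))) ^ (2⁻¹ : ℂ)

theorem halfPlaneMap_self (c d : ℂ) : halfPlaneMap c d c = 0 := by
  simp [halfPlaneMap]

section HalfPlaneMap

variable {c d z : ℂ}

theorem sub_ne_zero_of_mem_slitComplement (hz : z ∈ slitComplement c d) :
    z - (c + d) ≠ 0 := fun h =>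
  hz 1 (by simp) (by push_cast; linear_combination h)

/-- The quotient takes a real value `x ≤ 0` only at `z = c + t * d` with `t = -x / (1 - x)`, and
this `t` lies in `[0, 1]`. -/
theorem div_mem_slitPlane_of_mem_slitComplement (hz : z ∈ slitComplement c d) :
    (z - c) / (z - (c + d)) ∈ Complex.slitPlane := by
  have h1 := sub_ne_zero_of_mem_slitComplement hz
  by_contra h
  rw [Complex.mem_slitPlane_iff_not_le_zero, not_not] at h
  obtain ⟨x, hx, hxw⟩ : ∃ x : ℝ, x ≤ 0 ∧ (z - c) / (z - (c + d)) = x := by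
    rw [Complex.le_def] at h
    exact ⟨_, h.1, Complex.ext rfl (by simpa using h.2)⟩
  rw [div_eq_iff h1] at hxw
  have hx1 : (1 - x : ℂ) ≠ 0 := by
    have : (1 - x : ℝ) ≠ 0 := by linarith
    exact_mod_cast this
  refine hz (-x / (1 - x)) ⟨div_nonneg (by linarith) (by linarith),
    (div_le_one (by linarith)).2 (by linarith)⟩ ?_
  push_cast
  field_simp
  linear_combination hxw

/-- The real part of the principal square root of `w` is the root of `(‖w‖ + w.re) / 2`, which
vanishes only on the nonpositive real axis. -/
theorem re_halfPlaneMap_pos (hz : z ∈ slitComplement c d) : 0 < (halfPlaneMap c d z).re := by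
  have hw := div_mem_slitPlane_of_mem_slitComplement hz
  rw [halfPlaneMap, Complex.cpow_inv_two_re]
  apply Real.sqrt_pos.2
  set w := (z - c) / (z - (c + d))
  have h1 : -w.re ≤ ‖w‖ := (neg_le_abs _).trans (Complex.abs_re_le_norm w)
  have h2 : -w.re ≠ ‖w‖ := by
    intro h
    rw [Complex.mem_slitPlane_iff] at hw
    have h3 : ‖w‖ ^ 2 = w.re ^ 2 + w.im ^ 2 := by
      rw [← Complex.normSq_eq_norm_sq, Complex.normSq_apply]
      ring
    rw [← h] at h3
    rcases hw with hw | hw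
    · linarith [norm_nonneg w]
    · exact hw (pow_eq_zero_iff two_ne_zero |>.1 (by linarith))
  have := lt_of_le_of_ne h1 h2
  linarith

/-- Off the slit the quotient stays in the domain of continuity of the principal power. The point
`c` needs a separate argument: there the base is 0, and continuity comes from the positive real part
of the exponent. -/
theorem continuousOn_halfPlaneMap (hd : d ≠ 0) :
    ContinuousOn (halfPlaneMap c d) (insert c (slitComplement c d)) := by
  intro z hz
  apply ContinuousAt.continuousWithinAt
  have h1 : z - (c + d) ≠ 0 := by
    rcases hz with rfl | hz
    · simpa using hd
    · exact sub_ne_zero_of_mem_slitComplement hz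
  have hdiv : ContinuousAt (fun z => (z - c) / (z - (c + d))) z :=
    ContinuousAt.div (by fun_prop) (by fun_prop) h1
  rcases hz with rfl | hz
  · have h := Complex.continuousAt_cpow_zero_of_re_pos (z := (2⁻¹ : ℂ)) (by norm_num)
    exact ContinuousAt.comp₂_of_eq (f := fun x : ℂ × ℂ => x.1 ^ x.2) h hdiv continuousAt_const
      (by simp)
  · exact ContinuousAt.cpow hdiv continuousAt_const (div_mem_slitPlane_of_mem_slitComplement hz)

/-- Squaring recovers the quotient, which is a Möbius transformation with determinant `-d`, up to a
choice of sign. -/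
theorem injOn_halfPlaneMap (hd : d ≠ 0) :
    Set.InjOn (halfPlaneMap c d) (insert c (slitComplement c d)) := by
  have h1 : ∀ z ∈ insert c (slitComplement c d), z - (c + d) ≠ 0 := by
    rintro z (rfl | hz)
    · simpa using hd
    · exact sub_ne_zero_of_mem_slitComplement hz
  intro x hx y hy hxy
  have h2 := congrArg (· ^ 2) hxy
  simp only [halfPlaneMap] at h2
  rw [← Nat.cast_ofNat (n := 2), Complex.cpow_nat_inv_pow _ two_ne_zero,
    Complex.cpow_nat_inv_pow _ two_ne_zero, div_eq_div_iff (h1 x hx) (h1 y hy)] at h2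
  exact mul_right_cancel₀ hd (by linear_combination -h2)

end HalfPlaneMap

/-! ### Simultaneous embeddings that are anchored at a vertex -/

namespace IsDrawing

variable {V : Type*} {H : (⊤ : SimpleGraph V).Subgraph} {pos : V → ℂ} {arc : Sym2 V → Set ℂ}

/-- The set of points that the vertices and edges other than `v` and its edges occupy is contained
in `T`, and so are the edges of `v` up to the point `c` of `v`. -/
structure IsAnchored (H : (⊤ : SimpleGraph V).Subgraph) (pos : V → ℂ) (arc : Sym2 V → Set ℂ)
    (v : V) (c : ℂ) (T : Set ℂ) : Prop where
  pos_eq : v ∈ H.verts → pos v = c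
  pos_mem : ∀ w ∈ H.verts, w ≠ v → pos w ∈ T
  arc_mem : ∀ e ∈ H.edgeSet, ∀ z ∈ arc e, z ∈ T ∨ (z = c ∧ v ∈ e)

/-- The points that a drawing occupies, except for the vertices and edges in the given sets. -/
def image (pos : V → ℂ) (arc : Sym2 V → Set ℂ) (W : Set V) (F : Set (Sym2 V)) : Set ℂ :=
  pos '' W ∪ ⋃ e ∈ F, arc e

theorem finite_edgeSet (hfin : H.verts.Finite) : H.edgeSet.Finite := by
  refine (Set.Finite.image (fun p : V × V => s(p.1, p.2)) (hfin.prod hfin)).subset ?_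
  intro e he
  induction e with | _ u w =>
  have he : H.Adj u w := he
  exact ⟨(u, w), ⟨he.fst_mem, he.snd_mem⟩, rfl⟩

theorem isClosed_image (h : IsDrawing H pos arc) (hfin : H.verts.Finite) {W : Set V}
    {F : Set (Sym2 V)} (hW : W ⊆ H.verts) (hF : F ⊆ H.edgeSet) :
    IsClosed (image pos arc W F) :=
  ((hfin.subset hW).image pos).isClosed.union
    (((finite_edgeSet hfin).subset hF).isClosed_biUnion
      fun _ he => (h.isCompact_arc (hF he)).isClosed)

theorem interior_image (h : IsDrawing H pos arc) (hfin : H.verts.Finite) :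
    interior (image pos arc H.verts H.edgeSet) = ∅ := by
  rw [image, interior_union_isClosed_of_interior_empty (hfin.image pos).isClosed]
  · exact interior_eq_empty_iff_dense_compl.2 ((hfin.image pos).countable.dense_compl ℝ)
  · refine interior_biUnion_eq_empty (finite_edgeSet hfin)
      (fun e he => (h.isCompact_arc he).isClosed) fun e he => ?_
    induction e with | _ u w => exact (h.isArc u w he).interior_eq_empty

open Classical in
/-- Moving the vertex `v` within a disc around it that meets no other vertex and no edge except for
those of `v`. -/
theorem reroute (h : IsDrawing H pos arc) {v : V} (hv : v ∈ H.verts) {r : ℝ} {c : ℂ}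
    (hc : c ∈ Metric.ball (pos v) r)
    (hpos : ∀ w ∈ H.verts, w ≠ v → pos w ∉ Metric.closedBall (pos v) r)
    (harc : ∀ e ∈ H.edgeSet, v ∉ e → ∀ z ∈ arc e, z ∉ Metric.closedBall (pos v) r)
    {A : Sym2 V → Set ℂ} {Q : Sym2 V → ℂ}
    (hA : ∀ u, H.Adj v u → Q s(v, u) ∈ arc s(v, u) ∧ dist (Q s(v, u)) (pos v) = r ∧
      IsJordanArc (A s(v, u)) c (pos u) ∧
      A s(v, u) ⊆ segment ℝ c (Q s(v, u)) ∪ (arc s(v, u) \ Metric.closedBall (pos v) r)) :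
    IsDrawing H (Function.update pos v c) (fun e => if v ∈ e then A e else arc e) := by
  have hcb : c ∈ Metric.closedBall (pos v) r := Metric.ball_subset_closedBall hc
  have hvb : pos v ∈ Metric.closedBall (pos v) r :=
    Metric.mem_closedBall_self (dist_nonneg.trans_lt hc).le
  have hne : ∀ w, w ≠ v → Function.update pos v c w = pos w := fun w hw =>
    Function.update_of_ne hw _ _
  -- Outside the disc the new arcs are parts of the old ones, so new intersections can arise only
  -- inside, where only edges at `v` are present.
  have hsub : ∀ e ∈ H.edgeSet, v ∈ e → ∀ z ∈ A e, z ∉ Metric.closedBall (pos v) r →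
      z ∈ arc e := by
    intro e he hve z hz hzr
    obtain ⟨u, rfl⟩ := Sym2.mem_iff_exists.1 hve
    obtain ⟨h1, h2, h3, h4⟩ := hA u he
    rcases h4 hz with hz | hz
    · refine absurd ((convex_closedBall _ _).segment_subset hcb ?_ hz) hzr
      exact Metric.mem_closedBall.2 h2.le
    · exact hz.1
  have hmix : ∀ e ∈ H.edgeSet, ∀ f ∈ H.edgeSet, v ∈ e → v ∉ f →
      A e ∩ arc f ⊆ Function.update pos v c '' {w | w ∈ e ∧ w ∈ f} := by
    rintro e he f hf hve hvf z ⟨hze, hzf⟩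
    obtain ⟨w, ⟨hwe, hwf⟩, rfl⟩ := h.arc_inter_arc e he f hf (by rintro rfl; exact hvf hve)
      ⟨hsub e he hve z hze (harc f hf hvf z hzf), hzf⟩
    exact ⟨w, ⟨hwe, hwf⟩, hne w (by rintro rfl; exact hvf hwf)⟩
  constructor
  · intro a ha b hb hab
    by_cases hav : a = v <;> by_cases hbv : b = v
    · rw [hav, hbv]
    · rw [hav, hne b hbv, Function.update_self] at hab
      exact absurd (hab ▸ hcb) (hpos b hb hbv)
    · rw [hbv, hne a hav, Function.update_self] at hab
      exact absurd (hab ▸ hcb) (hpos a ha hav)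
    · rw [hne a hav, hne b hbv] at hab
      exact h.pos_injOn ha hb hab
  · intro a b hab
    by_cases hav : a = v
    · subst hav
      rw [if_pos (Sym2.mem_mk_left _ _), Function.update_self, hne b hab.ne.symm]
      exact (hA b hab).2.2.1
    by_cases hbv : b = v
    · subst hbv
      rw [if_pos (Sym2.mem_mk_right _ _), Function.update_self, hne a hav, Sym2.eq_swap]
      exact (hA a hab.symm).2.2.1.symm
    rw [if_neg (by simp [Ne.symm hav, Ne.symm hbv]), hne a hav, hne b hbv]
    exact h.isArc a b hab
  · intro e he w hw hwe
    by_cases hve : v ∈ e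
    · by_cases hwv : w = v
      · exact hwv ▸ hve
      · simp only [if_pos hve, hne w hwv] at hwe
        exact h.vertex_mem_arc e he w hw (hsub e he hve _ hwe (hpos w hw hwv))
    · by_cases hwv : w = v
      · subst hwv
        simp only [if_neg hve, Function.update_self] at hwe
        exact absurd hcb (harc e he hve _ hwe)
      · simp only [if_neg hve, hne w hwv] at hwe
        exact h.vertex_mem_arc e he w hw hwe
  · intro e he f hf hef
    by_cases hve : v ∈ e <;> by_cases hvf : v ∈ f
    · simp only [if_pos hve, if_pos hvf]
      rintro z ⟨hze, hzf⟩
      by_cases hz : z ∈ Metric.closedBall (pos v) r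
      · refine ⟨v, ⟨hve, hvf⟩, ?_⟩
        rw [Function.update_self]
        obtain ⟨a, rfl⟩ := Sym2.mem_iff_exists.1 hve
        obtain ⟨b, rfl⟩ := Sym2.mem_iff_exists.1 hvf
        obtain ⟨ha1, ha2, -, ha4⟩ := hA a he
        obtain ⟨hb1, hb2, -, hb4⟩ := hA b hf
        refine (segment_inter_segment_of_mem_ball hc ha2 hb2 ?_
          ((ha4 hze).resolve_right fun h => h.2 hz) ((hb4 hzf).resolve_right fun h => h.2 hz)).symm
        -- If the exit points coincided, the old arcs would meet there. They meet only at the old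
        -- position of `v`, which is the centre of the disc and not on the circle.
        intro hQ
        obtain ⟨w, ⟨hwa, hwb⟩, hw⟩ := h.arc_inter_arc _ he _ hf hef ⟨ha1, hQ ▸ hb1⟩
        have hwv : w = v := by
          by_contra hwv
          have h1 := Sym2.mem_iff.1 hwa |>.resolve_left hwv
          have h2 := Sym2.mem_iff.1 hwb |>.resolve_left hwv
          exact hef (by rw [← h1, ← h2])
        rw [← hw, hwv, dist_self] at ha2
        rw [← ha2] at hc
        simp at hc
      · obtain ⟨w, ⟨hwe, hwf⟩, rfl⟩ := h.arc_inter_arc e he f hf hef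
          ⟨hsub e he hve z hze hz, hsub f hf hvf z hzf hz⟩
        exact ⟨w, ⟨hwe, hwf⟩, hne w (by rintro rfl; exact hz hvb)⟩
    · simp only [if_pos hve, if_neg hvf]
      exact hmix e he f hf hve hvf
    · simp only [if_neg hve, if_pos hvf]
      rw [Set.inter_comm]
      simpa only [and_comm] using hmix f hf e he hvf hve
    · simp only [if_neg hve, if_neg hvf]
      rintro z hz
      obtain ⟨w, ⟨hwe, hwf⟩, rfl⟩ := h.arc_inter_arc e he f hf hef hz
      exact ⟨w, ⟨hwe, hwf⟩, hne w (by rintro rfl; exact hve hwe)⟩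

/-- A vertex has a neighbourhood that meets no other vertex and no edge except for its own. -/
theorem isOpen_compl_image_and_mem (h : IsDrawing H pos arc) (hfin : H.verts.Finite) {v : V}
    (hv : v ∈ H.verts) :
    (image pos arc (H.verts \ {v}) {e ∈ H.edgeSet | v ∉ e})ᶜ ∈ nhds (pos v) := by
  refine (h.isClosed_image hfin Set.sdiff_subset (Set.sep_subset _ _)).isOpen_compl.mem_nhds ?_
  rintro (⟨w, hw, hwv⟩ | hmem)
  · exact hw.2 (h.pos_injOn hw.1 hv hwv)
  · simp only [Set.mem_iUnion] at hmem
    obtain ⟨e, he, hz⟩ := hmem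
    exact he.2 (h.vertex_mem_arc e he.1 v hv hz)

theorem IsAnchored.map {v : V} {c : ℂ} {T T' : Set ℂ} (h : IsAnchored H pos arc v c T)
    {φ : ℂ → ℂ} (hφ : Set.MapsTo φ T T') :
    IsAnchored H (fun w => φ (pos w)) (fun e => φ '' arc e) v (φ c) T' where
  pos_eq hv := congrArg φ (h.pos_eq hv)
  pos_mem w hw hwv := hφ (h.pos_mem w hw hwv)
  arc_mem := by
    rintro e he _ ⟨z, hz, rfl⟩
    rcases h.arc_mem e he z hz with hz | ⟨rfl, hve⟩
    · exact Or.inl (hφ hz)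
    · exact Or.inr ⟨rfl, hve⟩

theorem IsAnchored.pos_mem_insert {v : V} {c : ℂ} {T : Set ℂ} (h : IsAnchored H pos arc v c T)
    {w : V} (hw : w ∈ H.verts) : pos w ∈ insert c T := by
  by_cases hwv : w = v
  · subst hwv
    exact Or.inl (h.pos_eq hw)
  · exact Or.inr (h.pos_mem w hw hwv)

theorem IsAnchored.arc_subset_insert {v : V} {c : ℂ} {T : Set ℂ}
    (h : IsAnchored H pos arc v c T) {e : Sym2 V} (he : e ∈ H.edgeSet) :
    arc e ⊆ insert c T := fun z hz =>
  (h.arc_mem e he z hz).elim Or.inr fun h => Or.inl h.1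

end IsDrawing

namespace SefeInstance

open IsDrawing

variable {V : Type*} {I : SefeInstance V}

/-- A simultaneous embedding can be modified such that a given vertex lies at the end of a
segment that avoids everything else. -/
theorem IsSefe.exists_slit {pos : V → ℂ} {arc : Sym2 V → Set ℂ} (h : I.IsSefe pos arc)
    (hfin : I.union.verts.Finite) (v : V) :
    ∃ (pos' : V → ℂ) (arc' : Sym2 V → Set ℂ) (c d : ℂ), d ≠ 0 ∧ I.IsSefe pos' arc' ∧
      ∀ G, G = I.G₁ ∨ G = I.G₂ → IsAnchored G pos' arc' v c (slitComplement c d) := by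
  classical
  have hG : ∀ G, G = I.G₁ ∨ G = I.G₂ → IsDrawing G pos arc := by
    rintro G (rfl | rfl)
    exacts [h.1, h.2]
  have hGfin : ∀ G, G = I.G₁ ∨ G = I.G₂ → G.verts.Finite := by
    rintro G (rfl | rfl)
    exacts [hfin.subset Set.subset_union_left, hfin.subset Set.subset_union_right]
  -- a disc that meets only `v` and its edges, in the graphs that contain `v`
  obtain ⟨r, hr, hball⟩ : ∃ r > 0, ∀ G, G = I.G₁ ∨ G = I.G₂ → v ∈ G.verts →
      Disjoint (Metric.closedBall (pos v) r)
        (image pos arc (G.verts \ {v}) {e ∈ G.edgeSet | v ∉ e}) := by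
    have key : ∀ G, G = I.G₁ ∨ G = I.G₂ → ∃ r > 0, v ∈ G.verts →
        Disjoint (Metric.closedBall (pos v) r)
          (image pos arc (G.verts \ {v}) {e ∈ G.edgeSet | v ∉ e}) := by
      intro G hG'
      by_cases hv : v ∈ G.verts
      · obtain ⟨r, hr, hsub⟩ := Metric.nhds_basis_closedBall.mem_iff.1
          ((hG G hG').isOpen_compl_image_and_mem (hGfin G hG') hv)
        exact ⟨r, hr, fun _ => Set.subset_compl_iff_disjoint_right.1 hsub⟩
      · exact ⟨1, one_pos, fun h => absurd h hv⟩
    obtain ⟨r₁, hr₁, h₁⟩ := key _ (Or.inl rfl)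
    obtain ⟨r₂, hr₂, h₂⟩ := key _ (Or.inr rfl)
    refine ⟨min r₁ r₂, lt_min hr₁ hr₂, ?_⟩
    rintro G (rfl | rfl) hv
    · exact (h₁ hv).mono_left (Metric.closedBall_subset_closedBall (min_le_left _ _))
    · exact (h₂ hv).mono_left (Metric.closedBall_subset_closedBall (min_le_right _ _))
  have hpos : ∀ G, G = I.G₁ ∨ G = I.G₂ → v ∈ G.verts → ∀ w ∈ G.verts, w ≠ v →
      pos w ∉ Metric.closedBall (pos v) r := fun G hG' hv w hw hwv hmem =>
    Set.disjoint_left.1 (hball G hG' hv) hmem (Or.inl ⟨w, ⟨hw, hwv⟩, rfl⟩)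
  have harc : ∀ G, G = I.G₁ ∨ G = I.G₂ → v ∈ G.verts → ∀ e ∈ G.edgeSet, v ∉ e → ∀ z ∈ arc e,
      z ∉ Metric.closedBall (pos v) r := fun G hG' hv e he hve z hz hmem =>
    Set.disjoint_left.1 (hball G hG' hv) hmem (Or.inr (Set.mem_biUnion ⟨he, hve⟩ hz))
  -- the new position of `v` avoids the graphs that do not contain `v`
  obtain ⟨c, hc, ρ, hρ, hcρ⟩ : ∃ c ∈ Metric.ball (pos v) r, ∃ ρ > 0,
      ∀ G, G = I.G₁ ∨ G = I.G₂ → v ∉ G.verts →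
        Disjoint (Metric.ball c ρ) (image pos arc G.verts G.edgeSet) := by
    -- The graphs that contain `v` impose no condition here, as they are already controlled in the
    -- whole disc. The others are nowhere dense, so the disc contains a point off them.
    let X : (⊤ : SimpleGraph V).Subgraph → Set ℂ := fun G =>
      if v ∈ G.verts then ∅ else image pos arc G.verts G.edgeSet
    have hXc : ∀ G, G = I.G₁ ∨ G = I.G₂ → IsClosed (X G) := by
      intro G hG'
      by_cases hv : v ∈ G.verts
      · simp only [X, if_pos hv, isClosed_empty]
      · simp only [X, if_neg hv]
        exact (hG G hG').isClosed_image (hGfin G hG') subset_rfl subset_rfl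
    have hXi : ∀ G, G = I.G₁ ∨ G = I.G₂ → interior (X G) = ∅ := by
      intro G hG'
      by_cases hv : v ∈ G.verts
      · simp only [X, if_pos hv, interior_empty]
      · simp only [X, if_neg hv]
        exact (hG G hG').interior_image (hGfin G hG')
    have hi : interior (X I.G₁ ∪ X I.G₂) = ∅ := by
      rw [interior_union_isClosed_of_interior_empty (hXc _ (Or.inl rfl)) (hXi _ (Or.inr rfl)),
        hXi _ (Or.inl rfl)]
    obtain ⟨c, hc, hcX⟩ : ∃ c ∈ Metric.ball (pos v) r, c ∉ X I.G₁ ∪ X I.G₂ := by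
      by_contra! hcon
      have := interior_maximal hcon Metric.isOpen_ball
      rw [hi] at this
      exact this (Metric.mem_ball_self hr)
    obtain ⟨ρ, hρ, hsub⟩ := Metric.isOpen_iff.1
      ((hXc _ (Or.inl rfl)).union (hXc _ (Or.inr rfl))).isOpen_compl c hcX
    refine ⟨c, hc, ρ, hρ, fun G hG' hv => ?_⟩
    have hXG : X G ⊆ X I.G₁ ∪ X I.G₂ := by
      rcases hG' with rfl | rfl
      exacts [Set.subset_union_left, Set.subset_union_right]
    have := (Set.subset_compl_iff_disjoint_right.1 hsub).mono_right hXG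
    simpa only [X, if_neg hv] using this
  have hadj : ∀ G, G = I.G₁ ∨ G = I.G₂ → ∀ u, G.Adj v u → I.union.Adj v u := by
    rintro G (rfl | rfl) u hu
    exacts [Or.inl hu, Or.inr hu]
  -- the rerouted edges of `v`
  have hA : ∀ e : Sym2 V, ∃ (S : Set ℂ) (q : ℂ), ∀ u, e = s(v, u) → I.union.Adj v u →
      q ∈ arc s(v, u) ∧ dist q (pos v) = r ∧ IsJordanArc S c (pos u) ∧
        S ⊆ segment ℝ c q ∪ (arc s(v, u) \ Metric.closedBall (pos v) r) := by
    intro e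
    by_cases he : ∃ u, e = s(v, u) ∧ I.union.Adj v u
    · obtain ⟨u, rfl, hu⟩ := he
      obtain ⟨G, hG', huG⟩ : ∃ G, (G = I.G₁ ∨ G = I.G₂) ∧ G.Adj v u := by
        rcases hu with hu | hu
        exacts [⟨_, Or.inl rfl, hu⟩, ⟨_, Or.inr rfl, hu⟩]
      obtain ⟨S, q, hS⟩ := ((hG G hG').isArc v u huG).exists_reroute
        (hpos G hG' huG.fst_mem u huG.snd_mem huG.ne.symm) hc
      refine ⟨S, q, fun u' huu' _ => ?_⟩
      obtain rfl : u = u' := Sym2.congr_right.1 huu'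
      exact hS
    · exact ⟨∅, 0, fun u hu hadj => absurd ⟨u, hu, hadj⟩ he⟩
  -- The new arc depends on the edge alone and not on the graph, so a common edge is rerouted in the
  -- same way in both drawings.
  choose A Q hAQ using hA
  -- the slit
  obtain ⟨d, hd, hdρ, hdQ⟩ := exists_segment_avoiding c
    ((finite_edgeSet hfin).image Q) (lt_min hρ (sub_pos.2 (Metric.mem_ball.1 hc)))
  have hslit : ∀ t ∈ Set.Icc (0 : ℝ) 1, dist (c + t * d) c ≤ ‖d‖ := by
    intro t ht
    rw [dist_eq_norm, add_sub_cancel_left, norm_mul, Complex.norm_real,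
      Real.norm_of_nonneg ht.1]
    exact mul_le_of_le_one_left (norm_nonneg _) ht.2
  -- The slit is shorter than `ρ` and than the distance from `c` to the circle, so it lies in both
  -- discs.
  have hslit₁ : (Metric.closedBall (pos v) r)ᶜ ⊆ slitComplement c d := by
    rintro z hz t ht rfl
    refine hz (Metric.mem_closedBall.2 ?_)
    have := dist_triangle (c + t * d) c (pos v)
    have := hslit t ht
    have := hdρ.trans_le (min_le_right _ _)
    linarith
  have hslit₂ : (Metric.ball c ρ)ᶜ ⊆ slitComplement c d := by
    rintro z hz t ht rfl
    exact hz (Metric.mem_ball.2 ((hslit t ht).trans_lt (hdρ.trans_le (min_le_left _ _))))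
  have hdraw : ∀ G, G = I.G₁ ∨ G = I.G₂ →
      IsDrawing G (Function.update pos v c) (fun e => if v ∈ e then A e else arc e) := by
    intro G hG'
    by_cases hv : v ∈ G.verts
    · exact (hG G hG').reroute hv hc (hpos G hG' hv) (harc G hG' hv)
        fun u hu => hAQ _ u rfl (hadj G hG' u hu)
    · exact (hG G hG').congr
        (fun w hw => Function.update_of_ne (by rintro rfl; exact hv hw) _ _)
        (fun e he => if_neg fun hve => hv (G.mem_verts_of_mem_edge he hve))
  refine ⟨Function.update pos v c, fun e => if v ∈ e then A e else arc e, c, d, hd,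
    ⟨hdraw _ (Or.inl rfl), hdraw _ (Or.inr rfl)⟩, fun G hG' => ?_⟩
  by_cases hv : v ∈ G.verts
  · refine ⟨fun _ => Function.update_self _ _ _, fun w hw hwv => ?_, fun e he z hz => ?_⟩
    · rw [Function.update_of_ne hwv]
      exact hslit₁ (hpos G hG' hv w hw hwv)
    · by_cases hve : v ∈ e
      · simp only [if_pos hve] at hz
        obtain ⟨u, rfl⟩ := Sym2.mem_iff_exists.1 hve
        have hu := hadj G hG' u he
        rcases (hAQ _ u rfl hu).2.2.2 hz with hz | hz
        · by_cases hzc : z = c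
          · exact Or.inr ⟨hzc, hve⟩
          · refine Or.inl ?_
            rintro t ht rfl
            exact hzc (hdQ t ht _ ⟨s(v, u), hu, rfl⟩ hz)
        · exact Or.inl (hslit₁ hz.2)
      · simp only [if_neg hve] at hz
        exact Or.inl (hslit₁ (harc G hG' hv e he hve z hz))
  · refine ⟨fun h => absurd h hv, fun w hw hwv => ?_, fun e he z hz => Or.inl ?_⟩
    · rw [Function.update_of_ne hwv]
      exact hslit₂ fun hmem => Set.disjoint_left.1 (hcρ G hG' hv) hmem (Or.inl ⟨w, hw, rfl⟩)
    · have hve : v ∉ e := fun hve => hv (G.mem_verts_of_mem_edge he hve)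
      simp only [if_neg hve] at hz
      exact hslit₂ fun hmem => Set.disjoint_left.1 (hcρ G hG' hv) hmem
        (Or.inr (Set.mem_biUnion he hz))

/-- A simultaneous embedding can be modified such that it lies in the right half plane, except for
a given vertex, which lies at zero. -/
theorem AdmitsSefe.exists_halfPlane (h : I.AdmitsSefe) (hfin : I.union.verts.Finite) (v : V) :
    ∃ (pos : V → ℂ) (arc : Sym2 V → Set ℂ), I.IsSefe pos arc ∧
      ∀ G, G = I.G₁ ∨ G = I.G₂ → IsAnchored G pos arc v 0 {z | 0 < z.re} := by
  rw [admitsSefe_iff] at h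
  obtain ⟨pos, arc, h⟩ := h
  obtain ⟨pos, arc, c, d, hd, h, hanch⟩ := h.exists_slit hfin v
  have h₁ := hanch _ (Or.inl rfl)
  have h₂ := hanch _ (Or.inr rfl)
  refine ⟨fun w => halfPlaneMap c d (pos w), fun e => halfPlaneMap c d '' arc e,
    ⟨h.1.map (fun w hw => h₁.pos_mem_insert hw) (fun e he => h₁.arc_subset_insert he)
      (continuousOn_halfPlaneMap hd) (injOn_halfPlaneMap hd),
    h.2.map (fun w hw => h₂.pos_mem_insert hw) (fun e he => h₂.arc_subset_insert he)
      (continuousOn_halfPlaneMap hd) (injOn_halfPlaneMap hd)⟩, fun G hG' => ?_⟩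
  rw [← halfPlaneMap_self c d]
  exact (hanch G hG').map fun z hz => re_halfPlaneMap_pos hz

end SefeInstance

/-! ### Gluing simultaneous embeddings at a vertex -/

/-- Away from `c` the two drawings occupy disjoint sets, and in each of them only `v` and its edges
can contain `c`. Hence any point that they share is the position of `v`. -/
theorem IsDrawing.sup {V : Type*} {H₁ H₂ : (⊤ : SimpleGraph V).Subgraph} {pos : V → ℂ}
    {arc : Sym2 V → Set ℂ} {v : V} {c : ℂ} {T₁ T₂ : Set ℂ} (h₁ : IsDrawing H₁ pos arc)
    (h₂ : IsDrawing H₂ pos arc) (a₁ : IsDrawing.IsAnchored H₁ pos arc v c T₁)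
    (a₂ : IsDrawing.IsAnchored H₂ pos arc v c T₂) (hT : Disjoint T₁ T₂) (hc₁ : c ∉ T₁)
    (hc₂ : c ∉ T₂) : IsDrawing (H₁ ⊔ H₂) pos arc := by
  have hinj : ∀ {H H' : (⊤ : SimpleGraph V).Subgraph} {T T' : Set ℂ},
      IsDrawing.IsAnchored H pos arc v c T → IsDrawing.IsAnchored H' pos arc v c T' →
      Disjoint T T' → c ∉ T → c ∉ T' → ∀ x ∈ H.verts, ∀ y ∈ H'.verts, pos x = pos y → x = y := by
    intro H H' T T' a a' hT hc hc' x hx y hy hxy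
    by_cases hxv : x = v <;> by_cases hyv : y = v
    · rw [hxv, hyv]
    · subst hxv
      exact absurd (a.pos_eq hx ▸ hxy ▸ a'.pos_mem y hy hyv) hc'
    · subst hyv
      exact absurd (a'.pos_eq hy ▸ hxy ▸ a.pos_mem x hx hxv) hc
    · exact absurd (hxy ▸ a'.pos_mem y hy hyv) (Set.disjoint_left.1 hT (a.pos_mem x hx hxv))
  have hmem : ∀ {H H' : (⊤ : SimpleGraph V).Subgraph} {T T' : Set ℂ},
      IsDrawing.IsAnchored H pos arc v c T → IsDrawing.IsAnchored H' pos arc v c T' →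
      Disjoint T T' → c ∉ T → c ∉ T' → ∀ e ∈ H.edgeSet, ∀ w ∈ H'.verts, pos w ∈ arc e →
        w ∈ e := by
    intro H H' T T' a a' hT hc hc' e he w hw hwe
    by_cases hwv : w = v
    · subst hwv
      rcases a.arc_mem e he _ hwe with h | h
      · exact absurd (a'.pos_eq hw ▸ h) hc
      · exact h.2
    · have hwT := a'.pos_mem w hw hwv
      rcases a.arc_mem e he _ hwe with h | h
      · exact absurd hwT (Set.disjoint_left.1 hT h)
      · exact absurd (h.1 ▸ hwT) hc'
  have hinter : ∀ {H H' : (⊤ : SimpleGraph V).Subgraph} {T T' : Set ℂ},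
      IsDrawing.IsAnchored H pos arc v c T → IsDrawing.IsAnchored H' pos arc v c T' →
      Disjoint T T' → c ∉ T → c ∉ T' → ∀ e ∈ H.edgeSet, ∀ f ∈ H'.edgeSet,
        arc e ∩ arc f ⊆ pos '' {w | w ∈ e ∧ w ∈ f} := by
    rintro H H' T T' a a' hT hc hc' e he f hf z ⟨hze, hzf⟩
    rcases a.arc_mem e he z hze with h | ⟨rfl, hve⟩ <;>
      rcases a'.arc_mem f hf _ hzf with h' | ⟨h', hvf⟩
    · exact absurd h' (Set.disjoint_left.1 hT h)
    · exact absurd (h' ▸ h) hc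
    · exact absurd h' hc'
    · exact ⟨v, ⟨hve, hvf⟩, a.pos_eq (H.mem_verts_of_mem_edge he hve)⟩
  constructor
  · rintro x (hx | hx) y (hy | hy) hxy
    · exact h₁.pos_injOn hx hy hxy
    · exact hinj a₁ a₂ hT hc₁ hc₂ x hx y hy hxy
    · exact hinj a₂ a₁ hT.symm hc₂ hc₁ x hx y hy hxy
    · exact h₂.pos_injOn hx hy hxy
  · rintro x y (hxy | hxy)
    exacts [h₁.isArc x y hxy, h₂.isArc x y hxy]
  · intro e he w hw hwe
    rw [SimpleGraph.Subgraph.edgeSet_sup] at he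
    rcases he with he | he <;> rcases hw with hw | hw
    · exact h₁.vertex_mem_arc e he w hw hwe
    · exact hmem a₁ a₂ hT hc₁ hc₂ e he w hw hwe
    · exact hmem a₂ a₁ hT.symm hc₂ hc₁ e he w hw hwe
    · exact h₂.vertex_mem_arc e he w hw hwe
  · intro e he f hf hef
    rw [SimpleGraph.Subgraph.edgeSet_sup] at he hf
    rcases he with he | he <;> rcases hf with hf | hf
    · exact h₁.arc_inter_arc e he f hf hef
    · exact hinter a₁ a₂ hT hc₁ hc₂ e he f hf
    · exact hinter a₂ a₁ hT.symm hc₂ hc₁ e he f hf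
    · exact h₂.arc_inter_arc e he f hf hef

theorem IsDrawing.IsAnchored.congr {V : Type*} {H : (⊤ : SimpleGraph V).Subgraph}
    {pos pos' : V → ℂ} {arc arc' : Sym2 V → Set ℂ} {v : V} {c : ℂ} {T : Set ℂ}
    (h : IsDrawing.IsAnchored H pos arc v c T) (hpos : ∀ v ∈ H.verts, pos' v = pos v)
    (harc : ∀ e ∈ H.edgeSet, arc' e = arc e) : IsDrawing.IsAnchored H pos' arc' v c T where
  pos_eq hv := (hpos v hv).trans (h.pos_eq hv)
  pos_mem w hw hwv := by
    rw [hpos w hw]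
    exact h.pos_mem w hw hwv
  arc_mem e he := by
    rw [harc e he]
    exact h.arc_mem e he

namespace SefeInstance

/-- One embedding is placed in the right half plane and the negative of the other in the left one,
with `v` at 0 in both. Each of the two graphs of the instance is then glued separately by
`IsDrawing.sup`. -/
theorem restrict_sup_admitsSefe {V : Type*} {I : SefeInstance V}
    {A B : (⊤ : SimpleGraph V).Subgraph} {v : V} (hA : (I.restrict A).AdmitsSefe)
    (hB : (I.restrict B).AdmitsSefe) (hAfin : A.verts.Finite) (hBfin : B.verts.Finite)
    (hAB : A.verts ∩ B.verts ⊆ {v}) : (I.restrict (A ⊔ B)).AdmitsSefe := by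
  classical
  have hsub : ∀ C : (⊤ : SimpleGraph V).Subgraph, (I.restrict C).union.verts ⊆ C.verts := by
    rintro C w (h | h)
    exacts [h.2, h.2]
  obtain ⟨pos₁, arc₁, hs₁, ha₁⟩ := hA.exists_halfPlane (hAfin.subset (hsub A)) v
  obtain ⟨pos₂, arc₂, hs₂, ha₂⟩ := hB.exists_halfPlane (hBfin.subset (hsub B)) v
  let pos : V → ℂ := fun w => if w ∈ A.verts then pos₁ w else -pos₂ w
  let arc : Sym2 V → Set ℂ := fun e =>
    if e ∈ A.edgeSet then arc₁ e else (fun z => -z) '' arc₂ e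
  have key : ∀ G : (⊤ : SimpleGraph V).Subgraph, IsDrawing (G ⊓ A) pos₁ arc₁ →
      IsDrawing (G ⊓ B) pos₂ arc₂ →
      IsDrawing.IsAnchored (G ⊓ A) pos₁ arc₁ v 0 {z | 0 < z.re} →
      IsDrawing.IsAnchored (G ⊓ B) pos₂ arc₂ v 0 {z | 0 < z.re} →
      IsDrawing (G ⊓ (A ⊔ B)) pos arc := by
    intro G d₁ d₂ a₁ a₂
    have d₂' := d₂.map (T := Set.univ) (φ := fun z => -z) (by simp) (by simp)
      continuous_neg.continuousOn neg_injective.injOn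
    have a₂' := a₂.map (φ := fun z => -z) (T' := {z | z.re < 0}) (fun z hz => by
      simpa using hz)
    simp only [neg_zero] at a₂'
    have p₁ : ∀ w ∈ (G ⊓ A).verts, pos w = pos₁ w := fun w hw => if_pos hw.2
    have q₁ : ∀ e ∈ (G ⊓ A).edgeSet, arc e = arc₁ e := fun e he => by
      rw [SimpleGraph.Subgraph.edgeSet_inf] at he
      exact if_pos he.2
    have p₂ : ∀ w ∈ (G ⊓ B).verts, pos w = -pos₂ w := fun w hw => by
      by_cases hwA : w ∈ A.verts
      · obtain rfl : w = v := hAB ⟨hwA, hw.2⟩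
        rw [p₁ w ⟨hw.1, hwA⟩, a₁.pos_eq ⟨hw.1, hwA⟩, a₂'.pos_eq hw]
      · exact if_neg hwA
    have q₂ : ∀ e ∈ (G ⊓ B).edgeSet, arc e = (fun z => -z) '' arc₂ e := fun e he => by
      rw [SimpleGraph.Subgraph.edgeSet_inf] at he
      -- A common edge of `A` and `B` would have two different ends in `{v}`, so the two definitions
      -- of `arc` never compete.
      refine if_neg fun heA => ?_
      induction e with | _ x y =>
      have hxA : A.Adj x y := heA
      have hxB : B.Adj x y := he.2
      have h1 : x = v := hAB ⟨hxA.fst_mem, hxB.fst_mem⟩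
      have h2 : y = v := hAB ⟨hxA.snd_mem, hxB.snd_mem⟩
      exact hxA.ne (h1.trans h2.symm)
    rw [inf_sup_left]
    refine (d₁.congr p₁ q₁).sup (d₂'.congr p₂ q₂) (a₁.congr p₁ q₁) (a₂'.congr p₂ q₂) ?_
      (by simp) (by simp)
    exact Set.disjoint_left.2 fun z (hz : 0 < z.re) (hz' : z.re < 0) => lt_asymm hz hz'
  rw [admitsSefe_iff]
  exact ⟨pos, arc, key _ hs₁.1 hs₂.1 (ha₁ _ (Or.inl rfl)) (ha₂ _ (Or.inl rfl)),
    key _ hs₁.2 hs₂.2 (ha₁ _ (Or.inr rfl)) (ha₂ _ (Or.inr rfl))⟩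

theorem restrict_admitsSefe_of_verts_eq_empty {V : Type*} (I : SefeInstance V)
    {B : (⊤ : SimpleGraph V).Subgraph} (hB : B.verts = ∅) : (I.restrict B).AdmitsSefe := by
  have key : ∀ G : (⊤ : SimpleGraph V).Subgraph, IsDrawing (G ⊓ B) (fun _ => (0 : ℂ))
      (fun _ => ∅) := by
    intro G
    have hv : ∀ w, w ∉ (G ⊓ B).verts := fun w hw => by
      have : w ∈ B.verts := hw.2
      simp [hB] at this
    have he : ∀ e, e ∉ (G ⊓ B).edgeSet := by
      intro e
      induction e with | _ x y => exact fun h => hv x (SimpleGraph.Subgraph.edge_vert _ h)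
    exact ⟨fun x hx => absurd hx (hv x), fun x y h => absurd h.fst_mem (hv x),
      fun e h => absurd h (he e), fun e h => absurd h (he e)⟩
  rw [admitsSefe_iff]
  exact ⟨_, _, key _, key _⟩

end SefeInstance

/-! ### Decomposition at cutvertices -/

/-- Stating connectivity on the ambient vertex type makes reachability comparable between subgraphs
with different vertex sets. -/
theorem SimpleGraph.Subgraph.connected_iff_reachable_spanningCoe {V : Type*}
    {G : SimpleGraph V} {H : G.Subgraph} :
    H.Connected ↔ H.verts.Nonempty ∧
      ∀ x ∈ H.verts, ∀ y ∈ H.verts, H.spanningCoe.Reachable x y := by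
  rw [SimpleGraph.Subgraph.connected_iff]
  constructor
  · rintro ⟨hc, hne⟩
    refine ⟨hne, fun x hx y hy => ?_⟩
    let φ : H.coe →g H.spanningCoe := ⟨Subtype.val, fun h => h⟩
    exact (hc.coe ⟨x, hx⟩ ⟨y, hy⟩).map φ
  · rintro ⟨hne, h⟩
    refine ⟨⟨?_⟩, hne⟩
    have key : ∀ x y (p : H.spanningCoe.Walk x y) (hx : x ∈ H.verts) (hy : y ∈ H.verts),
        H.coe.Reachable ⟨x, hx⟩ ⟨y, hy⟩ := by
      intro x y p
      induction p with
      | nil => exact fun _ _ => SimpleGraph.Reachable.refl _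
      | cons hadj p ih =>
        intro hx hy
        have hadj' : H.Adj _ _ := hadj
        have h1 : H.coe.Adj ⟨_, hx⟩ ⟨_, hadj'.snd_mem⟩ := hadj'
        exact h1.reachable.trans (ih hadj'.snd_mem hy)
    rintro ⟨x, hx⟩ ⟨y, hy⟩
    obtain ⟨p⟩ := h x hx y hy
    exact key x y p hx hy

/-- Disconnected graphs are treated together with cutvertices: any vertex outside the finite graph,
which exists in an infinite type, serves as the separating vertex. -/
theorem exists_not_reachable_of_not_biconnected {V : Type*} [Infinite V]
    {H : (⊤ : SimpleGraph V).Subgraph} (hfin : H.verts.Finite) (hne : H.verts.Nonempty)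
    (h : ¬ Biconnected H) : ∃ v, ∃ x ∈ H.verts, ∃ y ∈ H.verts, x ≠ v ∧ y ≠ v ∧
      ¬ (H.deleteVerts {v}).spanningCoe.Reachable x y := by
  by_cases hc : H.Connected
  · have : ∃ v, IsCutvertex H v := by
      by_contra! hcon
      exact h ⟨hc, hcon⟩
    obtain ⟨v, -, x, hx, y, hy, hxv, hyv, -, hr⟩ := this
    exact ⟨v, x, hx, y, hy, hxv, hyv, hr⟩
  · rw [SimpleGraph.Subgraph.connected_iff_reachable_spanningCoe] at hc
    push Not at hc
    obtain ⟨x, hx, y, hy, hxy⟩ := hc hne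
    obtain ⟨v, hv⟩ := hfin.exists_notMem
    refine ⟨v, x, hx, y, hy, by rintro rfl; exact hv hx, by rintro rfl; exact hv hy, fun hr => ?_⟩
    exact hxy (hr.mono (SimpleGraph.Subgraph.spanningCoe_le_of_le
      SimpleGraph.Subgraph.deleteVerts_le))

/-- A subgraph in which some vertex separates two others is the union of two smaller ones that
share at most this vertex. -/
theorem exists_sup_eq_of_not_reachable {V : Type*} {H : (⊤ : SimpleGraph V).Subgraph} {v x y : V}
    (hx : x ∈ H.verts) (hy : y ∈ H.verts) (hxv : x ≠ v) (hyv : y ≠ v)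
    (h : ¬ (H.deleteVerts {v}).spanningCoe.Reachable x y) :
    ∃ A B : (⊤ : SimpleGraph V).Subgraph, A ⊔ B = H ∧ A.verts ⊂ H.verts ∧ B.verts ⊂ H.verts ∧
      A.verts ∩ B.verts ⊆ {v} := by
  -- `C` is the component of `x` after the deletion of `v`. Edges leave it only to `v`, so `C` with
  -- `v` and the complement of `C` together induce every edge.
  let C : Set V := {a | a ∈ H.verts ∧ a ≠ v ∧ (H.deleteVerts {v}).spanningCoe.Reachable x a}
  have hC : ∀ a b, H.Adj a b → a ∈ C → b ∉ C → b = v := by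
    intro a b hab ha hb
    by_contra hbv
    refine hb ⟨hab.snd_mem, hbv, ha.2.2.trans (SimpleGraph.Adj.reachable ?_)⟩
    rw [SimpleGraph.Subgraph.spanningCoe_adj, SimpleGraph.Subgraph.deleteVerts_adj]
    exact ⟨hab.fst_mem, ha.2.1, hab.snd_mem, hbv, hab⟩
  have hxC : x ∈ C := ⟨hx, hxv, SimpleGraph.Reachable.refl _⟩
  have hyC : y ∉ C := fun hyC => h hyC.2.2
  refine ⟨H.induce (H.verts ∩ insert v C), H.induce (H.verts \ C), ?_, ?_, ?_, ?_⟩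
  · apply le_antisymm
    · refine sup_le ⟨Set.inter_subset_left, fun a b hab => hab.2.2⟩
        ⟨Set.sdiff_subset, fun a b hab => hab.2.2⟩
    · constructor
      · intro a ha
        by_cases haC : a ∈ C
        · exact Or.inl ⟨ha, Or.inr haC⟩
        · exact Or.inr ⟨ha, haC⟩
      · intro a b hab
        have ha := hab.fst_mem
        have hb := hab.snd_mem
        by_cases haC : a ∈ C <;> by_cases hbC : b ∈ C
        · exact Or.inl ⟨⟨ha, Or.inr haC⟩, ⟨hb, Or.inr hbC⟩, hab⟩
        · exact Or.inl ⟨⟨ha, Or.inr haC⟩, ⟨hb, Or.inl (hC a b hab haC hbC)⟩, hab⟩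
        · exact Or.inl ⟨⟨ha, Or.inl (hC b a hab.symm hbC haC)⟩, ⟨hb, Or.inr hbC⟩, hab⟩
        · exact Or.inr ⟨⟨ha, haC⟩, ⟨hb, hbC⟩, hab⟩
  · refine ⟨Set.inter_subset_left, fun hle => ?_⟩
    rcases (hle hy).2 with h | h
    exacts [hyv h, hyC h]
  · exact ⟨Set.sdiff_subset, fun hle => (hle hx).2 hxC⟩
  · rintro a ⟨⟨-, ha | ha⟩, -, ha'⟩
    · exact ha
    · exact absurd ha ha'

/-- If the instances that biconnected subgraphs induce admit simultaneous embeddings, then so does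
the instance that any subgraph induces. -/
theorem SefeInstance.restrict_admitsSefe_of_biconnected {V : Type*} [Infinite V]
    {I : SefeInstance V} (H : (⊤ : SimpleGraph V).Subgraph) (hfin : H.verts.Finite)
    (h : ∀ B ≤ H, Biconnected B → (I.restrict B).AdmitsSefe) : (I.restrict H).AdmitsSefe := by
  induction hn : H.verts.ncard using Nat.strong_induction_on generalizing H with
  | _ n ih =>
  subst hn
  rcases H.verts.eq_empty_or_nonempty with hemp | hne
  · exact I.restrict_admitsSefe_of_verts_eq_empty hemp
  by_cases hb : Biconnected H
  · exact h H le_rfl hb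
  obtain ⟨v, x, hx, y, hy, hxv, hyv, hr⟩ := exists_not_reachable_of_not_biconnected hfin hne hb
  obtain ⟨A, B, rfl, hA, hB, hAB⟩ := exists_sup_eq_of_not_reachable hx hy hxv hyv hr
  refine restrict_sup_admitsSefe ?_ ?_ (hfin.subset hA.subset) (hfin.subset hB.subset) hAB
  · exact ih _ (Set.ncard_lt_ncard hA hfin) A (hfin.subset hA.subset)
      (fun C hC => h C (hC.trans le_sup_left)) rfl
  · exact ih _ (Set.ncard_lt_ncard hB hfin) B (hfin.subset hB.subset)
      (fun C hC => h C (hC.trans le_sup_right)) rfl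

/-! ### Ancestors in a forest given by a parent function -/

/-- `a` is an ancestor of `b` (possibly `b` itself) with respect to the parent function `P`. -/
def IsAncestor (P : ℕ → ℕ) (a b : ℕ) : Prop := ∃ i, P^[i] b = a

namespace IsAncestor

variable {P : ℕ → ℕ} {a b c : ℕ}

theorem refl (P : ℕ → ℕ) (a : ℕ) : IsAncestor P a a := ⟨0, rfl⟩

theorem parent (P : ℕ → ℕ) (a : ℕ) : IsAncestor P (P a) a := ⟨1, rfl⟩

theorem trans (h : IsAncestor P a b) (h' : IsAncestor P b c) : IsAncestor P a c := by
  obtain ⟨i, rfl⟩ := h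
  obtain ⟨j, rfl⟩ := h'
  exact ⟨i + j, Function.iterate_add_apply P i j c⟩

theorem eq_or_parent (h : IsAncestor P a b) : a = b ∨ IsAncestor P a (P b) := by
  obtain ⟨i, rfl⟩ := h
  cases i with
  | zero => exact Or.inl rfl
  | succ i => exact Or.inr ⟨i, rfl⟩

theorem parent_of_ne (h : IsAncestor P a b) (hne : a ≠ b) : IsAncestor P a (P b) :=
  h.eq_or_parent.resolve_left hne

theorem le (hP : ∀ k, P k ≤ k) (h : IsAncestor P a b) : a ≤ b := by
  obtain ⟨i, rfl⟩ := h
  induction i with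
  | zero => exact le_rfl
  | succ i ih =>
    rw [Function.iterate_succ_apply']
    exact (hP _).trans ih

/-- The ancestors of a fixed vertex form a chain, and the chain is ordered by number because parents
have smaller numbers. -/
theorem of_le (hP : ∀ k, P k ≤ k) (ha : IsAncestor P a c) (hb : IsAncestor P b c) (hab : a ≤ b) :
    IsAncestor P a b := by
  obtain ⟨i, rfl⟩ := ha
  obtain ⟨j, rfl⟩ := hb
  rcases le_total i j with hij | hij
  · obtain ⟨k, rfl⟩ := Nat.exists_eq_add_of_le hij
    have h1 : IsAncestor P (P^[i + k] c) (P^[i] c) :=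
      ⟨k, by rw [add_comm i k, Function.iterate_add_apply]⟩
    rw [le_antisymm hab (h1.le hP)]
    exact refl _ _
  · obtain ⟨k, rfl⟩ := Nat.exists_eq_add_of_le hij
    exact ⟨k, by rw [add_comm j k, Function.iterate_add_apply]⟩

theorem antisymm (hP : ∀ k, P k ≤ k) (h : IsAncestor P a b) (h' : IsAncestor P b a) : a = b :=
  le_antisymm (h.le hP) (h'.le hP)

/-- The child of a proper ancestor `a` on the way to `b`. -/
theorem exists_child (h : IsAncestor P a b) (hne : a ≠ b) :
    ∃ c, P c = a ∧ IsAncestor P c b := by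
  obtain ⟨i, rfl⟩ := h
  cases i with
  | zero => exact absurd rfl hne
  | succ i => exact ⟨P^[i] b, (Function.iterate_succ_apply' P i b).symm, i, rfl⟩

theorem congr {P' : ℕ → ℕ} {m : ℕ} (hP : ∀ k ≤ m, P k ≤ k) (heq : ∀ k ≤ m, P' k = P k)
    (hb : b ≤ m) (h : IsAncestor P a b) : IsAncestor P' a b := by
  obtain ⟨i, rfl⟩ := h
  have key : ∀ i, P'^[i] b = P^[i] b ∧ P^[i] b ≤ m := by
    intro i
    induction i with
    | zero => exact ⟨rfl, hb⟩
    | succ i ih =>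
      rw [Function.iterate_succ_apply', Function.iterate_succ_apply', ih.1, heq _ ih.2]
      exact ⟨rfl, (hP _ ih.2).trans ih.2⟩
  exact ⟨i, (key i).1⟩

end IsAncestor

/-! ### Reachability -/

theorem SimpleGraph.Reachable.of_closed {V : Type*} {G : SimpleGraph V} {x y : V}
    (h : G.Reachable x y) {Q : V → Prop} (hx : Q x) (hQ : ∀ a b, G.Adj a b → Q a → Q b) : Q y := by
  obtain ⟨p⟩ := h
  induction p with
  | nil => exact hx
  | cons hadj p ih => exact ih (hQ _ _ hadj hx)

theorem SimpleGraph.Subgraph.Connected.exists_adj {V : Type*} {G : SimpleGraph V} {H : G.Subgraph}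
    (h : H.Connected) {x y : V} (hx : x ∈ H.verts) (hy : y ∈ H.verts) (hxy : x ≠ y) :
    ∃ z, H.Adj x z := by
  obtain ⟨p⟩ := (SimpleGraph.Subgraph.connected_iff_reachable_spanningCoe.1 h).2 x hx y hy
  cases p with
  | nil => exact absurd rfl hxy
  | cons hadj p => exact ⟨_, hadj⟩

theorem Biconnected.reachable_deleteVerts {V : Type*} {H : (⊤ : SimpleGraph V).Subgraph}
    (h : Biconnected H) {v x y : V} (hx : x ∈ H.verts) (hy : y ∈ H.verts) (hxv : x ≠ v)
    (hyv : y ≠ v) : (H.deleteVerts {v}).spanningCoe.Reachable x y := by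
  have hr := (SimpleGraph.Subgraph.connected_iff_reachable_spanningCoe.1 h.1).2 x hx y hy
  by_cases hv : v ∈ H.verts
  · by_contra hcon
    exact h.2 v ⟨hv, x, hx, y, hy, hxv, hyv, hr, hcon⟩
  · refine hr.mono fun a b hab => ?_
    have hab : H.Adj a b := hab
    rw [SimpleGraph.Subgraph.spanningCoe_adj, SimpleGraph.Subgraph.deleteVerts_adj]
    refine ⟨hab.fst_mem, ?_, hab.snd_mem, ?_, hab⟩
    · rintro rfl
      exact hv hab.fst_mem
    · rintro rfl
      exact hv hab.snd_mem

/-- The empty set `D` gives connectivity and the singletons exclude cutvertices, so one argument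
proves both. -/
theorem biconnected_of_reachable {V : Type*} {H : (⊤ : SimpleGraph V).Subgraph}
    (hne : H.verts.Nonempty)
    (h : ∀ D : Set V, D.Subsingleton → ∀ x ∈ H.verts, ∀ y ∈ H.verts, x ∉ D → y ∉ D →
      (H.deleteVerts D).spanningCoe.Reachable x y) : Biconnected H := by
  refine ⟨SimpleGraph.Subgraph.connected_iff_reachable_spanningCoe.2 ⟨hne, fun x hx y hy => ?_⟩,
    fun v => ?_⟩
  · simpa using h ∅ Set.subsingleton_empty x hx y hy (by simp) (by simp)
  · rintro ⟨-, x, hx, y, hy, hxv, hyv, -, hn⟩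
    exact hn (h {v} Set.subsingleton_singleton x hx y hy hxv hyv)

/-! ### Blocks from lowpoints -/

/-- The vertex with number `k` opens a block: it is the only vertex of the block, or its parent `P k`
separates its subtree from the rest of the graph. -/
def OpensBlock {V : Type*} (U : (⊤ : SimpleGraph V).Subgraph) (num : V → ℕ) (P low : ℕ → ℕ)
    (k : ℕ) : Prop :=
  (P k = 0 ∧ ∀ x y, U.Adj x y → num x ≠ k) ∨ (P k ≠ 0 ∧ P k ≤ low k)

/-- The vertices of the graph `U` are numbered `1, …, n` along a depth-first search with parent
function `P` (zero for the roots) and lowpoints `low`. Vertices are assigned numbers of blocks by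
`blk`: a vertex that opens a block gets a new number, and the other vertices get the one of their
parent. -/
structure IsBlockNumbering {V : Type*} (U : (⊤ : SimpleGraph V).Subgraph) (n nb : ℕ) (num : V → ℕ)
    (P low blk lead : ℕ → ℕ) : Prop where
  num_injOn : Set.InjOn num U.verts
  num_ne_zero : ∀ x ∈ U.verts, num x ≠ 0
  num_le : ∀ x ∈ U.verts, num x ≤ n
  exists_num : ∀ k, k ≠ 0 → k ≤ n → ∃ x ∈ U.verts, num x = k
  parent_lt : ∀ k, k ≠ 0 → P k < k
  parent_zero : P 0 = 0
  tree_adj : ∀ x ∈ U.verts, P (num x) ≠ 0 → ∃ y, num y = P (num x) ∧ U.Adj y x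
  comparable : ∀ x y, U.Adj x y → num x < num y → IsAncestor P (num x) (num y)
  low_le_of_adj : ∀ x y, U.Adj x y → num x < num y → low (num y) ≤ num x
  low_parent_le : ∀ k, k ≠ 0 → k ≤ n → P k ≠ 0 → low (P k) ≤ low k
  low_attained : ∀ k, k ≠ 0 → k ≤ n → ∃ z, IsAncestor P k z ∧
    (low k = z ∨ ∃ x y, U.Adj x y ∧ num x < num y ∧ num x = low k ∧ num y = z)
  lead_spec : ∀ b, b ≠ 0 → b ≤ nb → lead b ≠ 0 ∧ lead b ≤ n ∧ blk (lead b) = b ∧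
    OpensBlock U num P low (lead b)
  lead_blk : ∀ k, k ≠ 0 → k ≤ n → OpensBlock U num P low k →
    blk k ≠ 0 ∧ blk k ≤ nb ∧ lead (blk k) = k
  blk_root : ∀ k, k ≠ 0 → k ≤ n → P k = 0 → ¬ OpensBlock U num P low k → blk k = 0
  blk_eq_parent : ∀ k, k ≠ 0 → k ≤ n → P k ≠ 0 → ¬ OpensBlock U num P low k → blk k = blk (P k)

namespace IsBlockNumbering

variable {V : Type*} {U : (⊤ : SimpleGraph V).Subgraph} {n nb : ℕ} {num : V → ℕ}
  {P low blk lead : ℕ → ℕ} (h : IsBlockNumbering U n nb num P low blk lead)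

include h

theorem parent_le (k : ℕ) : P k ≤ k := by
  rcases eq_or_ne k 0 with rfl | hk
  · exact h.parent_zero.le
  · exact (h.parent_lt k hk).le

theorem low_le_of_ancestor {q z : ℕ} (hq : q ≠ 0) (hz : z ≤ n) (hqz : IsAncestor P q z) :
    low q ≤ low z := by
  induction z using Nat.strong_induction_on with
  | _ z ih =>
  rcases hqz.eq_or_parent with rfl | hqP
  · exact le_rfl
  · have hz0 : z ≠ 0 := by
      rintro rfl
      exact hq (Nat.le_zero.1 (hqz.le h.parent_le))
    have hP0 : P z ≠ 0 := by
      intro h0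
      rw [h0] at hqP
      exact hq (Nat.le_zero.1 (hqP.le h.parent_le))
    have hlt := h.parent_lt z hz0
    exact (ih _ hlt (hlt.le.trans hz) hqP).trans (h.low_parent_le z hz0 hz hP0)

/-- If `k` opens no block, then `low k < P k` comes from an edge between the subtree of `k` and a
proper ancestor of `P k`. So `P k` is not a root either, and induction applies. In particular,
children of roots always open blocks. -/
theorem blk_ne_zero {k : ℕ} (hk : k ≤ n) (hP : P k ≠ 0) : blk k ≠ 0 := by
  induction k using Nat.strong_induction_on with
  | _ k ih =>
  have hk0 : k ≠ 0 := by
    rintro rfl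
    exact hP h.parent_zero
  by_cases ho : OpensBlock U num P low k
  · exact (h.lead_blk k hk0 hk ho).1
  · rw [h.blk_eq_parent k hk0 hk hP ho]
    have hlt := h.parent_lt k hk0
    refine ih _ hlt (hlt.le.trans hk) ?_
    have hlow : low k < P k := by
      by_contra hcon
      exact ho (Or.inr ⟨hP, not_lt.1 hcon⟩)
    obtain ⟨z, hkz, hz | ⟨x, y, hxy, hlt', hx, rfl⟩⟩ := h.low_attained k hk0 hk
    · have := hkz.le h.parent_le
      omega
    · have h1 := h.comparable x y hxy hlt'
      have h2 : IsAncestor P (num x) (P k) :=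
        h1.of_le h.parent_le ((IsAncestor.parent P k).trans hkz) (by omega)
      have h3 := (h2.parent_of_ne (by omega)).le h.parent_le
      have := h.num_ne_zero x hxy.fst_mem
      omega

theorem blk_le {k : ℕ} (hk0 : k ≠ 0) (hk : k ≤ n) : blk k ≤ nb := by
  induction k using Nat.strong_induction_on with
  | _ k ih =>
  by_cases ho : OpensBlock U num P low k
  · exact (h.lead_blk k hk0 hk ho).2.1
  · by_cases hP : P k = 0
    · rw [h.blk_root k hk0 hk hP ho]
      exact zero_le
    · have hlt := h.parent_lt k hk0
      rw [h.blk_eq_parent k hk0 hk hP ho]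
      exact ih _ hlt hP (hlt.le.trans hk)

/-- Climbing from `k`, the block number is inherited from parent to child until the opening vertex
is reached, so it is constant along this path. -/
theorem lead_ancestor {k : ℕ} (hk0 : k ≠ 0) (hk : k ≤ n) (hb : blk k ≠ 0) :
    IsAncestor P (lead (blk k)) k ∧
      ∀ q, IsAncestor P (lead (blk k)) q → IsAncestor P q k → blk q = blk k := by
  induction k using Nat.strong_induction_on with
  | _ k ih =>
  by_cases ho : OpensBlock U num P low k
  · rw [(h.lead_blk k hk0 hk ho).2.2]
    refine ⟨IsAncestor.refl _ _, fun q h1 h2 => ?_⟩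
    rw [h1.antisymm h.parent_le h2]
  · have hP : P k ≠ 0 := fun hP => hb (h.blk_root k hk0 hk hP ho)
    have hlt := h.parent_lt k hk0
    have heq := h.blk_eq_parent k hk0 hk hP ho
    rw [heq] at hb ⊢
    obtain ⟨h1, h2⟩ := ih _ hlt hP (hlt.le.trans hk) hb
    refine ⟨h1.trans (IsAncestor.parent P k), fun q hq hqk => ?_⟩
    rcases hqk.eq_or_parent with rfl | hqP
    · exact heq
    · exact h2 q hq hqP

theorem exists_adj_of_parent {c : ℕ} (hc : c ≤ n) (hP : P c ≠ 0) :
    ∃ x y, U.Adj x y ∧ num x = P c ∧ num y = c := by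
  have hc0 : c ≠ 0 := by
    rintro rfl
    exact hP h.parent_zero
  obtain ⟨y, hy, rfl⟩ := h.exists_num c hc0 hc
  obtain ⟨x, hx, hxy⟩ := h.tree_adj y hy hP
  exact ⟨x, y, hxy, hx, rfl⟩

/-- A block whose opening vertex is a root has no other vertex. -/
theorem eq_lead {k : ℕ} (hk0 : k ≠ 0) (hk : k ≤ n) (hb : blk k ≠ 0) (hP : P (lead (blk k)) = 0) :
    k = lead (blk k) := by
  by_contra hne
  have hl := h.lead_spec _ hb (h.blk_le hk0 hk)
  obtain ⟨c, hc, hck⟩ := (h.lead_ancestor hk0 hk hb).1.exists_child (Ne.symm hne)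
  obtain ⟨x, y, hxy, hx, -⟩ := h.exists_adj_of_parent ((hck.le h.parent_le).trans hk)
    (by rw [hc]; exact hl.1)
  rcases hl.2.2.2 with ho | ho
  · exact ho.2 x y hxy (hx.trans hc)
  · exact ho.1 hP

theorem parent_ne_zero_of_adj {x y : V} (hxy : U.Adj x y) (hlt : num x < num y) :
    P (num y) ≠ 0 := by
  intro h0
  have h1 := ((h.comparable x y hxy hlt).parent_of_ne hlt.ne).le h.parent_le
  have := h.num_ne_zero x hxy.fst_mem
  omega

theorem blk_ne_zero_of_adj {x y : V} (hxy : U.Adj x y) (hlt : num x < num y) :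
    blk (num y) ≠ 0 :=
  h.blk_ne_zero (h.num_le y hxy.snd_mem) (h.parent_ne_zero_of_adj hxy hlt)

theorem parent_lead_ne_zero {x y : V} (hxy : U.Adj x y) (hlt : num x < num y) :
    P (lead (blk (num y))) ≠ 0 := by
  intro h0
  have hb := h.blk_ne_zero_of_adj hxy hlt
  have := h.eq_lead (h.num_ne_zero y hxy.snd_mem) (h.num_le y hxy.snd_mem) hb h0
  rw [← this] at h0
  exact h.parent_ne_zero_of_adj hxy hlt h0

/-- An edge that leaves a subtree whose root opens a block ends in the parent of this root. -/
theorem eq_parent_of_adj {c : ℕ} (ho : P c ≤ low c) (hc0 : c ≠ 0) {x y : V}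
    (hxy : U.Adj x y) (hy : IsAncestor P c (num y)) (hx : ¬ IsAncestor P c (num x)) :
    num x = P c := by
  rcases lt_trichotomy (num x) (num y) with hlt | heq | hlt
  · have h1 := h.comparable x y hxy hlt
    have hxc : num x < c := by
      by_contra hcon
      exact hx (hy.of_le h.parent_le h1 (not_lt.1 hcon))
    have h2 := (h1.of_le h.parent_le hy hxc.le).parent_of_ne hxc.ne
    have h3 := h2.le h.parent_le
    have h4 := h.low_le_of_ancestor hc0 (h.num_le y hxy.snd_mem) hy
    have h5 := h.low_le_of_adj x y hxy hlt
    omega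
  · exact absurd (heq ▸ hy) hx
  · exact absurd (hy.trans (h.comparable y x hxy.symm hlt)) hx

/-- The earlier end vertex is an ancestor of the later one. Within the subtree of the opening vertex
it lies on the tree path with constant block number; otherwise the edge leaves this subtree and must
end in its root's parent. -/
theorem mem_block_of_adj {x y : V} (hxy : U.Adj x y) (hlt : num x < num y) :
    blk (num x) = blk (num y) ∨ num x = P (lead (blk (num y))) := by
  have hy := hxy.snd_mem
  have hb := h.blk_ne_zero_of_adj hxy hlt
  have hl := h.lead_ancestor (h.num_ne_zero y hy) (h.num_le y hy) hb
  have hls := h.lead_spec _ hb (h.blk_le (h.num_ne_zero y hy) (h.num_le y hy))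
  have hP := h.parent_lead_ne_zero hxy hlt
  by_cases hx : IsAncestor P (lead (blk (num y))) (num x)
  · exact Or.inl (hl.2 _ hx (h.comparable x y hxy hlt))
  · refine Or.inr (h.eq_parent_of_adj ?_ hls.1 hxy hl.1 hx)
    rcases hls.2.2.2 with ho | ho
    · exact absurd ho.1 hP
    · exact ho.2

/-- The block with number `b`: an edge belongs to it if the number of its later end vertex does. -/
def block (b : ℕ) : (⊤ : SimpleGraph V).Subgraph where
  verts := {x | x ∈ U.verts ∧ (blk (num x) = b ∨ num x = P (lead b))}
  Adj x y := U.Adj x y ∧ blk (max (num x) (num y)) = b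
  adj_sub hxy := U.adj_sub hxy.1
  edge_vert := by
    rintro x y ⟨hxy, rfl⟩
    refine ⟨hxy.fst_mem, ?_⟩
    rcases le_or_gt (num y) (num x) with hle | hlt
    · rw [max_eq_left hle]
      exact Or.inl rfl
    · rw [max_eq_right hlt.le]
      exact h.mem_block_of_adj hxy hlt
  symm := ⟨fun x y hxy => ⟨hxy.1.symm, by rw [max_comm]; exact hxy.2⟩⟩

theorem block_le (b : ℕ) : h.block b ≤ U :=
  ⟨fun _ hx => hx.1, fun _ _ hxy => hxy.1⟩

theorem num_ne {x y : V} (hxy : U.Adj x y) : num x ≠ num y := fun heq =>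
  hxy.ne (h.num_injOn hxy.fst_mem hxy.snd_mem heq)

/-- The way from a vertex to an ancestor in the tree stays within a block. -/
theorem reachable_ancestor {b : ℕ} {D : Set V} {x y : V} (hx : x ∈ U.verts) (hy : y ∈ U.verts)
    (hyx : IsAncestor P (num y) (num x))
    (hb : ∀ q, IsAncestor P (num y) q → IsAncestor P q (num x) → q ≠ num y → blk q = b)
    (hD : ∀ z ∈ U.verts, IsAncestor P (num y) (num z) → IsAncestor P (num z) (num x) → z ∉ D) :
    ((h.block b).deleteVerts D).spanningCoe.Reachable x y := by
  induction hk : num x using Nat.strong_induction_on generalizing x with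
  | _ k ih =>
  subst hk
  by_cases hxy : num x = num y
  · rw [h.num_injOn hx hy hxy]
  · have hyP := hyx.parent_of_ne (Ne.symm hxy)
    have hP0 : P (num x) ≠ 0 := fun h0 => by
      have := hyP.le h.parent_le
      have := h.num_ne_zero y hy
      omega
    obtain ⟨z, hz, hzx⟩ := h.tree_adj x hx hP0
    have hlt := h.parent_lt _ (h.num_ne_zero x hx)
    have hPx := IsAncestor.parent P (num x)
    have hadj : ((h.block b).deleteVerts D).spanningCoe.Adj x z := by
      have hblock : (h.block b).Adj x z := by
        refine ⟨hzx.symm, ?_⟩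
        rw [max_eq_left (by omega)]
        exact hb _ hyx (IsAncestor.refl _ _) hxy
      rw [SimpleGraph.Subgraph.spanningCoe_adj, SimpleGraph.Subgraph.deleteVerts_adj]
      exact ⟨hblock.fst_mem, hD x hx hyx (IsAncestor.refl _ _), hblock.snd_mem,
        hD z hzx.fst_mem (by rwa [hz]) (by rwa [hz]), hblock⟩
    refine hadj.reachable.trans (ih (num z) (by omega) hzx.fst_mem (by rwa [hz]) ?_ ?_ rfl)
    · intro q h1 h2
      rw [hz] at h2
      exact hb q h1 (h2.trans hPx)
    · intro w hw h1 h2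
      rw [hz] at h2
      exact hD w hw h1 (h2.trans hPx)

/-- Let `t` be the parent of the opening vertex. Every vertex of the block climbs to `t` along the
tree. If the deleted vertex `v` is in the way and `c` is the child of `v` on this path, then `c`
opens no block, so an edge of the block joins the subtree of `c` to a proper ancestor of `v`. The
detour goes up to `c`, down to that edge, over `v`, and on to `t`. If `t` itself is deleted,
everything still climbs to the opening vertex. -/
theorem block_biconnected {b : ℕ} (hb0 : b ≠ 0) (hb : b ≤ nb) : Biconnected (h.block b) := by
  obtain ⟨hl0, hln, hlb, hlo⟩ := h.lead_spec b hb0 hb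
  obtain ⟨l, hl, hlnum⟩ := h.exists_num _ hl0 hln
  have hlead : ∀ x ∈ U.verts, blk (num x) = b → IsAncestor P (lead b) (num x) ∧
      ∀ q, IsAncestor P (lead b) q → IsAncestor P q (num x) → blk q = b := by
    intro x hx hxb
    have := h.lead_ancestor (h.num_ne_zero x hx) (h.num_le x hx) (by rwa [hxb])
    rwa [hxb] at this
  refine biconnected_of_reachable ⟨l, hl, Or.inl (by rw [hlnum, hlb])⟩ ?_
  by_cases hP : P (lead b) = 0
  · have hone : ∀ x ∈ (h.block b).verts, x = l := by
      rintro x ⟨hx, hxb | hxb⟩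
      · refine h.num_injOn hx hl ?_
        rw [hlnum, ← hxb]
        exact h.eq_lead (h.num_ne_zero x hx) (h.num_le x hx) (by rwa [hxb]) (by rwa [hxb])
      · exact absurd (hxb.trans hP) (h.num_ne_zero x hx)
    intro D _ x hx y hy _ _
    rw [hone x hx, hone y hy]
  obtain ⟨t, htnum, htl⟩ := h.tree_adj l hl (by rwa [hlnum])
  rw [hlnum] at htnum
  have ht := htl.fst_mem
  have htlt : num t < lead b := by
    rw [htnum]
    exact h.parent_lt _ hl0
  have htlA : IsAncestor P (num t) (lead b) := htnum ▸ IsAncestor.parent P _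
  intro D hD
  by_cases htD : t ∈ D
  · have key : ∀ x ∈ (h.block b).verts, x ∉ D →
        ((h.block b).deleteVerts D).spanningCoe.Reachable x l := by
      rintro x ⟨hx, hxb⟩ hxD
      have hxt : num x ≠ P (lead b) := by
        intro heq
        rw [h.num_injOn hx ht (heq.trans htnum.symm)] at hxD
        exact hxD htD
      obtain ⟨h1, h2⟩ := hlead x hx (hxb.resolve_right hxt)
      refine h.reachable_ancestor hx hl (by rwa [hlnum]) (fun q hq hqx _ => h2 q ?_ hqx)
        (fun z hz hlz _ hzD => ?_)
      · rwa [hlnum] at hq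
      · rw [hD hzD htD, hlnum] at hlz
        exact absurd (hlz.le h.parent_le) (by omega)
    intro x hx y hy hxD hyD
    exact (key x hx hxD).trans (key y hy hyD).symm
  -- the part of the tree path above `t`
  have chain : ∀ x ∈ U.verts, blk (num x) = b → ∀ q, IsAncestor P (num t) q →
      IsAncestor P q (num x) → q ≠ num t → IsAncestor P (lead b) q := by
    intro x hx hxb q h1 h2 h3
    obtain ⟨h4, h5⟩ := hlead x hx hxb
    by_contra hcon
    have hlt : q < lead b := by
      by_contra hge
      exact hcon (h4.of_le h.parent_le h2 (not_lt.1 hge))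
    have h6 := ((h2.of_le h.parent_le h4 hlt.le).parent_of_ne hlt.ne).le h.parent_le
    exact h3 (le_antisymm (by omega) (h1.le h.parent_le))
  have direct : ∀ x ∈ (h.block b).verts,
      (∀ v ∈ D, v ∈ U.verts → ¬ (IsAncestor P (num v) (num x) ∧ IsAncestor P (lead b) (num v))) →
      ((h.block b).deleteVerts D).spanningCoe.Reachable x t := by
    rintro x ⟨hx, hxb⟩ hxD
    by_cases hxt : num x = P (lead b)
    · rw [h.num_injOn hx ht (hxt.trans htnum.symm)]
    · have hxb := hxb.resolve_right hxt
      obtain ⟨h1, h2⟩ := hlead x hx hxb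
      refine h.reachable_ancestor hx ht (htlA.trans h1) ?_ ?_
      · intro q hq hqx hqt
        exact h2 q (chain x hx hxb q hq hqx hqt) hqx
      · intro z hz h3 h4 hzD
        refine hxD z hzD hz ⟨h4, chain x hx hxb _ h3 h4 fun heq => htD ?_⟩
        rwa [← h.num_injOn hz ht heq]
  have key : ∀ x ∈ (h.block b).verts, x ∉ D →
      ((h.block b).deleteVerts D).spanningCoe.Reachable x t := by
    intro x hx hxD
    by_cases hbad : ∃ v ∈ D, v ∈ U.verts ∧ IsAncestor P (num v) (num x) ∧
        IsAncestor P (lead b) (num v)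
    swap
    · exact direct x hx fun v hv hvU hcon => hbad ⟨v, hv, hvU, hcon⟩
    obtain ⟨v, hvD, hv, hvx, hlv⟩ := hbad
    have hxv : num v ≠ num x := by
      intro heq
      rw [← h.num_injOn hv hx.1 heq] at hxD
      exact hxD hvD
    have hxb : blk (num x) = b := by
      refine hx.2.resolve_right fun heq => ?_
      have := (hlv.trans hvx).le h.parent_le
      omega
    obtain ⟨h1, h2⟩ := hlead x hx.1 hxb
    obtain ⟨c, hcP, hcx⟩ := hvx.exists_child hxv
    have hv0 := h.num_ne_zero v hv
    have hcn : c ≤ n := (hcx.le h.parent_le).trans (h.num_le x hx.1)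
    have hc0 : c ≠ 0 := by
      rintro rfl
      rw [h.parent_zero] at hcP
      exact hv0 hcP.symm
    have hvc : num v < c := hcP ▸ h.parent_lt c hc0
    have hcb : blk c = b := h2 c (hlv.trans (hcP ▸ IsAncestor.parent P c)) hcx
    -- Otherwise `c` would open a block; as its block number is `b`, it would be the opening vertex
    -- of `b`, and its parent `v` would be `t`.
    have hlow : low c < num v := by
      by_contra hcon
      have ho : OpensBlock U num P low c := Or.inr ⟨by omega, by omega⟩
      have := (h.lead_blk c hc0 hcn ho).2.2
      rw [hcb] at this
      rw [← this] at hcP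
      exact htD (by rwa [← h.num_injOn hv ht (by omega)])
    obtain ⟨z, hcz, hz | ⟨p, q, hpq, hpqlt, hp, rfl⟩⟩ := h.low_attained c hc0 hcn
    · have := hcz.le h.parent_le
      omega
    have hq := hpq.snd_mem
    have hqb0 := h.blk_ne_zero_of_adj hpq hpqlt
    obtain ⟨h3, h4⟩ := h.lead_ancestor (h.num_ne_zero q hq) (h.num_le q hq) hqb0
    -- If the opening vertex of the block of `q` lay strictly below `c`, the edge from `q` to `p`
    -- would leave its subtree beyond its parent. So it lies at or above `c`, and `c` is on the tree
    -- path from it to `q`.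
    have hqb : blk (num q) = b := by
      rw [← hcb]
      symm
      rcases le_or_gt (lead (blk (num q))) c with hle | hgt
      · exact h4 c (h3.of_le h.parent_le hcz hle) hcz
      · exfalso
        have h5 := ((hcz.of_le h.parent_le h3 hgt.le).parent_of_ne hgt.ne).le h.parent_le
        obtain ⟨h6, -, -, h7⟩ := h.lead_spec _ hqb0
          (h.blk_le (h.num_ne_zero q hq) (h.num_le q hq))
        have h8 := h.low_le_of_ancestor h6 (h.num_le q hq) h3
        have h9 := h.low_le_of_adj p q hpq hpqlt
        rcases h7 with h7 | h7
        · exact h.parent_lead_ne_zero hpq hpqlt h7.1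
        · omega
    obtain ⟨w, hw, rfl⟩ := h.exists_num c hc0 hcn
    have toChild : ∀ y ∈ U.verts, blk (num y) = b → IsAncestor P (num w) (num y) →
        ((h.block b).deleteVerts D).spanningCoe.Reachable y w := by
      intro y hy hyb hwy
      refine h.reachable_ancestor hy hw hwy (fun k hk hky _ => (hlead y hy hyb).2 k ?_ hky) ?_
      · exact hlv.trans ((hcP ▸ IsAncestor.parent P _).trans hk)
      · intro z hz hwz _ hzD
        rw [hD hzD hvD] at hwz
        have := hwz.le h.parent_le
        omega
    have hblock : (h.block b).Adj q p := by
      refine ⟨hpq.symm, ?_⟩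
      rwa [max_eq_left hpqlt.le]
    have hnD : ∀ y, num y ≠ num v → y ∉ D := by
      intro y hy hyD
      exact hy (by rw [hD hyD hvD])
    have hadj : ((h.block b).deleteVerts D).spanningCoe.Adj q p := by
      rw [SimpleGraph.Subgraph.spanningCoe_adj, SimpleGraph.Subgraph.deleteVerts_adj]
      refine ⟨hblock.fst_mem, hnD q ?_, hblock.snd_mem, hnD p ?_, hblock⟩
      · have := hcz.le h.parent_le
        omega
      · omega
    refine ((toChild x hx.1 hxb hcx).trans (toChild q hq hqb hcz).symm).trans
      (hadj.reachable.trans (direct p hblock.snd_mem ?_))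
    rintro v' hv'D - ⟨hv'p, -⟩
    rw [hD hv'D hvD] at hv'p
    have := hv'p.le h.parent_le
    omega
  intro x hx y hy hxD hyD
  exact (key x hx hxD).trans (key y hy hyD).symm

/-- A biconnected subgraph that meets a subtree whose root opens a block lies in the subtree, except
for the parent of its root. -/
theorem ancestor_or_eq_parent {H : (⊤ : SimpleGraph V).Subgraph} (hH : Biconnected H) (hle : H ≤ U)
    {c : ℕ} (hc0 : c ≠ 0) (hcn : c ≤ n) (hP : P c ≠ 0) (ho : P c ≤ low c) {z : V}
    (hz : z ∈ H.verts) (hcz : IsAncestor P c (num z)) {y : V} (hy : y ∈ H.verts) :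
    IsAncestor P c (num y) ∨ num y = P c := by
  obtain ⟨v, w, hvw, hv, -⟩ := h.exists_adj_of_parent hcn hP
  by_cases hyv : y = v
  · exact Or.inr (by rw [hyv, hv])
  have hzv : z ≠ v := by
    rintro rfl
    have := hcz.le h.parent_le
    have := h.parent_lt c hc0
    omega
  left
  refine (hH.reachable_deleteVerts hz hy hzv hyv).of_closed
    (Q := fun a => IsAncestor P c (num a)) hcz fun a a' haa' ha => ?_
  rw [SimpleGraph.Subgraph.spanningCoe_adj, SimpleGraph.Subgraph.deleteVerts_adj] at haa'
  have hadj := hle.2 haa'.2.2.2.2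
  by_contra hcon
  have := h.eq_parent_of_adj ho hc0 hadj.symm ha hcon
  exact haa'.2.2.2.1 (h.num_injOn hadj.snd_mem hvw.fst_mem (this.trans hv.symm))

/-- For each edge of `H`, all of `H` lies in the subtree of the opening vertex of its block, plus
the parent. Given two edges, the later end of each lies in both subtrees, so the deeper opening
vertex is on the tree path below the other one, where the block number is constant. Hence the two
numbers agree. -/
theorem exists_le_block_of_adj {H : (⊤ : SimpleGraph V).Subgraph} (hH : Biconnected H) (hle : H ≤ U)
    {x₀ y₀ : V} (hxy₀ : H.Adj x₀ y₀) : ∃ b, b ≠ 0 ∧ b ≤ nb ∧ H ≤ h.block b := by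
  have main : ∀ x y x' y', H.Adj x y → H.Adj x' y' → num x < num y → num x' < num y' →
      blk (num y') = blk (num y) := by
    have facts : ∀ x y, H.Adj x y → num x < num y →
        (IsAncestor P (lead (blk (num y))) (num y) ∧
          ∀ q, IsAncestor P (lead (blk (num y))) q → IsAncestor P q (num y) →
            blk q = blk (num y)) ∧ blk (lead (blk (num y))) = blk (num y) ∧
        ∀ z ∈ H.verts, IsAncestor P (lead (blk (num y))) (num z) ∨
          num z = P (lead (blk (num y))) := by
      intro x y hxy hlt
      have hxy' := hle.2 hxy
      have hy := hxy'.snd_mem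
      have hb := h.blk_ne_zero_of_adj hxy' hlt
      have h1 := h.lead_ancestor (h.num_ne_zero y hy) (h.num_le y hy) hb
      obtain ⟨h2, h3, h4, h5⟩ := h.lead_spec _ hb (h.blk_le (h.num_ne_zero y hy) (h.num_le y hy))
      have h6 := h.parent_lead_ne_zero hxy' hlt
      refine ⟨h1, h4, fun z hz => h.ancestor_or_eq_parent hH hle h2 h3 h6 ?_ hxy.snd_mem h1.1 hz⟩
      rcases h5 with h5 | h5
      exacts [absurd h5.1 h6, h5.2]
    have later : ∀ c x y, (∀ z ∈ H.verts, IsAncestor P c (num z) ∨ num z = P c) → H.Adj x y →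
        num x < num y → IsAncestor P c (num y) := by
      intro c x y hc hxy hlt
      rcases hc y hxy.snd_mem with h1 | h1
      · exact h1
      · exfalso
        have := h.parent_le c
        rcases hc x hxy.fst_mem with h2 | h2
        · have := h2.le h.parent_le
          omega
        · omega
    intro x y x' y' hxy hxy' hlt hlt'
    obtain ⟨⟨a1, a2⟩, a3, a4⟩ := facts x y hxy hlt
    obtain ⟨⟨b1, b2⟩, b3, b4⟩ := facts x' y' hxy' hlt'
    have c1 := later _ x' y' a4 hxy' hlt'
    have c2 := later _ x y b4 hxy hlt
    rcases le_total (lead (blk (num y))) (lead (blk (num y'))) with hle' | hle'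
    · rw [← b3]
      exact a2 _ (a1.of_le h.parent_le c2 hle') c2
    · rw [← a3]
      exact (b2 _ (b1.of_le h.parent_le c1 hle') c1).symm
  obtain ⟨x₁, y₁, hxy₁, hlt₁⟩ : ∃ x y, H.Adj x y ∧ num x < num y := by
    rcases lt_or_gt_of_ne (h.num_ne (hle.2 hxy₀)) with hlt | hlt
    exacts [⟨_, _, hxy₀, hlt⟩, ⟨_, _, hxy₀.symm, hlt⟩]
  have hadj : ∀ x y, H.Adj x y → (h.block (blk (num y₁))).Adj x y := by
    intro x y hxy
    refine ⟨hle.2 hxy, ?_⟩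
    rcases lt_or_gt_of_ne (h.num_ne (hle.2 hxy)) with hlt | hlt
    · rw [max_eq_right hlt.le]
      exact main _ _ _ _ hxy₁ hxy hlt₁ hlt
    · rw [max_eq_left hlt.le]
      exact main _ _ _ _ hxy₁ hxy.symm hlt₁ hlt
  have hy₁ := (hle.2 hxy₁).snd_mem
  refine ⟨blk (num y₁), h.blk_ne_zero_of_adj (hle.2 hxy₁) hlt₁,
    h.blk_le (h.num_ne_zero _ hy₁) (h.num_le _ hy₁), fun x hx => ?_, fun x y hxy => hadj x y hxy⟩
  by_cases hxx : x = x₁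
  · rw [hxx]
    exact (hadj _ _ hxy₁).fst_mem
  · obtain ⟨z, hz⟩ := hH.1.exists_adj hx hxy₁.fst_mem hxx
    exact (hadj _ _ hz).fst_mem

theorem exists_le_block {H : (⊤ : SimpleGraph V).Subgraph} (hH : Biconnected H) (hle : H ≤ U) :
    ∃ b, b ≠ 0 ∧ b ≤ nb ∧ H ≤ h.block b := by
  by_cases hadj : ∃ x y, H.Adj x y
  · obtain ⟨x, y, hxy⟩ := hadj
    exact h.exists_le_block_of_adj hH hle hxy
  push Not at hadj
  obtain ⟨x, hx⟩ := (SimpleGraph.Subgraph.connected_iff_reachable_spanningCoe.1 hH.1).1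
  have hone : ∀ y ∈ H.verts, y = x := by
    intro y hy
    by_contra hne
    obtain ⟨z, hz⟩ := hH.1.exists_adj hy hx hne
    exact hadj y z hz
  have hxU := hle.1 hx
  -- Without edges `H` is a single vertex. It lies in the block of any of its edges in `U`, or opens
  -- its own block if it has none.
  suffices ∃ b, b ≠ 0 ∧ b ≤ nb ∧ x ∈ (h.block b).verts by
    obtain ⟨b, hb0, hb, hxb⟩ := this
    exact ⟨b, hb0, hb, fun y hy => by rwa [hone y hy], fun y z hyz => absurd hyz (hadj y z)⟩
  have hx0 := h.num_ne_zero x hxU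
  have hxn := h.num_le x hxU
  by_cases hiso : ∃ y, U.Adj x y
  · obtain ⟨y, hxy⟩ := hiso
    have hy := hxy.snd_mem
    rcases lt_or_gt_of_ne (h.num_ne hxy) with hlt | hlt
    · have hA : (h.block (blk (num y))).Adj x y := ⟨hxy, by rw [max_eq_right hlt.le]⟩
      exact ⟨_, h.blk_ne_zero_of_adj hxy hlt, h.blk_le (h.num_ne_zero y hy) (h.num_le y hy),
        hA.fst_mem⟩
    · have hA : (h.block (blk (num x))).Adj x y := ⟨hxy, by rw [max_eq_left hlt.le]⟩
      exact ⟨_, h.blk_ne_zero_of_adj hxy.symm hlt, h.blk_le hx0 hxn, hA.fst_mem⟩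
  · push Not at hiso
    have hP : P (num x) = 0 := by
      by_contra hP
      obtain ⟨y, -, hy⟩ := h.tree_adj x hxU hP
      exact hiso y hy.symm
    have ho : OpensBlock U num P low (num x) := by
      refine Or.inl ⟨hP, fun a b hab hax => ?_⟩
      rw [h.num_injOn hab.fst_mem hxU hax] at hab
      exact hiso b hab
    obtain ⟨h1, h2, -⟩ := h.lead_blk _ hx0 hxn ho
    exact ⟨_, h1, h2, hxU, Or.inl rfl⟩

/-- The tree edge above an opening vertex belongs to its own block only. A block without this edge
is an isolated vertex, which is in no other block. -/
theorem eq_of_block_le {b b' : ℕ} (hb0 : b ≠ 0) (hb : b ≤ nb) (hb0' : b' ≠ 0) (hb' : b' ≤ nb)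
    (hle : h.block b ≤ h.block b') : b = b' := by
  obtain ⟨hl0, hln, hlb, hlo⟩ := h.lead_spec b hb0 hb
  obtain ⟨l, hl, hlnum⟩ := h.exists_num _ hl0 hln
  by_cases hP : P (lead b) = 0
  · have hlmem : l ∈ (h.block b).verts := ⟨hl, Or.inl (by rw [hlnum, hlb])⟩
    obtain ⟨-, hl' | hl'⟩ := hle.1 hlmem
    · rw [hlnum, hlb] at hl'
      exact hl'
    · exfalso
      obtain ⟨hl0', hln', hlb', hlo'⟩ := h.lead_spec b' hb0' hb'
      obtain ⟨x, y, hxy, hx, -⟩ := h.exists_adj_of_parent hln' (by omega)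
      rcases hlo with ho | ho
      · exact ho.2 x y hxy (by omega)
      · exact ho.1 hP
  · obtain ⟨t, ht, htl⟩ := h.tree_adj l hl (by rwa [hlnum])
    rw [hlnum] at ht
    have hlt := h.parent_lt _ hl0
    have hmax : max (num t) (num l) = lead b := by
      rw [max_eq_right (by omega), hlnum]
    have hA : (h.block b).Adj t l := ⟨htl, by rw [hmax, hlb]⟩
    have := (hle.2 hA).2
    rw [hmax, hlb] at this
    exact this

/-- The numbered blocks are biconnected, pairwise incomparable, and every biconnected subgraph lies
in one of them; so they are the maximal ones. -/
theorem isBlock_iff {B : (⊤ : SimpleGraph V).Subgraph} :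
    IsBlock U B ↔ ∃ b, b ≠ 0 ∧ b ≤ nb ∧ B = h.block b := by
  constructor
  · intro hB
    obtain ⟨b, hb0, hb, hle⟩ := h.exists_le_block hB.prop.2 hB.prop.1
    exact ⟨b, hb0, hb, hB.eq_of_le ⟨h.block_le b, h.block_biconnected hb0 hb⟩ hle⟩
  · rintro ⟨b, hb0, hb, rfl⟩
    refine ⟨⟨h.block_le b, h.block_biconnected hb0 hb⟩, fun H hH hle => ?_⟩
    obtain ⟨b', hb0', hb', hle'⟩ := h.exists_le_block hH.2 hH.1
    rwa [h.eq_of_block_le hb0 hb hb0' hb' (hle.trans hle')]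

end IsBlockNumbering

/-! ### Reasoning about programs -/

namespace RAM

/-- All registers and cells hold numbers that are at most `M`. -/
def State.Bdd (M : ℕ) (s : State) : Prop := (∀ x, s.reg x ≤ M) ∧ ∀ a i, s.arr a i ≤ M

/-- The largest constant of an expression. -/
def Expr.maxConst : Expr → ℕ
  | const k => k
  | reg _ => 0
  | load _ e => e.maxConst
  | add e f => max e.maxConst f.maxConst
  | sub e f => max e.maxConst f.maxConst

/-- An expression adds up at most as many stored numbers and constants as it has operations. Hence
temporary values may exceed `M`, but only by a constant factor, which `W` absorbs. -/
theorem Expr.eval_le_and_fits {M W : ℕ} {s : State} (hs : s.Bdd M) (e : Expr)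
    (hc : e.maxConst ≤ M) (hW : e.cost * M ≤ W) : e.eval s ≤ e.cost * M ∧ e.Fits W s := by
  induction e generalizing W with
  | const k => simpa [Expr.eval, Expr.Fits, Expr.cost, Expr.maxConst] using ⟨hc, hc.trans (by
      simpa [Expr.cost] using hW)⟩
  | reg x => simpa [Expr.eval, Expr.Fits, Expr.cost] using ⟨hs.1 x, (hs.1 x).trans (by
      simpa [Expr.cost] using hW)⟩
  | load a e ih =>
    simp only [Expr.cost, Expr.maxConst, Expr.eval, Expr.Fits, Nat.add_mul, one_mul] at *
    have h1 := hs.2 a (e.eval s)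
    exact ⟨by omega, (ih hc (by omega)).2, by omega⟩
  | add e f ihe ihf =>
    simp only [Expr.cost, Expr.maxConst, Expr.eval, Expr.Fits, Nat.add_mul, one_mul,
      max_le_iff] at *
    have h1 := ihe (W := W) hc.1 (by omega)
    have h2 := ihf (W := W) hc.2 (by omega)
    exact ⟨by omega, h1.2, h2.2, by omega⟩
  | sub e f ihe ihf =>
    simp only [Expr.cost, Expr.maxConst, Expr.eval, Expr.Fits, Nat.add_mul, one_mul,
      max_le_iff] at *
    have h1 := ihe (W := W) hc.1 (by omega)
    have h2 := ihf (W := W) hc.2 (by omega)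
    exact ⟨by omega, h1.2, h2.2⟩

/-- What has to be checked so that the value of an expression is at most `M` if all registers and
cells and the constants are: the additions. -/
def Expr.Bounded (M : ℕ) (s : State) : Expr → Prop
  | const _ => True
  | reg _ => True
  | load _ _ => True
  | add e f => e.eval s + f.eval s ≤ M
  | sub e _ => e.Bounded M s

theorem Expr.eval_le {M : ℕ} {s : State} (hs : s.Bdd M) (e : Expr) (hc : e.maxConst ≤ M)
    (h : e.Bounded M s) : e.eval s ≤ M := by
  induction e with
  | const k => exact hc
  | reg x => exact hs.1 x
  | load a e => exact hs.2 a _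
  | add e f => exact h
  | sub e f ihe => exact (Nat.sub_le _ _).trans (ihe ((le_max_left _ _).trans hc) h)

/-- The number of operations of one pass through a program. -/
def Program.size : Program → ℕ
  | skip => 1
  | assign _ e => e.cost + 1
  | store _ e f => e.cost + f.cost + 1
  | seq c d => c.size + d.size
  | ite e c d => e.cost + 1 + (c.size + d.size)
  | loop e c => e.cost + 1 + c.size

/-- The largest constant of a program. -/
def Program.maxConst : Program → ℕ
  | skip => 0
  | assign _ e => e.maxConst
  | store _ e f => max e.maxConst f.maxConst
  | seq c d => max c.maxConst d.maxConst
  | ite e c d => max e.maxConst (max c.maxConst d.maxConst)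
  | loop e c => max e.maxConst c.maxConst

/-- The weakest precondition of a program without loops for the postcondition `Q`, in a memory whose
numbers are bounded by `M`. -/
def Program.wp (M : ℕ) : Program → (State → Prop) → State → Prop
  | skip, Q, s => Q s
  | assign x e, Q, s => e.Bounded M s ∧ Q ⟨Function.update s.reg x (e.eval s), s.arr⟩
  | store a e f, Q, s => f.Bounded M s ∧
      Q ⟨s.reg, Function.update s.arr a (Function.update (s.arr a) (e.eval s) (f.eval s))⟩
  | seq c d, Q, s => c.wp M (d.wp M Q) s
  | ite e c d, Q, s => (e.eval s ≠ 0 → c.wp M Q s) ∧ (e.eval s = 0 → d.wp M Q s)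
  | loop _ _, _, _ => False

/-- The program halts within `T` operations in a state with numbers at most `M` for which `Q`
holds. -/
def Runs (W M : ℕ) (c : Program) (s : State) (T : ℕ) (Q : State → Prop) : Prop :=
  ∃ t s', Exec W c s t s' ∧ t ≤ T ∧ s'.Bdd M ∧ Q s'

theorem State.Bdd.update_reg {M : ℕ} {s : State} (hs : s.Bdd M) {x v : ℕ} (hv : v ≤ M) :
    State.Bdd M ⟨Function.update s.reg x v, s.arr⟩ := by
  refine ⟨fun y => ?_, hs.2⟩
  by_cases hy : y = x
  · subst hy
    simpa using hv
  · simpa [Function.update_of_ne hy] using hs.1 y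

theorem State.Bdd.update_arr {M : ℕ} {s : State} (hs : s.Bdd M) {a i v : ℕ} (hv : v ≤ M) :
    State.Bdd M ⟨s.reg, Function.update s.arr a (Function.update (s.arr a) i v)⟩ := by
  refine ⟨hs.1, fun b j => ?_⟩
  by_cases hb : b = a
  · subst hb
    by_cases hj : j = i
    · subst hj
      simpa using hv
    · simpa [Function.update_of_ne hj] using hs.2 b j
  · simpa [Function.update_of_ne hb] using hs.2 b j

/-- The size of loop-free code bounds its running time and also the factor by which temporaries
exceed `M`, so only the effect and the size of stored values remain to be checked. -/
theorem Runs.of_wp {W M : ℕ} {c : Program} {Q : State → Prop} {s : State} (hs : s.Bdd M)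
    (hW : c.size * M ≤ W) (hM : c.maxConst ≤ M) (h : c.wp M Q s) : Runs W M c s c.size Q := by
  induction c generalizing Q s with
  | skip => exact ⟨1, s, .skip s, le_rfl, hs, h⟩
  | assign x e =>
    simp only [Program.size, Program.maxConst, Nat.add_mul, one_mul] at hW hM
    exact ⟨_, _, .assign x e s (e.eval_le_and_fits hs hM (by omega)).2, le_rfl,
      hs.update_reg (e.eval_le hs hM h.1), h.2⟩
  | store a e f =>
    simp only [Program.size, Program.maxConst, Nat.add_mul, one_mul, max_le_iff] at hW hM
    exact ⟨_, _, .store a e f s (e.eval_le_and_fits hs hM.1 (by omega)).2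
      (f.eval_le_and_fits hs hM.2 (by omega)).2, le_rfl,
      hs.update_arr (f.eval_le hs hM.2 h.1), h.2⟩
  | seq c d ihc ihd =>
    simp only [Program.size, Program.maxConst, Nat.add_mul, max_le_iff] at hW hM
    obtain ⟨t, s', h1, h2, h3, h4⟩ := ihc hs (by omega) hM.1 h
    obtain ⟨t', s'', h5, h6, h7, h8⟩ := ihd h3 (by omega) hM.2 h4
    exact ⟨_, _, .seq h1 h5, Nat.add_le_add h2 h6, h7, h8⟩
  | ite e c d ihc ihd =>
    simp only [Program.size, Program.maxConst, Nat.add_mul, one_mul, max_le_iff] at hW hM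
    have he := (e.eval_le_and_fits (W := W) hs hM.1 (by omega)).2
    by_cases h0 : e.eval s = 0
    · obtain ⟨t, s', h1, h2, h3, h4⟩ := ihd hs (by omega) hM.2.2 (h.2 h0)
      exact ⟨_, _, .ite_false he h0 h1, by simp only [Program.size]; omega, h3, h4⟩
    · obtain ⟨t, s', h1, h2, h3, h4⟩ := ihc hs (by omega) hM.2.1 (h.1 h0)
      exact ⟨_, _, .ite_true he h0 h1, by simp only [Program.size]; omega, h3, h4⟩
  | loop e c => exact h.elim

theorem Runs.mono {W M : ℕ} {c : Program} {s : State} {T T' : ℕ} {Q Q' : State → Prop}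
    (h : Runs W M c s T Q) (hT : T ≤ T') (hQ : ∀ s', s'.Bdd M → Q s' → Q' s') :
    Runs W M c s T' Q' := by
  obtain ⟨t, s', h1, h2, h3, h4⟩ := h
  exact ⟨t, s', h1, h2.trans hT, h3, hQ s' h3 h4⟩

theorem Runs.seq {W M : ℕ} {c d : Program} {s : State} {T T' : ℕ} {Q R : State → Prop}
    (hc : Runs W M c s T R) (hd : ∀ s', s'.Bdd M → R s' → Runs W M d s' T' Q) :
    Runs W M (.seq c d) s (T + T') Q := by
  obtain ⟨t, s', h1, h2, h3, h4⟩ := hc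
  obtain ⟨t', s'', h5, h6, h7, h8⟩ := hd s' h3 h4
  exact ⟨_, _, .seq h1 h5, Nat.add_le_add h2 h6, h7, h8⟩

/-- Loops with an amortized running time: the body pays for its operations by a decrease of the
potential `k` of the invariant. -/
theorem Runs.loop {W M : ℕ} {e : Expr} {c : Program} (hW : e.cost * M ≤ W)
    (hM : e.maxConst ≤ M) {B : ℕ} {Inv : ℕ → State → Prop} (hB : e.cost + 1 ≤ B)
    (hbody : ∀ k s, s.Bdd M → Inv k s → e.eval s ≠ 0 →
      ∃ T k', Runs W M c s T (Inv k') ∧ e.cost + 1 + T + B * k' ≤ B * k)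
    {k : ℕ} {s : State} (hs : s.Bdd M) (h : Inv k s) :
    Runs W M (.loop e c) s (B * (k + 1)) (fun s' => ∃ k', Inv k' s' ∧ e.eval s' = 0) := by
  induction k using Nat.strong_induction_on generalizing s with
  | _ k ih =>
  have he := (e.eval_le_and_fits hs hM hW).2
  by_cases h0 : e.eval s = 0
  · exact ⟨_, s, .loop_false he h0, by nlinarith, hs, k, h, h0⟩
  · obtain ⟨T, k', ⟨t, s', h1, h2, h3, h4⟩, hk⟩ := hbody k s hs h h0
    -- The test alone costs an operation, so a body that pays for itself strictly lowers the
    -- potential; termination needs no separate measure.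
    have hlt : k' < k := by
      by_contra hcon
      have := Nat.mul_le_mul_left B (not_lt.1 hcon)
      omega
    obtain ⟨t', s'', h5, h6, h7, h8⟩ := ih k' hlt h3 h4
    refine ⟨_, s'', .loop_true he h0 h1 h5, ?_, h7, h8⟩
    rw [Nat.mul_add] at h6 ⊢
    omega

/-- Loops whose bodies have no loops: the potential decreases with each pass. -/
theorem Runs.loop_wp {W M : ℕ} {e : Expr} {c : Program} (hW : (Program.loop e c).size * M ≤ W)
    (hM : (Program.loop e c).maxConst ≤ M) {Inv : ℕ → State → Prop}
    (hbody : ∀ k s, s.Bdd M → Inv k s → e.eval s ≠ 0 →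
      c.wp M (fun s' => ∃ k' < k, Inv k' s') s)
    {k : ℕ} {s : State} (hs : s.Bdd M) (h : Inv k s) :
    Runs W M (.loop e c) s ((Program.loop e c).size * (k + 1))
      (fun s' => ∃ k', Inv k' s' ∧ e.eval s' = 0) := by
  simp only [Program.size, Program.maxConst, Nat.add_mul, one_mul, max_le_iff] at hW hM
  -- the potential may be assumed to decrease by exactly one
  let Inv' : ℕ → State → Prop := fun k s => ∃ k' ≤ k, Inv k' s
  refine (Runs.loop (Inv := Inv') (B := (Program.loop e c).size) (by omega) hM.1
    (by simp only [Program.size]; omega) ?_ hs ⟨k, le_rfl, h⟩).mono le_rfl ?_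
  · rintro k s hs ⟨k₁, hk₁, hinv⟩ h0
    have h1 := hbody k₁ s hs hinv h0
    have h2 := Runs.of_wp (W := W) hs (by omega) hM.2 h1
    have hk : k ≠ 0 := by
      rintro rfl
      obtain ⟨t, s', -, -, -, k', hk', -⟩ := h2
      omega
    refine ⟨c.size, k - 1, h2.mono le_rfl fun s' _ ⟨k', hk', h'⟩ => ⟨k', by omega, h'⟩, ?_⟩
    · obtain ⟨k, rfl⟩ := Nat.exists_eq_succ_of_ne_zero hk
      simp only [Program.size, Nat.succ_eq_add_one, Nat.add_sub_cancel]
      rw [Nat.mul_add, mul_one]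
      omega
  · rintro s' - ⟨k, ⟨k', -, h'⟩, h0⟩
    exact ⟨k', h', h0⟩

/-- The registers that a program may change. -/
def Program.regs : Program → List ℕ
  | skip => []
  | assign x _ => [x]
  | store _ _ _ => []
  | seq c d => c.regs ++ d.regs
  | ite _ c d => c.regs ++ d.regs
  | loop _ c => c.regs

/-- The arrays that a program may change. -/
def Program.arrs : Program → List ℕ
  | skip => []
  | assign _ _ => []
  | store a _ _ => [a]
  | seq c d => c.arrs ++ d.arrs
  | ite _ c d => c.arrs ++ d.arrs
  | loop _ c => c.arrs

/-- The sets of changed registers and arrays are computed from the program text, so preservation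
across a whole pass is settled by `decide`. -/
theorem Exec.frame {W : ℕ} {c : Program} {s s' : State} {t : ℕ} (h : Exec W c s t s') :
    (∀ x ∉ c.regs, s'.reg x = s.reg x) ∧ ∀ a ∉ c.arrs, s'.arr a = s.arr a := by
  induction h with
  | skip s => exact ⟨fun _ _ => rfl, fun _ _ => rfl⟩
  | assign x e s he =>
    refine ⟨fun y hy => ?_, fun _ _ => rfl⟩
    exact Function.update_of_ne (by simpa [Program.regs] using hy) _ _
  | store a e f s he hf =>
    refine ⟨fun _ _ => rfl, fun b hb => ?_⟩
    exact Function.update_of_ne (by simpa [Program.arrs] using hb) _ _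
  | seq _ _ ih₁ ih₂ =>
    simp only [Program.regs, Program.arrs, List.mem_append, not_or]
    exact ⟨fun x hx => (ih₂.1 x hx.2).trans (ih₁.1 x hx.1),
      fun a ha => (ih₂.2 a ha.2).trans (ih₁.2 a ha.1)⟩
  | ite_true _ _ _ ih =>
    simp only [Program.regs, Program.arrs, List.mem_append, not_or]
    exact ⟨fun x hx => ih.1 x hx.1, fun a ha => ih.2 a ha.1⟩
  | ite_false _ _ _ ih =>
    simp only [Program.regs, Program.arrs, List.mem_append, not_or]
    exact ⟨fun x hx => ih.1 x hx.2, fun a ha => ih.2 a ha.2⟩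
  | loop_true _ _ _ _ ih₁ ih₂ =>
    exact ⟨fun x hx => (ih₂.1 x hx).trans (ih₁.1 x hx),
      fun a ha => (ih₂.2 a ha).trans (ih₁.2 a ha)⟩
  | loop_false => exact ⟨fun _ _ => rfl, fun _ _ => rfl⟩

theorem Runs.frame {W M : ℕ} {c : Program} {s : State} {T : ℕ} {Q : State → Prop}
    (h : Runs W M c s T Q) :
    Runs W M c s T (fun s' => Q s' ∧ (∀ x ∉ c.regs, s'.reg x = s.reg x) ∧
      ∀ a ∉ c.arrs, s'.arr a = s.arr a) := by
  obtain ⟨t, s', h1, h2, h3, h4⟩ := h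
  exact ⟨t, s', h1, h2, h3, h4, h1.frame⟩

end RAM

/-! ### Linked lists in arrays -/

/-- The items `1, …, k` are stored in linked lists, one for each key and in decreasing order; zero is
the end of a list. -/
structure IsBucket (key head next : ℕ → ℕ) (k : ℕ) : Prop where
  next_lt : ∀ a, a ≠ 0 → a ≤ k → next a < a
  key_next : ∀ a, a ≠ 0 → a ≤ k → next a ≠ 0 → key (next a) = key a
  le_next : ∀ a b, a ≠ 0 → a ≤ k → b ≠ 0 → b < a → key b = key a → b ≤ next a
  head_le : ∀ x, head x ≤ k
  key_head : ∀ x, head x ≠ 0 → key (head x) = x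
  le_head : ∀ a, a ≠ 0 → a ≤ k → a ≤ head (key a)

theorem IsBucket.zero {key head next : ℕ → ℕ} (h : ∀ x, head x = 0) :
    IsBucket key head next 0 := by
  constructor <;> intros <;> simp_all

/-- The new item is larger than all stored ones, so putting it in front keeps its list decreasing,
and its successor is the old head, the largest earlier item with the same key. -/
theorem IsBucket.push {key head next : ℕ → ℕ} {k : ℕ} (h : IsBucket key head next k) (x : ℕ) :
    IsBucket (Function.update key (k + 1) x) (Function.update head x (k + 1))
      (Function.update next (k + 1) (head x)) (k + 1) := by
  have hk : ∀ a ≤ k, Function.update key (k + 1) x a = key a := fun a ha =>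
    Function.update_of_ne (by omega) _ _
  have hn : ∀ a ≤ k, Function.update next (k + 1) (head x) a = next a := fun a ha =>
    Function.update_of_ne (by omega) _ _
  constructor
  · intro a ha0 ha
    rcases ha.eq_or_lt with rfl | ha
    · have := h.head_le x
      rw [Function.update_self]
      omega
    · rw [hn a (by omega)]
      exact h.next_lt a ha0 (by omega)
  · intro a ha0 ha
    rcases ha.eq_or_lt with rfl | ha
    · rw [Function.update_self, Function.update_self, hk _ (h.head_le x)]
      exact h.key_head x
    · have := h.next_lt a ha0 (by omega)
      rw [hn a (by omega), hk a (by omega), hk _ (by omega)]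
      exact h.key_next a ha0 (by omega)
  · intro a b ha0 ha hb0 hb
    rcases ha.eq_or_lt with rfl | ha
    · rw [Function.update_self, Function.update_self, hk b (by omega)]
      rintro rfl
      exact h.le_head b hb0 (by omega)
    · rw [hn a (by omega), hk a (by omega), hk b (by omega)]
      exact h.le_next a b ha0 (by omega) hb0 hb
  · intro y
    by_cases hy : y = x
    · rw [hy, Function.update_self]
    · rw [Function.update_of_ne hy]
      exact (h.head_le y).trans (by omega)
  · intro y hy0
    by_cases hy : y = x
    · rw [hy, Function.update_self, Function.update_self]
    · rw [Function.update_of_ne hy] at hy0 ⊢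
      rw [hk _ (h.head_le y)]
      exact h.key_head y hy0
  · intro a ha0 ha
    rcases ha.eq_or_lt with rfl | ha
    · rw [Function.update_self, Function.update_self]
    · rw [hk a (by omega)]
      by_cases hy : key a = x
      · rw [hy, Function.update_self]
        omega
      · rw [Function.update_of_ne hy]
        exact h.le_head a ha0 (by omega)

/-- The arcs `1, …, k` from `src` to `dst`, stored in linked lists by their sources, represent the
relation `R`. -/
structure IsArcList (src dst head next : ℕ → ℕ) (k : ℕ) (R : ℕ → ℕ → Prop) : Prop where
  bucket : IsBucket src head next k
  sound : ∀ a, a ≠ 0 → a ≤ k → R (src a) (dst a)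
  complete : ∀ x y, R x y → ∃ a, a ≠ 0 ∧ a ≤ k ∧ src a = x ∧ dst a = y

theorem IsArcList.push {src dst head next : ℕ → ℕ} {k : ℕ} {R R' : ℕ → ℕ → Prop}
    (h : IsArcList src dst head next k R) (x y : ℕ)
    (hR : ∀ a b, R' a b ↔ R a b ∨ (a = x ∧ b = y)) :
    IsArcList (Function.update src (k + 1) x) (Function.update dst (k + 1) y)
      (Function.update head x (k + 1)) (Function.update next (k + 1) (head x)) (k + 1) R' := by
  refine ⟨h.bucket.push x, ?_, ?_⟩
  · intro a ha0 ha
    rw [hR]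
    rcases ha.eq_or_lt with rfl | ha
    · exact Or.inr ⟨Function.update_self _ _ _, Function.update_self _ _ _⟩
    · rw [Function.update_of_ne (by omega), Function.update_of_ne (by omega)]
      exact Or.inl (h.sound a ha0 (by omega))
  · intro a b hab
    rcases (hR a b).1 hab with hab | ⟨rfl, rfl⟩
    · obtain ⟨c, hc0, hc, rfl, rfl⟩ := h.complete a b hab
      exact ⟨c, hc0, by omega, Function.update_of_ne (by omega) _ _,
        Function.update_of_ne (by omega) _ _⟩
    · exact ⟨k + 1, by omega, le_rfl, Function.update_self _ _ _, Function.update_self _ _ _⟩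

theorem IsArcList.congr {src dst head next : ℕ → ℕ} {k : ℕ} {R R' : ℕ → ℕ → Prop}
    (h : IsArcList src dst head next k R) (hR : ∀ a b, R' a b ↔ R a b) :
    IsArcList src dst head next k R' :=
  ⟨h.bucket, fun a h0 ha => (hR _ _).2 (h.sound a h0 ha),
    fun x y hxy => h.complete x y ((hR _ _).1 hxy)⟩

/-! ### Reading the input -/

/-- The array `A` holds a code of the instance `I` with vertices `0, …, n - 1` and `m` edges. -/
structure IsInput (I : SefeInstance ℕ) (n m : ℕ) (A : ℕ → ℕ) : Prop where
  verts_eq : I.union.verts = {v | v < n}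
  num_verts : A 0 = n
  num_edges : A 1 = m
  label : ∀ i < n, SefeInstance.IsLabel (A (2 + 2 * i) ∈ I.G₁.verts) (A (2 + 2 * i) ∈ I.G₂.verts)
    (A (2 + 2 * i + 1))
  exists_name : ∀ v < n, ∃ i < n, A (2 + 2 * i) = v
  edge_label : ∀ j < m, SefeInstance.IsLabel
    (I.G₁.Adj (A (2 + 2 * n + 3 * j)) (A (2 + 2 * n + 3 * j + 1)))
    (I.G₂.Adj (A (2 + 2 * n + 3 * j)) (A (2 + 2 * n + 3 * j + 1))) (A (2 + 2 * n + 3 * j + 2))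
  exists_edge : ∀ u v, I.union.Adj u v → ∃ j < m,
    s(A (2 + 2 * n + 3 * j), A (2 + 2 * n + 3 * j + 1)) = s(u, v)
  edge_inj : ∀ i < m, ∀ j < m, s(A (2 + 2 * n + 3 * i), A (2 + 2 * n + 3 * i + 1)) =
    s(A (2 + 2 * n + 3 * j), A (2 + 2 * n + 3 * j + 1)) → i = j

theorem SefeInstance.IsLabel.or {p q : Prop} {ℓ : ℕ} (h : SefeInstance.IsLabel p q ℓ) :
    p ∨ q := by
  rcases h with h | h | h
  exacts [Or.inl h.1, Or.inr h.2.1, Or.inl h.1]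

theorem IsInput.adj {I : SefeInstance ℕ} {n m : ℕ} {A : ℕ → ℕ} (h : IsInput I n m A) {j : ℕ}
    (hj : j < m) : I.union.Adj (A (2 + 2 * n + 3 * j)) (A (2 + 2 * n + 3 * j + 1)) :=
  (h.edge_label j hj).or

theorem IsInput.lt_of_mem {I : SefeInstance ℕ} {n m : ℕ} {A : ℕ → ℕ} (h : IsInput I n m A) {v : ℕ}
    (hv : v ∈ I.union.verts) : v < n := by
  rwa [h.verts_eq] at hv

/-- The arcs of the search: from the node 0 to all nodes, and from the node of a vertex to those of its
neighbours. -/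
def SearchArc (I : SefeInstance ℕ) (n x y : ℕ) : Prop :=
  (x = 0 ∧ y ≠ 0 ∧ y ≤ n) ∨ (x ≠ 0 ∧ y ≠ 0 ∧ I.union.Adj (x - 1) (y - 1))

namespace RAM

open RAM.Expr RAM.Program

/-- Adds the arc from the register `f` to the register `t`. The array 3 holds the sources, 4 the
targets, 5 the successors in the lists and 6 the first arcs; register 5 counts the arcs. -/
def addArc (f t : ℕ) : Program :=
  .seq (.assign 5 (.add (.reg 5) (.const 1))) <|
  .seq (.store 3 (.reg 5) (.reg f)) <|
  .seq (.store 4 (.reg 5) (.reg t)) <|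
  .seq (.store 5 (.reg 5) (.load 6 (.reg f))) <|
  .store 6 (.reg f) (.reg 5)

/-- The postcondition is a continuation, so that consecutive additions chain; the caller chooses the
form `R'` of the enlarged relation. -/
theorem addArc_wp {M : ℕ} {f t k : ℕ} {R : ℕ → ℕ → Prop} (R' : ℕ → ℕ → Prop) {s : State}
    {Q : State → Prop} (hf : f ≠ 5) (ht : t ≠ 5) (hk : s.reg 5 = k) (hM : k + 1 ≤ M)
    (h : IsArcList (s.arr 3) (s.arr 4) (s.arr 6) (s.arr 5) k R)
    (hR : ∀ a b, R' a b ↔ R a b ∨ (a = s.reg f ∧ b = s.reg t))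
    (hQ : ∀ s' : State, (∀ x, x ≠ 5 → s'.reg x = s.reg x) → s'.reg 5 = k + 1 →
      (∀ a, a ≠ 3 → a ≠ 4 → a ≠ 5 → a ≠ 6 → s'.arr a = s.arr a) →
      IsArcList (s'.arr 3) (s'.arr 4) (s'.arr 6) (s'.arr 5) (k + 1) R' → Q s') :
    (addArc f t).wp M Q s := by
  subst hk
  simp only [addArc, Program.wp, Expr.Bounded, Expr.eval, true_and]
  refine ⟨hM, hQ _ ?_ ?_ ?_ ?_⟩
  · intro x hx
    simp [hx]
  · simp
  · intro a h3 h4 h5 h6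
    simp [h3, h4, h5, h6]
  · have := h.push (s.reg f) (s.reg t) hR
    simpa [hf, ht] using this

/-- Reads the vertices. The array 2 gets the labels, at the addresses of the nodes `v + 1`, and the
array 11 the initial lowpoints; there is an arc from the node 0 to each node. -/
def readVertices : Program :=
  .loop (.sub (.reg 1) (.reg 3)) <|
    .seq (.store 2 (.add (.load 0 (.reg 4)) (.const 1)) (.load 0 (.add (.reg 4) (.const 1)))) <|
    .seq (.assign 3 (.add (.reg 3) (.const 1))) <|
    .seq (.store 11 (.reg 3) (.reg 3)) <|
    .seq (.assign 4 (.add (.reg 4) (.const 2))) <|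
    addArc 6 3

/-- Reads the edges and adds two arcs for each of them. -/
def readEdges : Program :=
  .loop (.sub (.reg 2) (.reg 3)) <|
    .seq (.assign 3 (.add (.reg 3) (.const 1))) <|
    .seq (.assign 6 (.add (.load 0 (.reg 4)) (.const 1))) <|
    .seq (.assign 7 (.add (.load 0 (.add (.reg 4) (.const 1))) (.const 1))) <|
    .seq (.assign 4 (.add (.reg 4) (.const 3))) <|
    .seq (addArc 6 7) (addArc 7 6)

section

variable {I : SefeInstance ℕ} {n m : ℕ} {A : ℕ → ℕ} {W M : ℕ}

theorem readVertices_runs (hA : IsInput I n m A) (hM : 10 * (n + m + 1) ≤ M)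
    (hW : 1000 * M ≤ W) {s : State} (hs : s.Bdd M) (h0 : s.arr 0 = A) (h1 : s.reg 1 = n)
    (h3 : s.reg 3 = 0) (h4 : s.reg 4 = 2) (h5 : s.reg 5 = 0) (h6 : s.reg 6 = 0)
    (ha6 : ∀ x, s.arr 6 x = 0) :
    Runs W M readVertices s (1000 * (n + 1)) (fun s' =>
      s'.reg 4 = 2 + 2 * n ∧ s'.reg 5 = n ∧
      (∀ v < n, SefeInstance.IsLabel (v ∈ I.G₁.verts) (v ∈ I.G₂.verts) (s'.arr 2 (v + 1))) ∧
      (∀ q, q ≠ 0 → q ≤ n → s'.arr 11 q = q) ∧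
      IsArcList (s'.arr 3) (s'.arr 4) (s'.arr 6) (s'.arr 5) n
        (fun x y => x = 0 ∧ y ≠ 0 ∧ y ≤ n)) := by
  let Inv : ℕ → State → Prop := fun k s => ∃ i, i + k = n ∧ s.arr 0 = A ∧ s.reg 1 = n ∧
    s.reg 3 = i ∧ s.reg 4 = 2 + 2 * i ∧ s.reg 5 = i ∧ s.reg 6 = 0 ∧
    (∀ j < i, SefeInstance.IsLabel (A (2 + 2 * j) ∈ I.G₁.verts) (A (2 + 2 * j) ∈ I.G₂.verts)
      (s.arr 2 (A (2 + 2 * j) + 1))) ∧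
    (∀ q, q ≠ 0 → q ≤ i → s.arr 11 q = q) ∧
    IsArcList (s.arr 3) (s.arr 4) (s.arr 6) (s.arr 5) i (fun x y => x = 0 ∧ y ≠ 0 ∧ y ≤ i)
  refine (Runs.loop_wp (Inv := Inv) (k := n) ?_ ?_ ?_ hs ?_).mono ?_ ?_
  · exact (Nat.mul_le_mul_right M (by decide)).trans hW
  · exact le_trans (by decide) (show 10 ≤ M by omega)
  · rintro k s hs ⟨i, hi, a0, r1, r3, r4, r5, r6, hlab, hlow, harc⟩ hcond
    simp only [Expr.eval, r1, r3] at hcond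
    have hin : i < n := by omega
    simp only [Program.wp, Expr.Bounded, Expr.eval, true_and, a0, r3, r4]
    refine ⟨by omega, ?_, addArc_wp (R := fun x y => x = 0 ∧ y ≠ 0 ∧ y ≤ i) (k := i)
      (fun x y => x = 0 ∧ y ≠ 0 ∧ y ≤ i + 1) (by decide) (by decide) ?_ ?_ ?_ ?_ ?_⟩
    · simp; omega
    · simpa using r5
    · omega
    · simpa using harc
    · intro a b
      simp [r6]
      omega
    · intro s' hreg h5' harr harc'
      refine ⟨k - 1, by omega, i + 1, by omega, ?_, ?_, ?_, ?_, h5', ?_, ?_, ?_, harc'⟩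
      · rw [harr 0 (by decide) (by decide) (by decide) (by decide)]
        simpa using a0
      · rw [hreg 1 (by decide)]
        simpa using r1
      · rw [hreg 3 (by decide)]
        simp
      · rw [hreg 4 (by decide)]
        simp
        omega
      · rw [hreg 6 (by decide)]
        simpa using r6
      · intro j hj
        rw [harr 2 (by decide) (by decide) (by decide) (by decide)]
        simp only [Function.update_of_ne (show (2 : ℕ) ≠ 11 by decide), Function.update_self]
        -- Overwriting a label is harmless: a label is determined by the name, so equal names carry
        -- equal labels.
        by_cases hjA : A (2 + 2 * j) + 1 = A (2 + 2 * i) + 1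
        · rw [hjA, Function.update_self, show A (2 + 2 * j) = A (2 + 2 * i) by omega]
          exact hA.label i hin
        · rw [Function.update_of_ne hjA]
          refine hlab j ?_
          rcases Nat.lt_succ_iff_lt_or_eq.1 hj with hj | rfl
          exacts [hj, absurd rfl hjA]
      · intro q hq0 hq
        rw [harr 11 (by decide) (by decide) (by decide) (by decide)]
        simp only [Function.update_self]
        by_cases hqi : q = i + 1
        · simp [hqi]
        · simpa [hqi] using hlow q hq0 (by omega)
  · refine ⟨0, by omega, h0, h1, h3, h4, h5, h6, by simp, fun q h h' => absurd h' (by omega),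
      IsBucket.zero ha6, fun a ha0 ha => absurd ha (by omega), fun x y h => absurd h (by omega)⟩
  · exact Nat.mul_le_mul_right _ (by decide)
  · rintro s' hs' ⟨k, ⟨i, hi, a0, r1, r3, r4, r5, r6, hlab, hlow, harc⟩, hcond⟩
    simp only [Expr.eval, r1, r3] at hcond
    obtain rfl : i = n := by omega
    refine ⟨r4, r5, fun v hv => ?_, hlow, harc⟩
    obtain ⟨j, hj, rfl⟩ := hA.exists_name v hv
    exact hlab j hj

theorem readEdges_runs (hA : IsInput I n m A) (hM : 10 * (n + m + 1) ≤ M)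
    (hW : 1000 * M ≤ W) {s : State} (hs : s.Bdd M) (h0 : s.arr 0 = A) (h2 : s.reg 2 = m)
    (h3 : s.reg 3 = 0) (h4 : s.reg 4 = 2 + 2 * n) (h5 : s.reg 5 = n)
    (harc : IsArcList (s.arr 3) (s.arr 4) (s.arr 6) (s.arr 5) n
        (fun x y => x = 0 ∧ y ≠ 0 ∧ y ≤ n)) :
    Runs W M readEdges s (1000 * (m + 1)) (fun s' =>
      IsArcList (s'.arr 3) (s'.arr 4) (s'.arr 6) (s'.arr 5) (n + 2 * m) (SearchArc I n)) := by
  let R : ℕ → ℕ → ℕ → Prop := fun i x y => (x = 0 ∧ y ≠ 0 ∧ y ≤ n) ∨ ∃ j < i,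
    (x = A (2 + 2 * n + 3 * j) + 1 ∧ y = A (2 + 2 * n + 3 * j + 1) + 1) ∨
    (x = A (2 + 2 * n + 3 * j + 1) + 1 ∧ y = A (2 + 2 * n + 3 * j) + 1)
  let Inv : ℕ → State → Prop := fun k s => ∃ i, i + k = m ∧ s.arr 0 = A ∧ s.reg 2 = m ∧
    s.reg 3 = i ∧ s.reg 4 = 2 + 2 * n + 3 * i ∧ s.reg 5 = n + 2 * i ∧
    IsArcList (s.arr 3) (s.arr 4) (s.arr 6) (s.arr 5) (n + 2 * i) (R i)
  refine (Runs.loop_wp (Inv := Inv) (k := m) ?_ ?_ ?_ hs ?_).mono ?_ ?_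
  · exact (Nat.mul_le_mul_right M (by decide)).trans hW
  · exact le_trans (by decide) (show 10 ≤ M by omega)
  · rintro k s hs ⟨i, hi, a0, r2, r3, r4, r5, harc⟩ hcond
    simp only [Expr.eval, r2, r3] at hcond
    have him : i < m := by omega
    have hu := hA.lt_of_mem (hA.adj him).fst_mem
    have hv := hA.lt_of_mem (hA.adj him).snd_mem
    set u := A (2 + 2 * n + 3 * i) with hu_def
    set v := A (2 + 2 * n + 3 * i + 1) with hv_def
    simp only [Program.wp, Expr.Bounded, Expr.eval, a0, r3]
    simp only [ne_eq, Nat.reduceEqDiff, not_false_eq_true,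
      Function.update_of_ne, r4, ← hu_def, ← hv_def]
    refine ⟨by omega, by omega, by omega, by omega,
      addArc_wp (R := R i) (k := n + 2 * i) (fun x y => R i x y ∨ (x = u + 1 ∧ y = v + 1))
        (by decide) (by decide) ?_ ?_ ?_ ?_ ?_⟩
    · simpa using r5
    · omega
    · simpa using harc
    · intro a b
      simp
    · intro s₁ hreg₁ h5₁ harr₁ harc₁
      refine addArc_wp (k := n + 2 * i + 1) (R (i + 1)) (by decide) (by decide) h5₁ (by omega)
        harc₁ ?_ ?_
      · intro a b
        rw [hreg₁ 6 (by decide), hreg₁ 7 (by decide)]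
        simp only [R, Nat.exists_lt_succ_right, or_assoc, Function.update_self, ne_eq,
          Nat.reduceEqDiff, not_false_eq_true, Function.update_of_ne, ← hu_def, ← hv_def]
      · intro s₂ hreg₂ h5₂ harr₂ harc₂
        refine ⟨k - 1, by omega, i + 1, by omega, ?_, ?_, ?_, ?_, by rw [h5₂]; omega, harc₂⟩
        · exact (harr₂ 0 (by decide) (by decide) (by decide) (by decide)).trans
            ((harr₁ 0 (by decide) (by decide) (by decide) (by decide)).trans a0)
        · rw [hreg₂ 2 (by decide), hreg₁ 2 (by decide)]
          simpa using r2
        · rw [hreg₂ 3 (by decide), hreg₁ 3 (by decide)]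
          simp
        · rw [hreg₂ 4 (by decide), hreg₁ 4 (by decide)]
          simp
          omega
  · exact ⟨0, by omega, h0, h2, h3, h4, h5, harc.congr (by simp [R])⟩
  · exact Nat.mul_le_mul_right _ (by decide)
  · rintro s' hs' ⟨k, ⟨i, hi, a0, r2, r3, r4, r5, harc⟩, hcond⟩
    simp only [Expr.eval, r2, r3] at hcond
    obtain rfl : i = m := by omega
    refine harc.congr fun x y => or_congr Iff.rfl ?_
    constructor
    · rintro ⟨hx, hy, hxy⟩
      obtain ⟨j, hj, hjxy⟩ := hA.exists_edge _ _ hxy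
      refine ⟨j, hj, ?_⟩
      rcases Sym2.eq_iff.1 hjxy with h | h
      · left; omega
      · right; omega
    · rintro ⟨j, hj, ⟨rfl, rfl⟩ | ⟨rfl, rfl⟩⟩
      · exact ⟨by omega, by omega, hA.adj hj⟩
      · exact ⟨by omega, by omega, (hA.adj hj).symm⟩

end

end RAM

/-! ### Depth-first search -/

/-- The state of a depth-first search from the node 0 in the graph with arcs `1, …, K` from `src` to
`dst`: the first unexplored arc `head` of each node, the numbers `num` of the visited nodes other
than 0 (up to `cnt`) with inverse `ord`, the parent numbers `P` and the stack `st` of height `d`. -/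
structure IsSearchState (n K : ℕ) (src dst head num ord P st : ℕ → ℕ) (d cnt : ℕ) : Prop where
  head_le : ∀ x, head x ≤ K
  src_head : ∀ x, head x ≠ 0 → src (head x) = x
  num_zero : num 0 = 0
  num_le : ∀ x, num x ≤ cnt
  node_le : ∀ x, num x ≠ 0 → x ≤ n
  ord_num : ∀ x, num x ≠ 0 → ord (num x) = x
  num_ord : ∀ k, k ≠ 0 → k ≤ cnt → num (ord k) = k
  parent_lt : ∀ k, k ≠ 0 → P k < k
  parent_zero : P 0 = 0
  parent_arc : ∀ x, num x ≠ 0 → ∃ a, a ≠ 0 ∧ a ≤ K ∧ dst a = x ∧ num (src a) = P (num x) ∧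
    (src a = 0 ∨ num (src a) ≠ 0)
  stack_zero : st 0 = 0
  stack_visited : ∀ i, i ≠ 0 → i ≤ d → num (st i) ≠ 0
  stack_parent : ∀ i < d, P (num (st (i + 1))) = num (st i)
  visited : ∀ a, a ≠ 0 → a ≤ K → head (src a) < a → num (dst a) ≠ 0
  finished : ∀ x, num x ≠ 0 → (∃ i ≤ d, st i = x) ∨ ∀ a, a ≠ 0 → a ≤ K → src a = x →
    num (dst a) ≠ 0 ∧ (IsAncestor P (num x) (num (dst a)) ∨ IsAncestor P (num (dst a)) (num x))

/-- The number of unexplored arcs. -/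
def unexplored (K : ℕ) (src head : ℕ → ℕ) : ℕ :=
  ((Finset.Icc 1 K).filter fun a => a ≤ head (src a)).card

namespace IsSearchState

variable {n K d cnt : ℕ} {src dst next head head' num ord P st : ℕ → ℕ}

theorem parent_le (h : IsSearchState n K src dst head num ord P st d cnt) (k : ℕ) : P k ≤ k := by
  rcases eq_or_ne k 0 with rfl | hk
  · exact h.parent_zero.le
  · exact (h.parent_lt k hk).le

theorem ord_mem (h : IsSearchState n K src dst head num ord P st d cnt) {k : ℕ} (hk0 : k ≠ 0)
    (hk : k ≤ cnt) : ord k ≠ 0 ∧ ord k ≤ n := by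
  have h1 := h.num_ord k hk0 hk
  refine ⟨fun h0 => ?_, h.node_le _ (by omega)⟩
  rw [h0, h.num_zero] at h1
  exact hk0 h1.symm

theorem cnt_le (h : IsSearchState n K src dst head num ord P st d cnt) : cnt ≤ n := by
  have := Finset.card_le_card_of_injOn (s := Finset.Icc 1 cnt) (t := Finset.Icc 1 n) ord ?_ ?_
  · simpa using this
  · intro k hk
    simp only [Finset.coe_Icc, Set.mem_Icc] at hk ⊢
    have := h.ord_mem (k := k) (by omega) hk.2
    omega
  · intro k hk l hl hkl
    simp only [Finset.coe_Icc, Set.mem_Icc] at hk hl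
    rw [← h.num_ord k (by omega) hk.2, hkl, h.num_ord l (by omega) hl.2]

theorem stack_ancestor (h : IsSearchState n K src dst head num ord P st d cnt) {i : ℕ}
    (hi : i ≤ d) : IsAncestor P (num (st i)) (num (st d)) := by
  induction hi using Nat.decreasingInduction with
  | self => exact IsAncestor.refl _ _
  | of_succ k hk ih =>
    rw [← h.stack_parent k hk]
    exact (IsAncestor.parent P _).trans ih

/-- Advancing the head of `x` turns the arc `head x` into an explored one and no explored arc
becomes unexplored. This is the progress measure of the search. -/
theorem unexplored_pop (hb : IsBucket src head' next K)
    (h : IsSearchState n K src dst head num ord P st d cnt) {x : ℕ} (hx : head x ≠ 0) :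
    unexplored K src (Function.update head x (next (head x))) < unexplored K src head := by
  have hlt := hb.next_lt _ hx (h.head_le x)
  refine Finset.card_lt_card ((Finset.ssubset_iff_of_subset ?_).2 ⟨head x, ?_, ?_⟩)
  · intro a ha
    simp only [Finset.mem_filter] at ha ⊢
    refine ⟨ha.1, ?_⟩
    by_cases hax : src a = x
    · have := ha.2
      rw [hax, Function.update_self] at this
      rw [hax]
      omega
    · simpa [hax] using ha.2
  · have := h.head_le x
    simp only [Finset.mem_filter, Finset.mem_Icc, h.src_head x hx]
    omega
  · simp only [Finset.mem_filter, h.src_head x hx, Function.update_self]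
    omega

/-- The first unexplored arc leads to a visited node. -/
theorem pop (hb : IsBucket src head' next K)
    (h : IsSearchState n K src dst head num ord P st d cnt) {x : ℕ} (hx : head x ≠ 0)
    (hv : num (dst (head x)) ≠ 0) :
    IsSearchState n K src dst (Function.update head x (next (head x))) num ord P st d cnt where
  head_le y := by
    by_cases hy : y = x
    · have := hb.next_lt _ hx (h.head_le x)
      have := h.head_le x
      rw [hy, Function.update_self]
      omega
    · rw [Function.update_of_ne hy]
      exact h.head_le y
  src_head y := by
    by_cases hy : y = x
    · rw [hy, Function.update_self]
      intro h0
      rw [hb.key_next _ hx (h.head_le x) h0, h.src_head x hx]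
    · rw [Function.update_of_ne hy]
      exact h.src_head y
  num_zero := h.num_zero
  num_le := h.num_le
  node_le := h.node_le
  ord_num := h.ord_num
  num_ord := h.num_ord
  parent_lt := h.parent_lt
  parent_zero := h.parent_zero
  parent_arc := h.parent_arc
  stack_zero := h.stack_zero
  stack_visited := h.stack_visited
  stack_parent := h.stack_parent
  visited a ha0 ha hlt := by
    by_cases hax : src a = x
    · rw [hax, Function.update_self] at hlt
      -- No arc of `x` lies strictly between the old head and its successor, so the popped arc is
      -- the only one that becomes explored.
      rcases lt_trichotomy a (head x) with hlt' | rfl | hlt'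
      · have := hb.le_next _ a hx (h.head_le x) ha0 hlt' (by rw [hax, h.src_head x hx])
        omega
      · exact hv
      · exact h.visited a ha0 ha (by rwa [hax])
    · rw [Function.update_of_ne hax] at hlt
      exact h.visited a ha0 ha hlt
  finished := h.finished

/-- A new node is visited. -/
theorem discover (h : IsSearchState n K src dst head num ord P st d cnt) {a : ℕ}
    (ha0 : a ≠ 0) (ha : a ≤ K) (hsrc : src a = st d) (hnew : num (dst a) = 0) (hd0 : dst a ≠ 0)
    (hdn : dst a ≤ n) :
    IsSearchState n K src dst head (Function.update num (dst a) (cnt + 1))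
      (Function.update ord (cnt + 1) (dst a)) (Function.update P (cnt + 1) (num (st d)))
      (Function.update st (d + 1) (dst a)) (d + 1) (cnt + 1) := by
  set u := dst a with hu
  have hnum : ∀ x, num x ≠ 0 → Function.update num u (cnt + 1) x = num x := fun x hx =>
    Function.update_of_ne (by rintro rfl; exact hx hnew) _ _
  have hP : ∀ k ≤ cnt, Function.update P (cnt + 1) (num (st d)) k = P k := fun k hk =>
    Function.update_of_ne (by omega) _ _
  have hst : ∀ i ≤ d, Function.update st (d + 1) u i = st i := fun i hi =>
    Function.update_of_ne (by omega) _ _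
  have hstn : ∀ i ≤ d, Function.update num u (cnt + 1) (st i) = num (st i) := by
    intro i hi
    refine Function.update_of_ne ?_ _ _
    rcases eq_or_ne i 0 with rfl | hi0
    · rw [h.stack_zero]
      exact hd0.symm
    · intro heq
      exact h.stack_visited i hi0 hi (heq ▸ hnew)
  have hanc : ∀ x y, num x ≠ 0 → num y ≠ 0 → IsAncestor P (num x) (num y) →
      IsAncestor (Function.update P (cnt + 1) (num (st d)))
        (Function.update num u (cnt + 1) x) (Function.update num u (cnt + 1) y) := by
    intro x y hx hy hxy
    rw [hnum x hx, hnum y hy]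
    exact hxy.congr (m := cnt) (fun k _ => h.parent_le k) hP (h.num_le y)
  constructor
  · exact h.head_le
  · exact h.src_head
  · rw [Function.update_of_ne hd0.symm]
    exact h.num_zero
  · intro x
    by_cases hx : x = u
    · rw [hx, Function.update_self]
    · rw [Function.update_of_ne hx]
      exact (h.num_le x).trans (by omega)
  · intro x
    by_cases hx : x = u
    · rw [hx]
      exact fun _ => hdn
    · rw [Function.update_of_ne hx]
      exact h.node_le x
  · intro x
    by_cases hx : x = u
    · rw [hx, Function.update_self, Function.update_self]
      exact fun _ => rfl
    · have := h.num_le x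
      rw [Function.update_of_ne hx, Function.update_of_ne (by omega)]
      exact h.ord_num x
  · intro k hk0 hk
    rcases hk.eq_or_lt with rfl | hk
    · rw [Function.update_self, Function.update_self]
    · have h1 := h.num_ord k hk0 (by omega)
      rw [Function.update_of_ne (show k ≠ cnt + 1 by omega), hnum _ (by omega)]
      exact h1
  · intro k hk0
    by_cases hk : k = cnt + 1
    · have := h.num_le (st d)
      rw [hk, Function.update_self]
      omega
    · rw [Function.update_of_ne hk]
      exact h.parent_lt k hk0
  · rw [Function.update_of_ne (by omega)]
    exact h.parent_zero
  · intro x hx0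
    by_cases hx : x = u
    · refine ⟨a, ha0, ha, hx.symm, ?_, ?_⟩
      · rw [hx, Function.update_self, Function.update_self, hsrc, hstn d le_rfl]
      · rw [hsrc, hstn d le_rfl]
        rcases eq_or_ne d 0 with rfl | hd
        · exact Or.inl h.stack_zero
        · exact Or.inr (h.stack_visited d hd le_rfl)
    · rw [Function.update_of_ne hx] at hx0
      obtain ⟨b, hb0, hb, rfl, hbx, hbs⟩ := h.parent_arc x hx0
      have hbu : src b ≠ u := by
        intro hbu
        rw [hbu] at hbs
        exact hbs.elim hd0 fun h => h hnew
      refine ⟨b, hb0, hb, rfl, ?_, ?_⟩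
      · rw [hnum _ hx0, hP _ (h.num_le _), ← hbx, Function.update_of_ne hbu]
      · rwa [Function.update_of_ne hbu]
  · rw [Function.update_of_ne (by omega)]
    exact h.stack_zero
  · intro i hi0 hi
    rcases hi.eq_or_lt with rfl | hi
    · rw [Function.update_self, Function.update_self]
      omega
    · rw [hst i (by omega), hstn i (by omega)]
      exact h.stack_visited i hi0 (by omega)
  · intro i hi
    rw [hst i (by omega), hstn i (by omega)]
    rcases (Nat.lt_succ_iff.1 hi).eq_or_lt with rfl | hi
    · rw [Function.update_self, Function.update_self, Function.update_self]
    · rw [hst (i + 1) (by omega), hstn (i + 1) (by omega), hP _ (h.num_le _)]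
      exact h.stack_parent i hi
  · intro b hb0 hb hlt
    have := h.visited b hb0 hb hlt
    rwa [hnum _ this]
  · intro x hx0
    by_cases hx : x = u
    · exact Or.inl ⟨d + 1, le_rfl, by rw [Function.update_self, hx]⟩
    · rw [Function.update_of_ne hx] at hx0
      rcases h.finished x hx0 with ⟨i, hi, rfl⟩ | hfin
      · exact Or.inl ⟨i, by omega, hst i hi⟩
      · refine Or.inr fun b hb0 hb hbx => ?_
        obtain ⟨h1, h2⟩ := hfin b hb0 hb hbx
        refine ⟨by rwa [hnum _ h1], h2.imp (hanc _ _ hx0 h1) (hanc _ _ h1 hx0)⟩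

/-- The node on top of the stack is finished. -/
theorem finish (h : IsSearchState n K src dst head num ord P st d cnt) (hd : d ≠ 0)
    (hhead : head (st d) = 0)
    (hsymm : ∀ a, a ≠ 0 → a ≤ K → src a ≠ 0 →
      ∃ b, b ≠ 0 ∧ b ≤ K ∧ src b = dst a ∧ dst b = src a) :
    IsSearchState n K src dst head num ord P st (d - 1) cnt :=
  { h with
    stack_visited := fun i hi0 hi => h.stack_visited i hi0 (by omega)
    stack_parent := fun i hi => h.stack_parent i (by omega)
    finished := by
      intro x hx0
      rcases h.finished x hx0 with ⟨i, hi, rfl⟩ | hfin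
      · rcases hi.eq_or_lt with rfl | hi
        · refine Or.inr fun a ha0 ha hax => ?_
          have hv := h.visited a ha0 ha (by rw [hax, hhead]; omega)
          refine ⟨hv, ?_⟩
          -- A target on the stack is an ancestor of the node that is being finished. A target that
          -- is already finished has had its own arcs explored, among them the reverse arc, so the
          -- two nodes were found comparable then.
          rcases h.finished _ hv with ⟨j, hj, hja⟩ | hfin
          · rw [← hja]
            exact Or.inr (h.stack_ancestor hj)
          · have hs0 : src a ≠ 0 := by
              rw [hax]
              intro h0
              rw [h0, h.num_zero] at hx0
              exact hx0 rfl
            obtain ⟨b, hb0, hb, hbs, hbd⟩ := hsymm a ha0 ha hs0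
            have := (hfin b hb0 hb hbs).2
            rw [hbd, hax] at this
            exact this.symm
        · exact Or.inl ⟨i, by omega, rfl⟩
      · exact Or.inr hfin }

end IsSearchState

/-- A numbering of the nodes `1, …, n` along a depth-first search, with parent numbers `P` (zero for
the roots). -/
structure IsSearchNumbering (I : SefeInstance ℕ) (n : ℕ) (num ord P : ℕ → ℕ) : Prop where
  num_ne_zero : ∀ x, x ≠ 0 → x ≤ n → num x ≠ 0
  num_le : ∀ x, num x ≤ n
  ord_num : ∀ x, num x ≠ 0 → ord (num x) = x
  num_ord : ∀ k, k ≠ 0 → k ≤ n → num (ord k) = k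
  ord_mem : ∀ k, k ≠ 0 → k ≤ n → ord k ≠ 0 ∧ ord k ≤ n
  parent_lt : ∀ k, k ≠ 0 → P k < k
  parent_zero : P 0 = 0
  tree_adj : ∀ x, num x ≠ 0 → P (num x) ≠ 0 →
    ∃ y, y ≠ 0 ∧ num y = P (num x) ∧ I.union.Adj (y - 1) (x - 1)
  comparable : ∀ u v, I.union.Adj u v →
    IsAncestor P (num (u + 1)) (num (v + 1)) ∨ IsAncestor P (num (v + 1)) (num (u + 1))

/-- All arcs of the node 0 are explored, so every node has been visited. Counting in both directions
gives `cnt = n`, and with only node 0 on the stack every other node is finished. -/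
theorem IsSearchState.isSearchNumbering {I : SefeInstance ℕ} {n m : ℕ} {A : ℕ → ℕ}
    (hA : IsInput I n m A) {K cnt : ℕ} {src dst head num ord P st head' next : ℕ → ℕ}
    (harc : IsArcList src dst head' next K (SearchArc I n))
    (h : IsSearchState n K src dst head num ord P st 0 cnt) (h0 : head 0 = 0) :
    IsSearchNumbering I n num ord P := by
  have hnum : ∀ x, x ≠ 0 → x ≤ n → num x ≠ 0 := by
    intro x hx0 hx
    obtain ⟨a, ha0, ha, hs, rfl⟩ := harc.complete 0 x (Or.inl ⟨rfl, hx0, hx⟩)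
    exact h.visited a ha0 ha (by rw [hs, h0]; omega)
  have hcnt : cnt = n := by
    refine le_antisymm h.cnt_le ?_
    have := Finset.card_le_card_of_injOn (s := Finset.Icc 1 n) (t := Finset.Icc 1 cnt) num ?_ ?_
    · simpa using this
    · intro k hk
      simp only [Finset.coe_Icc, Set.mem_Icc] at hk ⊢
      have := hnum k (by omega) hk.2
      have := h.num_le k
      omega
    · intro k hk l hl hkl
      simp only [Finset.coe_Icc, Set.mem_Icc] at hk hl
      rw [← h.ord_num k (hnum k (by omega) hk.2), hkl, h.ord_num l (hnum l (by omega) hl.2)]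
  subst hcnt
  refine ⟨hnum, h.num_le, h.ord_num, h.num_ord, fun k => h.ord_mem, h.parent_lt,
    h.parent_zero, ?_, ?_⟩
  · intro x hx hP
    obtain ⟨a, ha0, ha, rfl, hap, -⟩ := h.parent_arc x hx
    rw [← hap] at hP ⊢
    have hs0 : src a ≠ 0 := by
      intro h0
      rw [h0, h.num_zero] at hP
      exact hP rfl
    rcases harc.sound a ha0 ha with hR | hR
    · exact absurd hR.1 hs0
    · exact ⟨src a, hs0, rfl, hR.2.2⟩
  · intro u v huv
    have hu := hA.lt_of_mem huv.fst_mem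
    obtain ⟨a, ha0, ha, hs, hd⟩ := harc.complete (u + 1) (v + 1)
      (Or.inr ⟨by omega, by omega, by simpa using huv⟩)
    have hu0 := hnum (u + 1) (by omega) (by omega)
    rcases h.finished _ hu0 with ⟨i, hi, hiu⟩ | hfin
    · obtain rfl : i = 0 := by omega
      rw [h.stack_zero] at hiu
      omega
    · have := (hfin a ha0 ha hs).2
      rwa [hd] at this

theorem SearchArc.symm {I : SefeInstance ℕ} {n x y : ℕ} (h : SearchArc I n x y) (hx : x ≠ 0) :
    SearchArc I n y x := by
  rcases h with h | h
  · exact absurd h.1 hx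
  · exact Or.inr ⟨h.2.1, h.1, h.2.2.symm⟩

namespace RAM

open RAM.Expr RAM.Program

/-- Follows one arc or backs up. The arrays 7 and 8 hold the numbers of the nodes and the inverse, 9 the
parent numbers and 10 the stack, whose height is in register 8; register 9 counts the visited
nodes. -/
def searchStep : Program :=
  .seq (.assign 10 (.load 10 (.reg 8))) <|
  .seq (.assign 11 (.load 6 (.reg 10))) <|
  .ite (.reg 11)
    (.seq (.store 6 (.reg 10) (.load 5 (.reg 11))) <|
      .seq (.assign 12 (.load 4 (.reg 11))) <|
      .ite (.load 7 (.reg 12)) .skip <|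
        .seq (.assign 9 (.add (.reg 9) (.const 1))) <|
        .seq (.store 7 (.reg 12) (.reg 9)) <|
        .seq (.store 8 (.reg 9) (.reg 12)) <|
        .seq (.store 9 (.reg 9) (.load 7 (.reg 10))) <|
        .seq (.assign 8 (.add (.reg 8) (.const 1))) <|
        .store 10 (.reg 8) (.reg 12))
    (.assign 8 (.sub (.reg 8) (.const 1)))

/-- The depth-first search. -/
def search : Program :=
  .loop (.add (.reg 8) (.load 6 (.load 10 (.reg 8)))) searchStep

theorem search_runs {I : SefeInstance ℕ} {n m : ℕ} {A : ℕ → ℕ} {W M : ℕ} (hA : IsInput I n m A)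
    (hM : 10 * (n + m + 1) ≤ M) (hW : 1000 * M ≤ W) {s : State} (hs : s.Bdd M)
    (h8 : s.reg 8 = 0) (h9 : s.reg 9 = 0) (ha7 : ∀ x, s.arr 7 x = 0) (ha9 : ∀ x, s.arr 9 x = 0)
    (ha10 : ∀ x, s.arr 10 x = 0)
    (harc : IsArcList (s.arr 3) (s.arr 4) (s.arr 6) (s.arr 5) (n + 2 * m) (SearchArc I n)) :
    Runs W M search s (1000 * (2 * n + 4 * m + 1)) (fun s' =>
      IsSearchNumbering I n (s'.arr 7) (s'.arr 8) (s'.arr 9)) := by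
  set K := n + 2 * m with hK
  set src := s.arr 3
  set dst := s.arr 4
  set next := s.arr 5
  have hdst : ∀ a, a ≠ 0 → a ≤ K → dst a ≠ 0 ∧ dst a ≤ n := by
    intro a ha0 ha
    rcases harc.sound a ha0 ha with h | h
    · exact h.2
    · have := hA.lt_of_mem h.2.2.snd_mem
      exact ⟨h.2.1, by omega⟩
  have hsymm : ∀ a, a ≠ 0 → a ≤ K → src a ≠ 0 →
      ∃ b, b ≠ 0 ∧ b ≤ K ∧ src b = dst a ∧ dst b = src a := fun a ha0 ha hs0 =>
    harc.complete _ _ (SearchArc.symm (harc.sound a ha0 ha) hs0)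
  -- The potential is twice the number of unexplored arcs plus the stack height. Following an arc
  -- lowers it by 2 and pushes at most one node; backing up lowers it by 1. Its bound `2 * K` also
  -- bounds the stack height.
  let Inv : ℕ → State → Prop := fun k s => s.arr 4 = dst ∧ s.arr 5 = next ∧
    2 * unexplored K src (s.arr 6) + s.reg 8 = k ∧ k ≤ 2 * K ∧
    IsSearchState n K src dst (s.arr 6) (s.arr 7) (s.arr 8) (s.arr 9) (s.arr 10) (s.reg 8) (s.reg 9)
  have hk : 2 * unexplored K src (s.arr 6) + s.reg 8 ≤ 2 * K := by
    have : unexplored K src (s.arr 6) ≤ K := by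
      simpa [unexplored] using Finset.card_filter_le (Finset.Icc 1 K) fun a => a ≤ s.arr 6 (src a)
    omega
  refine (Runs.loop_wp (Inv := Inv) (k := 2 * unexplored K src (s.arr 6) + s.reg 8)
    ?_ ?_ ?_ hs ?_).mono ?_ ?_
  · exact (Nat.mul_le_mul_right M (by decide)).trans hW
  · exact le_trans (by decide) (show 10 ≤ M by omega)
  · clear hk
    rintro k s hs ⟨a4, a5, hk, hkK, h⟩ hcond
    simp only [Expr.eval] at hcond
    simp only [searchStep, Program.wp, Expr.Bounded, Expr.eval, true_and, Function.update_self,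
      ne_eq, Nat.reduceEqDiff, not_false_eq_true, Function.update_of_ne, a4, a5]
    set x := s.arr 10 (s.reg 8) with hx
    set a := s.arr 6 x with ha
    constructor
    · intro ha0
      have hun := h.unexplored_pop harc.bucket (x := x) ha0
      have haK := h.head_le x
      obtain ⟨hd0, hdn⟩ := hdst a ha0 haK
      rw [← ha] at hun
      constructor
      · intro hv
        refine ⟨_, ?_, a4, a5, rfl, ?_, ?_⟩
        · simp only [Function.update_self, ne_eq, Nat.reduceEqDiff, not_false_eq_true,
            Function.update_of_ne]
          omega
        · simp only [Function.update_self, ne_eq, Nat.reduceEqDiff, not_false_eq_true,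
            Function.update_of_ne]
          omega
        · simpa using h.pop harc.bucket ha0 hv
      · intro hv
        -- The program pops the arc before it numbers the target. The two updates touch different
        -- arrays, so the proof may discover the target first, as `pop` requires a visited target.
        have h' := h.discover ha0 haK (h.src_head x ha0) hv hd0 hdn
        have hcnt := h'.cnt_le
        refine ⟨by omega, by omega, _, ?_, a4, a5, rfl, ?_, ?_⟩
        · simp only [Function.update_self, ne_eq, Nat.reduceEqDiff, not_false_eq_true,
            Function.update_of_ne]
          omega
        · simp only [Function.update_self, ne_eq, Nat.reduceEqDiff, not_false_eq_true,
            Function.update_of_ne]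
          omega
        -- The parent number is read after the target has been numbered; as the target differs from
        -- the node on top, the entry read is still the old one.
        · have hxd : x ≠ dst a := by
            intro hxd
            rcases eq_or_ne (s.reg 8) 0 with h0 | h0
            · rw [hx, h0, h.stack_zero] at hxd
              exact hd0 hxd.symm
            · exact h.stack_visited _ h0 le_rfl (by rw [← hx, hxd]; exact hv)
          have h'' := h'.pop harc.bucket (x := x) ha0
            (by rw [← ha, Function.update_self]; omega)
          simpa [hxd, ← ha, ← hx] using h''
    · intro ha0
      have hd : s.reg 8 ≠ 0 := by omega
      refine ⟨_, ?_, a4, a5, rfl, ?_, ?_⟩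
      · simp only [Function.update_self]
        omega
      · simp only [Function.update_self]
        omega
      · simpa using h.finish hd ha0 hsymm
  · refine ⟨rfl, rfl, rfl, hk, harc.bucket.head_le, harc.bucket.key_head, ha7 0, ?_, ?_, ?_, ?_,
      ?_, ha9 0, ?_, ha10 0, ?_, ?_, ?_, ?_⟩
    · simp [ha7]
    · simp [ha7]
    · simp [ha7]
    · intro k hk0 hk
      omega
    · intro k hk0
      rw [ha9]
      omega
    · simp [ha7]
    · intro i hi0 hi
      omega
    · intro i hi
      omega
    · intro a ha0 ha hlt
      have := harc.bucket.le_head a ha0 ha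
      omega
    · simp [ha7]
  · exact Nat.mul_le_mul (by decide) (by omega)
  · rintro s' hs' ⟨k, ⟨-, -, -, -, h⟩, hcond⟩
    simp only [Expr.eval] at hcond
    obtain ⟨hd, hh⟩ := Nat.add_eq_zero_iff.1 hcond
    rw [hd] at h hh
    rw [h.stack_zero] at hh
    exact h.isSearchNumbering hA harc hh

end RAM

namespace RAM

open RAM.Expr RAM.Program

/-! ### Lowpoints -/

/-- Replaces the entry of the array 11 at the address in the register `t` by the minimum with the
register `f`. -/
def relax (f t : ℕ) : Program :=
  .ite (.sub (.load 11 (.reg t)) (.reg f)) (.store 11 (.reg t) (.reg f)) .skip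

theorem relax_wp {M f t : ℕ} {s : State} {Q : State → Prop}
    (hQ : Q ⟨s.reg, Function.update s.arr 11 (Function.update (s.arr 11) (s.reg t)
      (min (s.arr 11 (s.reg t)) (s.reg f)))⟩) : (relax f t).wp M Q s := by
  simp only [relax, Program.wp, Expr.Bounded, Expr.eval, true_and]
  constructor
  · intro h
    rwa [min_eq_right (by omega)] at hQ
  · intro h
    rw [min_eq_left (by omega), Function.update_eq_self, Function.update_eq_self] at hQ
    exact hQ

/-- Loads the numbers of the end vertices of the next edge into the registers 6 and 7. -/
def loadEdge : Program :=
  .seq (.assign 3 (.add (.reg 3) (.const 1))) <|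
  .seq (.assign 6 (.load 7 (.add (.load 0 (.reg 4)) (.const 1)))) <|
  .seq (.assign 7 (.load 7 (.add (.load 0 (.add (.reg 4) (.const 1))) (.const 1)))) <|
  .assign 4 (.add (.reg 4) (.const 3))

theorem loadEdge_wp {M i p : ℕ} {s : State} {Q : State → Prop} (h3 : s.reg 3 = i)
    (h4 : s.reg 4 = p) (hi : i + 1 ≤ M) (hp : p + 3 ≤ M)
    (hQ : ∀ reg : ℕ → ℕ, (∀ x, x ≠ 3 → x ≠ 4 → x ≠ 6 → x ≠ 7 → reg x = s.reg x) →
      reg 3 = i + 1 → reg 4 = p + 3 → reg 6 = s.arr 7 (s.arr 0 p + 1) →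
      reg 7 = s.arr 7 (s.arr 0 (p + 1) + 1) → Q ⟨reg, s.arr⟩) : loadEdge.wp M Q s := by
  subst h3 h4
  simp only [loadEdge, Program.wp, Expr.Bounded, Expr.eval, true_and]
  refine ⟨hi, by simpa using hp, hQ _ ?_ ?_ ?_ ?_ ?_⟩
  · intro x h3 h4 h6 h7
    simp [h3, h4, h6, h7]
  all_goals simp

/-- Computes the lowpoints with respect to the edges at each vertex (array 11) and marks the vertices
that have an edge (array 12). -/
def edgeLows : Program :=
  .loop (.sub (.reg 2) (.reg 3)) <|
    .seq loadEdge <|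
    .seq (.store 12 (.reg 6) (.const 1)) <|
    .seq (.store 12 (.reg 7) (.const 1)) <|
    .ite (.sub (.reg 7) (.reg 6)) (relax 6 7) (relax 7 6)

/-- Propagates the lowpoints from the vertices to their parents. -/
def treeLows : Program :=
  .loop (.reg 3) <|
    .seq (.assign 6 (.load 9 (.reg 3))) <|
    .seq (.assign 7 (.load 11 (.reg 3))) <|
    .seq (relax 7 6) (.assign 3 (.sub (.reg 3) (.const 1)))

section

variable {I : SefeInstance ℕ} {n m : ℕ} {A num ord P : ℕ → ℕ} {W M : ℕ}

/-- The lowpoint of `k` is `k` itself or the number of an earlier neighbour of a descendant. -/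
def LowAttained (I : SefeInstance ℕ) (num P low : ℕ → ℕ) (k : ℕ) : Prop :=
  ∃ z, IsAncestor P k z ∧ (low k = z ∨ ∃ x y, I.union.Adj x y ∧ num (x + 1) < num (y + 1) ∧
    num (x + 1) = low k ∧ num (y + 1) = z)

theorem IsInput.num_ne (hA : IsInput I n m A) (hS : IsSearchNumbering I n num ord P) {u v : ℕ}
    (huv : I.union.Adj u v) : num (u + 1) ≠ num (v + 1) := by
  intro h
  have hu := hA.lt_of_mem huv.fst_mem
  have hv := hA.lt_of_mem huv.snd_mem
  have h1 := hS.ord_num _ (hS.num_ne_zero (u + 1) (by omega) (by omega))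
  have h2 := hS.ord_num _ (hS.num_ne_zero (v + 1) (by omega) (by omega))
  rw [h] at h1
  exact huv.ne (by omega)

/-- The tree edge to the parent is not left out, so a non-root `k` always gets a lowpoint of at most
`P k`, and the test `P k ≤ low k` amounts to equality. The marks serve to tell isolated vertices
from other roots. -/
theorem edgeLows_runs (hA : IsInput I n m A) (hS : IsSearchNumbering I n num ord P)
    (hM : 10 * (n + m + 1) ≤ M) (hW : 1000 * M ≤ W) {s : State} (hs : s.Bdd M) (h0 : s.arr 0 = A)
    (h7 : s.arr 7 = num) (h2 : s.reg 2 = m) (h3 : s.reg 3 = 0) (h4 : s.reg 4 = 2 + 2 * n)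
    (h11 : ∀ q, q ≠ 0 → q ≤ n → s.arr 11 q = q) (h12 : ∀ x, s.arr 12 x = 0) :
    Runs W M edgeLows s (1000 * (m + 1)) (fun s' =>
      (∀ x y, I.union.Adj x y → num (x + 1) < num (y + 1) →
        s'.arr 11 (num (y + 1)) ≤ num (x + 1)) ∧
      (∀ k, k ≠ 0 → k ≤ n → LowAttained I num P (s'.arr 11) k) ∧
      (∀ k, s'.arr 12 k ≠ 0 ↔ ∃ x y, I.union.Adj x y ∧ num (x + 1) = k)) := by
  let Inv : ℕ → State → Prop := fun k s => ∃ i, i + k = m ∧ s.arr 0 = A ∧ s.arr 7 = num ∧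
    s.reg 2 = m ∧ s.reg 3 = i ∧ s.reg 4 = 2 + 2 * n + 3 * i ∧
    (∀ j < i, ∀ x y, s(A (2 + 2 * n + 3 * j), A (2 + 2 * n + 3 * j + 1)) = s(x, y) →
      (num (x + 1) < num (y + 1) → s.arr 11 (num (y + 1)) ≤ num (x + 1)) ∧
      s.arr 12 (num (x + 1)) ≠ 0) ∧
    (∀ k, k ≠ 0 → k ≤ n → LowAttained I num P (s.arr 11) k) ∧
    (∀ k, s.arr 12 k ≠ 0 → ∃ x y, I.union.Adj x y ∧ num (x + 1) = k)
  refine (Runs.loop_wp (Inv := Inv) (k := m) ?_ ?_ ?_ hs ?_).mono ?_ ?_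
  · exact (Nat.mul_le_mul_right M (by decide)).trans hW
  · exact le_trans (by decide) (show 10 ≤ M by omega)
  · rintro k s hs ⟨i, hi, a0, a7, r2, r3, r4, hlow, hatt, hhas⟩ hcond
    simp only [Expr.eval, r2, r3] at hcond
    have him : i < m := by omega
    have hadj := hA.adj him
    refine loadEdge_wp r3 r4 (by omega) (by omega) fun reg hreg hr3 hr4 hr6 hr7 => ?_
    rw [a0, a7] at hr6 hr7
    set u := A (2 + 2 * n + 3 * i) with hu
    set v := A (2 + 2 * n + 3 * i + 1) with hv
    -- the effect of processing the edge with end vertices `x`, `y` in the order of their numbers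
    have key : ∀ x y, s(u, v) = s(x, y) → num (x + 1) < num (y + 1) → ∀ low has : ℕ → ℕ,
        low = Function.update (s.arr 11) (num (y + 1))
          (min (s.arr 11 (num (y + 1))) (num (x + 1))) →
        (∀ k, has k ≠ 0 ↔ s.arr 12 k ≠ 0 ∨ k = num (u + 1) ∨ k = num (v + 1)) →
        (∀ j < i + 1, ∀ x y, s(A (2 + 2 * n + 3 * j), A (2 + 2 * n + 3 * j + 1)) = s(x, y) →
          (num (x + 1) < num (y + 1) → low (num (y + 1)) ≤ num (x + 1)) ∧
          has (num (x + 1)) ≠ 0) ∧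
        (∀ k, k ≠ 0 → k ≤ n → LowAttained I num P low k) ∧
        (∀ k, has k ≠ 0 → ∃ x y, I.union.Adj x y ∧ num (x + 1) = k) := by
      intro x y hxy hlt low has hlow' hhas'
      have hxyadj : I.union.Adj x y := by
        rw [← SimpleGraph.Subgraph.mem_edgeSet, ← hxy]
        exact hadj
      have hle : ∀ k, low k ≤ s.arr 11 k := by
        intro k
        rw [hlow']
        by_cases hk : k = num (y + 1)
        · rw [hk, Function.update_self]
          exact min_le_left _ _
        · rw [Function.update_of_ne hk]
      refine ⟨fun j hj x' y' hxy' => ?_, fun k hk0 hk => ?_, fun k hk => ?_⟩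
      · rcases Nat.lt_succ_iff_lt_or_eq.1 hj with hj | rfl
        · obtain ⟨h1, h2⟩ := hlow j hj x' y' hxy'
          exact ⟨fun h => (hle _).trans (h1 h), (hhas' _).2 (Or.inl h2)⟩
        · rw [← hu, ← hv] at hxy'
          constructor
          · intro h
            rcases Sym2.eq_iff.1 (hxy.symm.trans hxy') with ⟨rfl, rfl⟩ | ⟨rfl, rfl⟩
            · rw [hlow', Function.update_self]
              exact min_le_right _ _
            · omega
          · rw [hhas']
            rcases Sym2.eq_iff.1 hxy' with ⟨h, -⟩ | ⟨-, h⟩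
            · exact Or.inr (Or.inl (by rw [h]))
            · exact Or.inr (Or.inr (by rw [h]))
      · obtain ⟨z, hz, hatt'⟩ := hatt k hk0 hk
        by_cases hky : k = num (y + 1)
        · rcases le_or_gt (s.arr 11 (num (y + 1))) (num (x + 1)) with h | h
          · refine ⟨z, hz, ?_⟩
            rwa [hlow', min_eq_left h, Function.update_eq_self]
          · refine ⟨k, IsAncestor.refl _ _, Or.inr ⟨x, y, hxyadj, hlt, ?_, hky.symm⟩⟩
            rw [hlow', min_eq_right h.le, hky, Function.update_self]
        · refine ⟨z, hz, ?_⟩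
          rwa [hlow', Function.update_of_ne hky]
      · rcases (hhas' k).1 hk with h | rfl | rfl
        · exact hhas k h
        · exact ⟨u, v, hadj, rfl⟩
        · exact ⟨v, u, hadj.symm, rfl⟩
    have hhas' : ∀ k, Function.update (Function.update (s.arr 12) (num (u + 1)) 1)
        (num (v + 1)) 1 k ≠ 0 ↔ s.arr 12 k ≠ 0 ∨ k = num (u + 1) ∨ k = num (v + 1) := by
      intro k
      simp only [Function.update_apply]
      split_ifs <;> simp_all
    simp only [Program.wp, Expr.Bounded, Expr.eval, true_and, hr6, hr7]
    constructor
    · intro hlt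
      obtain ⟨k1, k2, k3⟩ := key u v rfl (by omega) _ _ rfl hhas'
      refine relax_wp ⟨k - 1, by omega, i + 1, by omega, ?_, ?_, ?_, hr3, ?_, ?_, ?_, ?_⟩
      · simpa using a0
      · simpa using a7
      · exact (hreg 2 (by decide) (by decide) (by decide) (by decide)).trans r2
      · simp only [hr4]; omega
      · simpa [hr6, hr7] using k1
      · simpa [hr6, hr7] using k2
      · simpa [hr6, hr7] using k3
    · intro hge
      have := IsInput.num_ne hA hS hadj
      obtain ⟨k1, k2, k3⟩ := key v u Sym2.eq_swap (by omega) _ _ rfl hhas'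
      refine relax_wp ⟨k - 1, by omega, i + 1, by omega, ?_, ?_, ?_, hr3, ?_, ?_, ?_, ?_⟩
      · simpa using a0
      · simpa using a7
      · exact (hreg 2 (by decide) (by decide) (by decide) (by decide)).trans r2
      · simp only [hr4]; omega
      · simpa [hr6, hr7] using k1
      · simpa [hr6, hr7] using k2
      · simpa [hr6, hr7] using k3
  · exact ⟨0, by omega, h0, h7, h2, h3, h4, by simp,
      fun k hk0 hk => ⟨k, IsAncestor.refl _ _, Or.inl (h11 k hk0 hk)⟩, by simp [h12]⟩
  · exact Nat.mul_le_mul_right _ (by decide)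
  · rintro s' hs' ⟨k, ⟨i, hi, a0, a7, r2, r3, r4, hlow, hatt, hhas⟩, hcond⟩
    simp only [Expr.eval, r2, r3] at hcond
    obtain rfl : i = m := by omega
    refine ⟨fun x y hxy => ?_, hatt, fun k => ⟨hhas k, ?_⟩⟩
    · obtain ⟨j, hj, hjxy⟩ := hA.exists_edge x y hxy
      exact (hlow j hj x y hjxy).1
    · rintro ⟨x, y, hxy, rfl⟩
      obtain ⟨j, hj, hjxy⟩ := hA.exists_edge x y hxy
      exact (hlow j hj x y hjxy).2

/-- Numbers are processed downwards. Children have larger numbers than their parents, so the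
lowpoint of `k` is final when it is passed on to `P k`. -/
theorem treeLows_runs (hS : IsSearchNumbering I n num ord P)
    (hM : 10 * (n + m + 1) ≤ M) (hW : 1000 * M ≤ W) {s : State} (hs : s.Bdd M) (h9 : s.arr 9 = P)
    (h3 : s.reg 3 = n)
    (hlow : ∀ x y, I.union.Adj x y → num (x + 1) < num (y + 1) →
      s.arr 11 (num (y + 1)) ≤ num (x + 1))
    (hatt : ∀ k, k ≠ 0 → k ≤ n → LowAttained I num P (s.arr 11) k) :
    Runs W M treeLows s (1000 * (n + 1)) (fun s' => s'.reg 3 = 0 ∧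
      (∀ x y, I.union.Adj x y → num (x + 1) < num (y + 1) →
        s'.arr 11 (num (y + 1)) ≤ num (x + 1)) ∧
      (∀ k, k ≠ 0 → k ≤ n → LowAttained I num P (s'.arr 11) k) ∧
      (∀ k, k ≠ 0 → k ≤ n → s'.arr 11 (P k) ≤ s'.arr 11 k)) := by
  let Inv : ℕ → State → Prop := fun k s => s.arr 9 = P ∧ s.reg 3 = k ∧ k ≤ n ∧
    (∀ x y, I.union.Adj x y → num (x + 1) < num (y + 1) →
      s.arr 11 (num (y + 1)) ≤ num (x + 1)) ∧
    (∀ k, k ≠ 0 → k ≤ n → LowAttained I num P (s.arr 11) k) ∧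
    (∀ c, k < c → c ≤ n → s.arr 11 (P c) ≤ s.arr 11 c)
  refine (Runs.loop_wp (Inv := Inv) (k := n) ?_ ?_ ?_ hs ?_).mono ?_ ?_
  · exact (Nat.mul_le_mul_right M (by decide)).trans hW
  · exact le_trans (by decide) (show 10 ≤ M by omega)
  · rintro k s hs ⟨a9, r3, hkn, hlow, hatt, hpar⟩ hcond
    simp only [Expr.eval, r3] at hcond
    simp only [Program.wp, Expr.Bounded, Expr.eval, true_and, a9, r3]
    have hlt := hS.parent_lt k hcond
    have hle : ∀ q, Function.update (s.arr 11) (P k) (min (s.arr 11 (P k)) (s.arr 11 k)) q ≤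
        s.arr 11 q := by
      intro q
      by_cases hq : q = P k
      · rw [hq, Function.update_self]
        exact min_le_left _ _
      · rw [Function.update_of_ne hq]
    refine relax_wp ⟨k - 1, by omega, ?_, ?_, by omega, ?_, ?_, ?_⟩
    · simpa using a9
    · simp [r3]
    · intro x y hxy hlt'
      simpa [r3] using (hle _).trans (hlow x y hxy hlt')
    · intro q hq0 hq
      suffices LowAttained I num P
          (Function.update (s.arr 11) (P k) (min (s.arr 11 (P k)) (s.arr 11 k))) q by
        simpa [r3] using this
      by_cases hqP : q = P k
      · rcases le_or_gt (s.arr 11 (P k)) (s.arr 11 k) with h | h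
        · rw [min_eq_left h, Function.update_eq_self]
          exact hatt q hq0 hq
        · obtain ⟨z, hz, hz'⟩ := hatt k hcond hkn
          refine ⟨z, hqP ▸ (IsAncestor.parent P k).trans hz, ?_⟩
          rwa [hqP, Function.update_self, min_eq_right h.le]
      · obtain ⟨z, hz, hz'⟩ := hatt q hq0 hq
        refine ⟨z, hz, ?_⟩
        rwa [Function.update_of_ne hqP]
    · intro c hc hcn
      suffices Function.update (s.arr 11) (P k) (min (s.arr 11 (P k)) (s.arr 11 k)) (P c) ≤
          Function.update (s.arr 11) (P k) (min (s.arr 11 (P k)) (s.arr 11 k)) c by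
        simpa [r3] using this
      -- Only the cell `P k < k` changes, so the entries from `k` on keep their values while that of
      -- the parent can only decrease.
      rw [Function.update_of_ne (show c ≠ P k by omega)]
      rcases (show c = k ∨ k < c by omega) with rfl | hkc
      · rw [Function.update_self]
        exact min_le_right _ _
      · exact (hle _).trans (hpar c hkc hcn)
  · exact ⟨h9, h3, le_rfl, hlow, hatt, fun c hc hcn => absurd hcn (by omega)⟩
  · exact Nat.mul_le_mul_right _ (by decide)
  · rintro s' hs' ⟨k, ⟨a9, r3, hkn, hlow, hatt, hpar⟩, hcond⟩
    simp only [Expr.eval, r3] at hcond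
    subst hcond
    exact ⟨r3, hlow, hatt, fun k hk0 hk => hpar k (by omega) hk⟩

end

end RAM

/-! ### The numbers of the blocks -/

/-- The vertices with numbers up to `i` have been assigned to the blocks `1, …, nb`. -/
structure IsBlockState {V : Type*} (U : (⊤ : SimpleGraph V).Subgraph) (num : V → ℕ)
    (P low blk lead : ℕ → ℕ) (i nb : ℕ) : Prop where
  nb_le : nb ≤ i
  lead_spec : ∀ b, b ≠ 0 → b ≤ nb → lead b ≠ 0 ∧ lead b ≤ i ∧ blk (lead b) = b ∧
    OpensBlock U num P low (lead b)
  lead_blk : ∀ k, k ≠ 0 → k ≤ i → OpensBlock U num P low k →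
    blk k ≠ 0 ∧ blk k ≤ nb ∧ lead (blk k) = k
  blk_root : ∀ k, k ≠ 0 → k ≤ i → P k = 0 → ¬ OpensBlock U num P low k → blk k = 0
  blk_eq_parent : ∀ k, k ≠ 0 → k ≤ i → P k ≠ 0 → ¬ OpensBlock U num P low k → blk k = blk (P k)

namespace IsBlockState

variable {V : Type*} {U : (⊤ : SimpleGraph V).Subgraph} {num : V → ℕ} {P low blk lead : ℕ → ℕ}
  {i nb : ℕ}

theorem opens (h : IsBlockState U num P low blk lead i nb) (hP : ∀ k, k ≠ 0 → P k < k)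
    (ho : OpensBlock U num P low (i + 1)) :
    IsBlockState U num P low (Function.update blk (i + 1) (nb + 1))
      (Function.update lead (nb + 1) (i + 1)) (i + 1) (nb + 1) := by
  have hb : ∀ k ≤ i, Function.update blk (i + 1) (nb + 1) k = blk k := fun k hk =>
    Function.update_of_ne (by omega) _ _
  have hl : ∀ b ≤ nb, Function.update lead (nb + 1) (i + 1) b = lead b := fun b hb =>
    Function.update_of_ne (by omega) _ _
  refine ⟨Nat.succ_le_succ h.nb_le, ?_, ?_, ?_, ?_⟩
  · intro b hb0 hbn
    rcases hbn.eq_or_lt with rfl | hbn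
    · rw [Function.update_self, Function.update_self]
      exact ⟨by omega, le_rfl, rfl, ho⟩
    · obtain ⟨h1, h2, h3, h4⟩ := h.lead_spec b hb0 (by omega)
      rw [hl b (by omega), hb _ h2]
      exact ⟨h1, by omega, h3, h4⟩
  · intro k hk0 hk hok
    rcases hk.eq_or_lt with rfl | hk
    · rw [Function.update_self, Function.update_self]
      exact ⟨by omega, le_rfl, rfl⟩
    · obtain ⟨h1, h2, h3⟩ := h.lead_blk k hk0 (by omega) hok
      rw [hb k (by omega), hl _ h2]
      exact ⟨h1, by omega, h3⟩
  · intro k hk0 hk hPk hok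
    rcases hk.eq_or_lt with rfl | hk
    · exact absurd ho hok
    · rw [hb k (by omega)]
      exact h.blk_root k hk0 (by omega) hPk hok
  · intro k hk0 hk hPk hok
    rcases hk.eq_or_lt with rfl | hk
    · exact absurd ho hok
    · have := hP k hk0
      rw [hb k (by omega), hb _ (by omega)]
      exact h.blk_eq_parent k hk0 (by omega) hPk hok

theorem joins (h : IsBlockState U num P low blk lead i nb) (hP : ∀ k, k ≠ 0 → P k < k)
    (ho : ¬ OpensBlock U num P low (i + 1)) {v : ℕ} (hv : P (i + 1) = 0 → v = 0)
    (hv' : P (i + 1) ≠ 0 → v = blk (P (i + 1))) :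
    IsBlockState U num P low (Function.update blk (i + 1) v) lead (i + 1) nb := by
  have hb : ∀ k ≤ i, Function.update blk (i + 1) v k = blk k := fun k hk =>
    Function.update_of_ne (by omega) _ _
  refine ⟨h.nb_le.trans (Nat.le_succ i), ?_, ?_, ?_, ?_⟩
  · intro b hb0 hbn
    obtain ⟨h1, h2, h3, h4⟩ := h.lead_spec b hb0 hbn
    rw [hb _ h2]
    exact ⟨h1, by omega, h3, h4⟩
  · intro k hk0 hk hok
    rcases hk.eq_or_lt with rfl | hk
    · exact absurd hok ho
    · rw [hb k (by omega)]
      exact h.lead_blk k hk0 (by omega) hok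
  · intro k hk0 hk hPk hok
    rcases hk.eq_or_lt with rfl | hk
    · rw [Function.update_self]
      exact hv hPk
    · rw [hb k (by omega)]
      exact h.blk_root k hk0 (by omega) hPk hok
  · intro k hk0 hk hPk hok
    have := hP k hk0
    rw [hb (P k) (by omega)]
    rcases hk.eq_or_lt with rfl | hk
    · rw [Function.update_self]
      exact hv' hPk
    · rw [hb k (by omega)]
      exact h.blk_eq_parent k hk0 (by omega) hPk hok

end IsBlockState

namespace RAM

open RAM.Expr RAM.Program

/-- Lets the vertex with the number in register 3 open a new block, whose number is put into the
registers 7 and 13. -/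
def openBlock : Program :=
  .seq (.assign 13 (.add (.reg 13) (.const 1))) <|
  .seq (.store 14 (.reg 13) (.reg 3)) (.assign 7 (.reg 13))

/-- Stores the block of the vertex with the number in register 3 and adds it to the list of the
block. -/
def storeBlock : Program :=
  .seq (.store 13 (.reg 3) (.reg 7)) <|
  .seq (.store 16 (.reg 3) (.load 15 (.reg 7))) <|
  .store 15 (.reg 7) (.reg 3)

/-- Assigns the vertices to blocks. The array 13 holds the block of each vertex, 14 the opening vertex
of each block; the arrays 15 and 16 hold the lists of the vertices of the blocks. -/
def assignBlocks : Program :=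
  .loop (.sub (.reg 1) (.reg 3)) <|
    .seq (.assign 3 (.add (.reg 3) (.const 1))) <|
    .seq (.assign 6 (.load 9 (.reg 3))) <|
    .seq (.ite (.reg 6)
      (.ite (.sub (.reg 6) (.load 11 (.reg 3))) (.assign 7 (.load 13 (.reg 6))) openBlock)
      (.ite (.load 12 (.reg 3)) (.assign 7 (.const 0)) openBlock))
    storeBlock

/-- Stores the block of the edge with the number in register 3, for which register 7 holds the larger
number of an end vertex, and adds the edge to the list of the block. -/
def storeEdge : Program :=
  .seq (.assign 6 (.load 13 (.reg 7))) <|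
  .seq (.store 19 (.reg 3) (.reg 6)) <|
  .seq (.store 18 (.reg 3) (.load 17 (.reg 6))) <|
  .store 17 (.reg 6) (.reg 3)

/-- Adds the edges to the lists of their blocks. The array 19 holds the block of each edge, 17 and 18
hold the lists. -/
def assignEdges : Program :=
  .loop (.sub (.reg 2) (.reg 3)) <|
    .seq loadEdge <|
    .seq (.ite (.sub (.reg 6) (.reg 7)) (.assign 7 (.reg 6)) .skip) storeEdge

section

variable {I : SefeInstance ℕ} {n m : ℕ} {A num ord P low : ℕ → ℕ} {W M : ℕ}

/-- Increasing order makes the block of the parent available. Roots that have edges get the number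
0; their list is never written out, and they enter the output as parents of opening vertices. -/
theorem assignBlocks_runs (hS : IsSearchNumbering I n num ord P)
    (hM : 10 * (n + m + 1) ≤ M) (hW : 1000 * M ≤ W) {s : State} (hs : s.Bdd M) (h9 : s.arr 9 = P)
    (h11 : s.arr 11 = low) (h1 : s.reg 1 = n) (h3 : s.reg 3 = 0) (h13 : s.reg 13 = 0)
    (h12 : ∀ k, s.arr 12 k ≠ 0 ↔ ∃ x y, I.union.Adj x y ∧ num (x + 1) = k)
    (h15 : ∀ x, s.arr 15 x = 0) :
    Runs W M assignBlocks s (1000 * (n + 1)) (fun s' =>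
      IsBlockState I.union (fun v => num (v + 1)) P low (s'.arr 13) (s'.arr 14) n (s'.reg 13) ∧
      IsBucket (s'.arr 13) (s'.arr 15) (s'.arr 16) n) := by
  set has := s.arr 12 with hhas
  let Inv : ℕ → State → Prop := fun k s => ∃ i, i + k = n ∧ s.arr 9 = P ∧ s.arr 11 = low ∧
    s.arr 12 = has ∧ s.reg 1 = n ∧ s.reg 3 = i ∧
    IsBlockState I.union (fun v => num (v + 1)) P low (s.arr 13) (s.arr 14) i (s.reg 13) ∧
    IsBucket (s.arr 13) (s.arr 15) (s.arr 16) i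
  refine (Runs.loop_wp (Inv := Inv) (k := n) ?_ ?_ ?_ hs ?_).mono ?_ ?_
  · exact (Nat.mul_le_mul_right M (by decide)).trans hW
  · exact le_trans (by decide) (show 10 ≤ M by omega)
  · rintro k s hs ⟨i, hi, a9, a11, a12, r1, r3, hblk, hbuc⟩ hcond
    simp only [Expr.eval, r1, r3] at hcond
    have hin : i < n := by omega
    have hnb := hblk.nb_le
    have finish : ∀ s' : State, s'.arr 9 = P → s'.arr 11 = low → s'.arr 12 = has → s'.reg 1 = n →
        s'.reg 3 = i + 1 → s'.arr 13 = s.arr 13 → s'.arr 15 = s.arr 15 → s'.arr 16 = s.arr 16 →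
        IsBlockState I.union (fun v => num (v + 1)) P low
          (Function.update (s.arr 13) (i + 1) (s'.reg 7)) (s'.arr 14) (i + 1) (s'.reg 13) →
        storeBlock.wp M (fun s' => ∃ k' < k, Inv k' s') s' := by
      intro s' b9 b11 b12 q1 q3 b13 b15 b16 hblk'
      simp only [storeBlock, Program.wp, Expr.Bounded, Expr.eval, true_and]
      refine ⟨k - 1, by omega, i + 1, by omega, ?_, ?_, ?_, q1, q3, ?_, ?_⟩
      · simpa using b9
      · simpa using b11
      · simpa using b12
      · simpa [q3, b13] using hblk'
      · simpa [q3, b13, b15, b16] using hbuc.push (s'.reg 7)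
    simp only [Program.wp, Expr.Bounded, Expr.eval, true_and, Function.update_self, r3, a9, a11,
      a12, ne_eq, Nat.reduceEqDiff, not_false_eq_true, Function.update_of_ne]
    have hopen : OpensBlock I.union (fun v => num (v + 1)) P low (i + 1) →
        openBlock.wp M (storeBlock.wp M (fun s' => ∃ k' < k, Inv k' s'))
          ⟨Function.update (Function.update s.reg 3 (i + 1)) 6 (P (i + 1)), s.arr⟩ := by
      intro ho
      simp only [openBlock, Program.wp, Expr.Bounded, Expr.eval, true_and]
      refine ⟨?_, finish _ ?_ ?_ ?_ ?_ ?_ ?_ ?_ ?_ ?_⟩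
      · simp
        omega
      · simpa using a9
      · simpa using a11
      · simpa using a12
      · simpa using r1
      · simp
      · simp
      · simp
      · simp
      · simpa using hblk.opens hS.parent_lt ho
    -- The four branches: a non-root below its parent's cut joins the parent's block if `low < P`
    -- and opens one otherwise; a root gets 0 if it is marked as having an edge and opens a block if
    -- it is isolated.
    refine ⟨by omega, fun hP => ⟨fun hlow => ?_, fun hlow => ?_⟩,
      fun hP => ⟨fun hh => ?_, fun hh => ?_⟩⟩
    · refine finish _ a9 a11 a12 ?_ ?_ rfl rfl rfl ?_
      · simpa using r1
      · simp
      · refine hblk.joins hS.parent_lt ?_ (fun h => absurd h hP) (by simp)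
        rintro (⟨h, -⟩ | ⟨-, h⟩)
        · exact hP h
        · omega
    · exact hopen (Or.inr ⟨hP, by omega⟩)
    · refine finish _ a9 a11 a12 ?_ ?_ rfl rfl rfl ?_
      · simpa using r1
      · simp
      · refine hblk.joins hS.parent_lt ?_ (by simp) (fun h => absurd hP h)
        obtain ⟨x, y, hxy, hx⟩ := (h12 (i + 1)).1 hh
        rintro (⟨-, h⟩ | ⟨h, -⟩)
        · exact h x y hxy hx
        · exact h hP
    · refine hopen (Or.inl ⟨hP, fun x y hxy hx => ?_⟩)
      exact (h12 (i + 1)).2 ⟨x, y, hxy, hx⟩ hh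
  · refine ⟨0, by omega, h9, h11, hhas.symm, h1, h3, ?_, IsBucket.zero h15⟩
    rw [h13]
    exact ⟨le_rfl, fun b h h' => absurd h' (by omega), fun b h h' => absurd h' (by omega),
      fun b h h' => absurd h' (by omega), fun b h h' => absurd h' (by omega)⟩
  · exact Nat.mul_le_mul_right _ (by decide)
  · rintro s' hs' ⟨k, ⟨i, hi, a9, a11, a12, r1, r3, hblk, hbuc⟩, hcond⟩
    simp only [Expr.eval, r1, r3] at hcond
    obtain rfl : i = n := by omega
    exact ⟨hblk, hbuc⟩

theorem assignEdges_runs (hM : 10 * (n + m + 1) ≤ M) (hW : 1000 * M ≤ W) {s : State}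
    (hs : s.Bdd M) (h0 : s.arr 0 = A) (h7 : s.arr 7 = num) (h2 : s.reg 2 = m) (h3 : s.reg 3 = 0)
    (h4 : s.reg 4 = 2 + 2 * n) (h17 : ∀ x, s.arr 17 x = 0) :
    Runs W M assignEdges s (1000 * (m + 1)) (fun s' =>
      IsBucket (s'.arr 19) (s'.arr 17) (s'.arr 18) m ∧
      ∀ j < m, s'.arr 19 (j + 1) = s.arr 13 (max (num (A (2 + 2 * n + 3 * j) + 1))
        (num (A (2 + 2 * n + 3 * j + 1) + 1)))) := by
  set blk := s.arr 13 with hblk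
  let Inv : ℕ → State → Prop := fun k s => ∃ i, i + k = m ∧ s.arr 0 = A ∧ s.arr 7 = num ∧
    s.arr 13 = blk ∧ s.reg 2 = m ∧ s.reg 3 = i ∧ s.reg 4 = 2 + 2 * n + 3 * i ∧
    IsBucket (s.arr 19) (s.arr 17) (s.arr 18) i ∧
    ∀ j < i, s.arr 19 (j + 1) = blk (max (num (A (2 + 2 * n + 3 * j) + 1))
        (num (A (2 + 2 * n + 3 * j + 1) + 1)))
  refine (Runs.loop_wp (Inv := Inv) (k := m) ?_ ?_ ?_ hs ?_).mono ?_ ?_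
  · exact (Nat.mul_le_mul_right M (by decide)).trans hW
  · exact le_trans (by decide) (show 10 ≤ M by omega)
  · rintro k s hs ⟨i, hi, a0, a7, a13, r2, r3, r4, hbuc, hkey⟩ hcond
    simp only [Expr.eval, r2, r3] at hcond
    have him : i < m := by omega
    refine loadEdge_wp r3 r4 (by omega) (by omega) fun reg hreg hr3 hr4 hr6 hr7 => ?_
    rw [a0, a7] at hr6 hr7
    have finish : ∀ r : ℕ → ℕ, r 2 = m → r 3 = i + 1 → r 4 = 2 + 2 * n + 3 * i + 3 →
        r 7 = max (num (A (2 + 2 * n + 3 * i) + 1)) (num (A (2 + 2 * n + 3 * i + 1) + 1)) →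
        storeEdge.wp M (fun s' => ∃ k' < k, Inv k' s') ⟨r, s.arr⟩ := by
      intro r q2 q3 q4 q7
      simp only [storeEdge, Program.wp, Expr.Bounded, Expr.eval, true_and]
      refine ⟨k - 1, by omega, i + 1, by omega, ?_, ?_, ?_, ?_, ?_, ?_, ?_, ?_⟩
      · simpa using a0
      · simpa using a7
      · simpa using a13
      · simpa using q2
      · simpa using q3
      · simp [q4]
        omega
      · simpa [q3] using hbuc.push (s.arr 13 (r 7))
      · intro j hj
        simp only [ne_eq, Nat.reduceEqDiff, not_false_eq_true, Function.update_of_ne,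
          Function.update_self, q3]
        rcases Nat.lt_succ_iff_lt_or_eq.1 hj with hj | rfl
        · rw [Function.update_of_ne (by omega)]
          exact hkey j hj
        · rw [Function.update_self, a13, q7]
    simp only [Program.wp, Expr.eval, Expr.Bounded, hr6, hr7, true_and]
    have q2 : reg 2 = m := (hreg 2 (by decide) (by decide) (by decide) (by decide)).trans r2
    constructor
    · intro hlt
      refine finish _ ?_ ?_ ?_ ?_
      · simpa using q2
      · simpa using hr3
      · simpa using hr4
      · simp only [Function.update_self]
        omega
    · intro hge
      exact finish _ q2 hr3 hr4 (by rw [hr7]; omega)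
  · exact ⟨0, by omega, h0, h7, hblk.symm, h2, h3, h4, IsBucket.zero h17, by simp⟩
  · exact Nat.mul_le_mul_right _ (by decide)
  · rintro s' hs' ⟨k, ⟨i, hi, a0, a7, a13, r2, r3, r4, hbuc, hkey⟩, hcond⟩
    simp only [Expr.eval, r2, r3] at hcond
    obtain rfl : i = m := by omega
    exact ⟨hbuc, hkey⟩

end

end RAM

/-! ### Words and linked lists in arrays -/

/-- The array `f` holds the word `X` from the address `p` on. -/
def HoldsAt (f : ℕ → ℕ) : ℕ → List ℕ → Prop
  | _, [] => True
  | p, a :: X => f p = a ∧ HoldsAt f (p + 1) X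

theorem HoldsAt.append {f : ℕ → ℕ} {p : ℕ} {X Y : List ℕ} (hX : HoldsAt f p X)
    (hY : HoldsAt f (p + X.length) Y) : HoldsAt f p (X ++ Y) := by
  induction X generalizing p with
  | nil => exact hY
  | cons a X ih =>
    refine ⟨hX.1, ih hX.2 ?_⟩
    rwa [List.length_cons, Nat.add_comm X.length, ← Nat.add_assoc] at hY

theorem HoldsAt.congr {f g : ℕ → ℕ} {p : ℕ} {X : List ℕ} (hX : HoldsAt f p X)
    (h : ∀ i, p ≤ i → i < p + X.length → g i = f i) : HoldsAt g p X := by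
  induction X generalizing p with
  | nil => trivial
  | cons a X ih =>
    rw [List.length_cons] at h
    exact ⟨(h p le_rfl (by omega)).trans hX.1, ih hX.2 fun i hi hi' => h i (by omega) (by omega)⟩

theorem HoldsAt.map_range {f : ℕ → ℕ} {X : List ℕ} (h : HoldsAt f 0 X) :
    (List.range X.length).map f = X := by
  suffices ∀ p, HoldsAt f p X → (List.range X.length).map (fun i => f (p + i)) = X by
    simpa using this 0 h
  clear h
  intro p h
  induction X generalizing p with
  | nil => rfl
  | cons a X ih =>
    rw [List.length_cons, List.range_succ_eq_map, List.map_cons, List.map_map, Nat.add_zero, h.1]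
    congr 1
    rw [← ih (p + 1) h.2, List.length_map, List.length_range]
    refine List.map_congr_left fun i _ => ?_
    simp only [Function.comp_apply, Nat.succ_eq_add_one]
    congr 1
    omega

/-- The successor function `next`, started at `h`, runs through the list and then arrives at zero. -/
def Follows (next : ℕ → ℕ) : ℕ → List ℕ → Prop
  | h, [] => h = 0
  | h, a :: L => h = a ∧ a ≠ 0 ∧ Follows next (next a) L

/-- Successors strictly decrease, so the walk terminates without repetition, and `le_next`
guarantees that it skips no item with the key. -/
theorem IsBucket.exists_follows {key head next : ℕ → ℕ} {k : ℕ} (h : IsBucket key head next k)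
    (x : ℕ) : ∃ L : List ℕ, Follows next (head x) L ∧ L.Nodup ∧
      ∀ a, a ∈ L ↔ a ≠ 0 ∧ a ≤ k ∧ key a = x := by
  suffices ∀ q ≤ k, (q ≠ 0 → key q = x) → ∃ L : List ℕ, Follows next q L ∧ L.Nodup ∧
      ∀ a, a ∈ L ↔ a ≠ 0 ∧ a ≤ q ∧ key a = x by
    obtain ⟨L, h1, h2, h3⟩ := this (head x) (h.head_le x) (h.key_head x)
    refine ⟨L, h1, h2, fun a => ?_⟩
    rw [h3]
    have := h.head_le x
    refine ⟨fun ⟨h0, ha, hx⟩ => ⟨h0, by omega, hx⟩, fun ⟨h0, ha, hx⟩ => ⟨h0, ?_, hx⟩⟩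
    rw [← hx]
    exact h.le_head a h0 ha
  intro q
  induction q using Nat.strong_induction_on with
  | _ q ih =>
  intro hq hx
  rcases eq_or_ne q 0 with rfl | hq0
  · refine ⟨[], rfl, List.nodup_nil, fun a => ⟨fun h => absurd h List.not_mem_nil, fun h => ?_⟩⟩
    omega
  · have hlt := h.next_lt q hq0 hq
    obtain ⟨L, h1, h2, h3⟩ := ih (next q) hlt (by omega)
      fun h0 => (h.key_next q hq0 hq h0).trans (hx hq0)
    refine ⟨q :: L, ⟨rfl, hq0, h1⟩, List.nodup_cons.2 ⟨fun hm => ?_, h2⟩, fun a => ?_⟩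
    · have := ((h3 q).1 hm).2.1
      omega
    · rw [List.mem_cons, h3]
      constructor
      · rintro (rfl | ⟨h0, ha, hax⟩)
        exacts [⟨hq0, le_rfl, hx hq0⟩, ⟨h0, by omega, hax⟩]
      · rintro ⟨h0, ha, hax⟩
        rcases ha.eq_or_lt with rfl | ha
        · exact Or.inl rfl
        · exact Or.inr ⟨h0, h.le_next q a hq0 hq h0 ha (hax.trans (hx hq0).symm), hax⟩

namespace RAM

open RAM.Expr RAM.Program

/-! ### The output -/

/-- Writes the vertex with the number in register 6 to the output. Register 15 is the output position,
register 16 counts the vertices. -/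
def emitVertex : Program :=
  .seq (.assign 7 (.load 8 (.reg 6))) <|
  .seq (.store 1 (.reg 15) (.sub (.reg 7) (.const 1))) <|
  .seq (.store 1 (.add (.reg 15) (.const 1)) (.load 2 (.reg 7))) <|
  .seq (.assign 15 (.add (.reg 15) (.const 2))) <|
  .assign 16 (.add (.reg 16) (.const 1))

/-- Writes the edge with the number in register 6 to the output; register 17 counts the edges. -/
def emitEdge : Program :=
  .seq (.assign 7 (.sub (.add (.add (.reg 1) (.reg 1)) (.add (.reg 6) (.add (.reg 6) (.reg 6))))
    (.const 1))) <|
  .seq (.store 1 (.reg 15) (.load 0 (.reg 7))) <|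
  .seq (.store 1 (.add (.reg 15) (.const 1)) (.load 0 (.add (.reg 7) (.const 1)))) <|
  .seq (.store 1 (.add (.reg 15) (.const 2)) (.load 0 (.add (.reg 7) (.const 2)))) <|
  .seq (.assign 15 (.add (.reg 15) (.const 3))) <|
  .assign 17 (.add (.reg 17) (.const 1))

/-- Prepares the output of the next block and writes the parent of its opening vertex. -/
def startBlock : Program :=
  .seq (.assign 3 (.add (.reg 3) (.const 1))) <|
  .seq (.assign 15 (.add (.reg 14) (.const 2))) <|
  .seq (.assign 16 (.const 0)) <|
  .seq (.assign 17 (.const 0)) <|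
  .seq (.assign 6 (.load 9 (.load 14 (.reg 3)))) <|
  .seq (.ite (.reg 6) emitVertex .skip) <|
  .assign 6 (.load 15 (.reg 3))

/-- Writes the numbers of vertices and edges in front of the code of the block. -/
def finishBlock : Program :=
  .seq (.store 1 (.reg 14) (.reg 16)) <|
  .seq (.store 1 (.add (.reg 14) (.const 1)) (.reg 17)) <|
  .assign 14 (.reg 15)

/-- Writes the code of the next block. -/
def emitBlock : Program :=
  .seq startBlock <|
  .seq (.loop (.reg 6) (.seq emitVertex (.assign 6 (.load 16 (.reg 6))))) <|
  .seq (.assign 6 (.load 17 (.reg 3))) <|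
  .seq (.loop (.reg 6) (.seq emitEdge (.assign 6 (.load 18 (.reg 6)))))
  finishBlock

/-- Writes the codes of all blocks. -/
def emitBlocks : Program :=
  .seq (.loop (.sub (.reg 13) (.reg 3)) emitBlock) <|
  .seq (.store 1 (.const 0) (.reg 13)) (.assign 0 (.reg 14))

/-- The code of the vertex with the number `k`. -/
def vertexCode (ord lab : ℕ → ℕ) (k : ℕ) : List ℕ := [ord k - 1, lab (ord k)]

/-- The code of the edge with the number `j`. -/
def edgeCode (A : ℕ → ℕ) (n j : ℕ) : List ℕ :=
  [A (2 * n + 3 * j - 1), A (2 * n + 3 * j - 1 + 1), A (2 * n + 3 * j - 1 + 2)]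

/-- The code of a block, given the numbers of its vertices and edges. -/
def blockCode (ord lab A : ℕ → ℕ) (n : ℕ) (V E : List ℕ) : List ℕ :=
  V.length :: E.length :: (V.flatMap (vertexCode ord lab) ++ E.flatMap (edgeCode A n))

theorem length_flatMap_vertexCode {ord lab : ℕ → ℕ} (V : List ℕ) :
    (V.flatMap (vertexCode ord lab)).length = 2 * V.length := by
  induction V with
  | nil => rfl
  | cons a V ih =>
    rw [List.flatMap_cons, List.length_append, ih, List.length_cons]
    simp only [vertexCode, List.length_cons, List.length_nil]
    omega

theorem length_flatMap_edgeCode {A : ℕ → ℕ} {n : ℕ} (E : List ℕ) :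
    (E.flatMap (edgeCode A n)).length = 3 * E.length := by
  induction E with
  | nil => rfl
  | cons a V ih =>
    rw [List.flatMap_cons, List.length_append, ih, List.length_cons]
    simp only [edgeCode, List.length_cons, List.length_nil]
    omega

theorem length_blockCode {ord lab A : ℕ → ℕ} {n : ℕ} (V E : List ℕ) :
    (blockCode ord lab A n V E).length = 2 + 2 * V.length + 3 * E.length := by
  simp only [blockCode, List.length_cons, List.length_append, length_flatMap_vertexCode,
    length_flatMap_edgeCode]
  omega

/-- What is added to the output: the word `X`, which contains `d` items. -/
structure Emits (cnt d : ℕ) (X : List ℕ) (s s' : State) : Prop where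
  pos : s'.reg 15 = s.reg 15 + X.length
  count : s'.reg cnt = s.reg cnt + d
  before : ∀ i < s.reg 15, s'.arr 1 i = s.arr 1 i
  holds : HoldsAt (s'.arr 1) (s.reg 15) X

theorem Emits.append {cnt d d' : ℕ} {X X' : List ℕ} {s s' s'' : State} (h : Emits cnt d X s s')
    (h' : Emits cnt d' X' s' s'') : Emits cnt (d + d') (X ++ X') s s'' := by
  refine ⟨?_, ?_, fun i hi => ?_, ?_⟩
  · rw [h'.pos, h.pos, List.length_append, Nat.add_assoc]
  · rw [h'.count, h.count, Nat.add_assoc]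
  · rw [h'.before i (by rw [h.pos]; omega), h.before i hi]
  · refine (h.holds.congr fun i _ hi => h'.before i (by rwa [h.pos])).append ?_
    rw [← h.pos]
    exact h'.holds

/-- This covers both the loop over vertices and the loop over edges of a block. The list `L` that
the successor function follows fixes the number of passes, each of which costs the body and 2
operations for the test. -/
theorem emit_loop_runs {W M cnt : ℕ} {c : Program} {f : ℕ → List ℕ} {D : ℕ → Prop}
    {Inv : State → Prop} {next : ℕ → ℕ} (hW : (c.size + 1) * M ≤ W) (hM : c.maxConst ≤ M)
    (hbody : ∀ s, s.Bdd M → Inv s → D (s.reg 6) → s.reg 15 + (f (s.reg 6)).length ≤ M →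
      s.reg cnt + 1 ≤ M →
      c.wp M (fun s' => Inv s' ∧ s'.reg 6 = next (s.reg 6) ∧ Emits cnt 1 (f (s.reg 6)) s s') s)
    {L : List ℕ} {s : State} (hs : s.Bdd M) (hinv : Inv s) (hL : Follows next (s.reg 6) L)
    (hD : ∀ a ∈ L, D a) (hlen : s.reg 15 + (L.flatMap f).length ≤ M)
    (hcnt : s.reg cnt + L.length ≤ M) :
    Runs W M (.loop (.reg 6) c) s ((c.size + 2) * L.length + 2)
      (fun s' => Inv s' ∧ Emits cnt L.length (L.flatMap f) s s') := by
  rw [Nat.add_mul, one_mul] at hW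
  induction L generalizing s with
  | nil =>
    refine ⟨_, s, .loop_false ((hs.1 6).trans (by omega)) hL, by simp [Expr.cost], hs, hinv, ?_⟩
    exact ⟨rfl, rfl, fun _ _ => rfl, trivial⟩
  | cons a L ih =>
    obtain ⟨ha, ha0, hL⟩ := hL
    rw [List.flatMap_cons, List.length_append] at hlen
    rw [List.length_cons] at hcnt
    obtain ⟨t, s', h1, h2, h3, h4, h5, h6⟩ := Runs.of_wp (W := W) hs (by omega) hM
      (hbody s hs hinv (ha ▸ hD a List.mem_cons_self) (by rw [ha]; omega) (by omega))
    rw [ha] at h5 h6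
    obtain ⟨t', s'', h7, h8, h9, h10, h11⟩ := ih h3 h4 (by rwa [h5])
      (fun b hb => hD b (List.mem_cons_of_mem a hb)) (by rw [h6.pos]; omega)
      (by rw [h6.count]; omega)
    refine ⟨_, s'', .loop_true ((hs.1 6).trans (by omega)) (by rwa [Expr.eval, ha]) h1 h7, ?_, h9,
      h10, ?_⟩
    · rw [List.length_cons, Nat.mul_add]
      simp only [Expr.cost]
      omega
    · rw [List.flatMap_cons, List.length_cons, Nat.add_comm L.length]
      exact h6.append h11

/-- The arrays that are used for the output. -/
structure OutputData (n : ℕ) (A lab ord P lead vhead vnext ehead enext : ℕ → ℕ) (s : State) :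
    Prop where
  num : s.reg 1 = n
  input : s.arr 0 = A
  lab : s.arr 2 = lab
  ord : s.arr 8 = ord
  parent : s.arr 9 = P
  lead : s.arr 14 = lead
  vhead : s.arr 15 = vhead
  vnext : s.arr 16 = vnext
  ehead : s.arr 17 = ehead
  enext : s.arr 18 = enext

section

variable {n m nb : ℕ} {A lab ord P lead vhead vnext ehead enext : ℕ → ℕ} {W M : ℕ}

theorem OutputData.congr {s s' : State}
    (h : OutputData n A lab ord P lead vhead vnext ehead enext s) (h1 : s'.reg 1 = s.reg 1)
    (ha : ∀ a, a ≠ 1 → s'.arr a = s.arr a) :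
    OutputData n A lab ord P lead vhead vnext ehead enext s' := by
  constructor
  · exact h1.trans h.num
  · exact (ha 0 (by decide)).trans h.input
  · exact (ha 2 (by decide)).trans h.lab
  · exact (ha 8 (by decide)).trans h.ord
  · exact (ha 9 (by decide)).trans h.parent
  · exact (ha 14 (by decide)).trans h.lead
  · exact (ha 15 (by decide)).trans h.vhead
  · exact (ha 16 (by decide)).trans h.vnext
  · exact (ha 17 (by decide)).trans h.ehead
  · exact (ha 18 (by decide)).trans h.enext

theorem emitVertex_wp {s : State} {Q : State → Prop} (h2 : s.arr 2 = lab) (h8 : s.arr 8 = ord)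
    (hpos : s.reg 15 + 2 ≤ M) (hcnt : s.reg 16 + 1 ≤ M)
    (hQ : ∀ s' : State, (∀ x, x ≠ 7 → x ≠ 15 → x ≠ 16 → s'.reg x = s.reg x) →
      (∀ a, a ≠ 1 → s'.arr a = s.arr a) → Emits 16 1 (vertexCode ord lab (s.reg 6)) s s' → Q s') :
    emitVertex.wp M Q s := by
  subst h2 h8
  simp only [emitVertex, Program.wp, Expr.Bounded, Expr.eval, true_and]
  refine ⟨by simpa using hpos, by simpa using hcnt, hQ _ ?_ ?_ ⟨?_, ?_, ?_, ?_, ?_, trivial⟩⟩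
  · intro x h7 h15 h16
    simp [h7, h15, h16]
  · intro a ha
    simp [ha]
  · simp [vertexCode]
  · simp
  · intro i hi
    have h1 : i ≠ s.reg 15 := by omega
    have h2 : i ≠ s.reg 15 + 1 := by omega
    simp [h1, h2]
  · simp
  · simp

theorem emitEdge_wp {s : State} {Q : State → Prop} (h1 : s.reg 1 = n) (h0 : s.arr 0 = A)
    (hM : 2 * n + 3 * s.reg 6 ≤ M) (hpos : s.reg 15 + 3 ≤ M) (hcnt : s.reg 17 + 1 ≤ M)
    (hQ : ∀ s' : State, (∀ x, x ≠ 7 → x ≠ 15 → x ≠ 17 → s'.reg x = s.reg x) →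
      (∀ a, a ≠ 1 → s'.arr a = s.arr a) → Emits 17 1 (edgeCode A n (s.reg 6)) s s' → Q s') :
    emitEdge.wp M Q s := by
  subst h1 h0
  have hadd : s.reg 1 + s.reg 1 + (s.reg 6 + (s.reg 6 + s.reg 6)) =
    2 * s.reg 1 + 3 * s.reg 6 := by omega
  simp only [emitEdge, Program.wp, Expr.Bounded, Expr.eval, true_and, hadd]
  refine ⟨hM, by simpa using hpos, by simpa using hcnt, hQ _ ?_ ?_ ⟨?_, ?_, ?_, ?_, ?_, ?_, trivial⟩⟩
  · intro x h7 h15 h16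
    simp [h7, h15, h16]
  · intro a ha
    simp [ha]
  · simp [edgeCode]
  · simp
  · intro i hi
    have h1 : i ≠ s.reg 15 := by omega
    have h2 : i ≠ s.reg 15 + 1 := by omega
    have h3 : i ≠ s.reg 15 + 2 := by omega
    simp [h1, h2, h3]
  · simp
  · simp
  · simp

end

end RAM

namespace RAM

open RAM.Expr RAM.Program

section

variable {n m nb : ℕ} {A lab ord P lead vhead vnext ehead enext : ℕ → ℕ} {W M : ℕ}

/-- The vertices of a block, given by the parent of the opening vertex and the other vertices. -/
def withParent (p : ℕ) (V : List ℕ) : List ℕ := (if p = 0 then [] else [p]) ++ V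

theorem length_withParent_le (p : ℕ) (V : List ℕ) :
    (withParent p V).length ≤ V.length + 1 := by
  rw [withParent, List.length_append]
  split_ifs <;> simp only [List.length_nil, List.length_cons] <;> omega

/-- Two cells are left free at `pos`, as the numbers of vertices and edges are known only after the
lists have been walked. The other two cells in `pos + 4` are for the parent of the opening vertex,
if there is one. -/
theorem startBlock_wp {s : State} {b pos : ℕ} {Q : State → Prop}
    (hd : OutputData n A lab ord P lead vhead vnext ehead enext s) (h3 : s.reg 3 = b)
    (h14 : s.reg 14 = pos) (hb : b + 1 ≤ M) (hpos : pos + 4 ≤ M)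
    (hQ : ∀ s', OutputData n A lab ord P lead vhead vnext ehead enext s' ∧ s'.reg 3 = b + 1 ∧
      s'.reg 13 = s.reg 13 ∧ s'.reg 14 = pos ∧ s'.reg 6 = vhead (b + 1) ∧ s'.reg 17 = 0 ∧
      Emits 16 (withParent (P (lead (b + 1))) []).length
        ((withParent (P (lead (b + 1))) []).flatMap (vertexCode ord lab))
        ⟨Function.update (Function.update s.reg 15 (pos + 2)) 16 0, s.arr⟩ s' → Q s') :
    startBlock.wp M Q s := by
  simp only [startBlock, Program.wp, Expr.Bounded, Expr.eval, true_and, Function.update_self, h3,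
    h14, hd.parent, hd.lead, ne_eq, Nat.reduceEqDiff, not_false_eq_true, Function.update_of_ne]
  refine ⟨hb, by omega, fun hP => ?_, fun hP => ?_⟩
  · refine emitVertex_wp hd.lab hd.ord ?_ ?_ fun s' hreg harr hem => ?_
    · simpa [hb] using hpos
    · simp
      omega
    · refine hQ _ ⟨hd.congr ?_ harr, ?_, ?_, ?_, ?_, ?_, ?_⟩
      · simp [hreg]
      · simp [hreg]
      · simp [hreg]
      · simpa [hreg] using h14
      · simp [hreg, harr, hd.vhead]
      · simp [hreg]
      · rw [withParent, if_neg hP]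
        refine ⟨?_, ?_, ?_, ?_⟩
        · simpa [vertexCode] using hem.pos
        · simpa using hem.count
        · simpa using hem.before
        · simpa using hem.holds
  · rw [withParent, if_pos hP] at hQ
    refine hQ _ ⟨hd.congr ?_ fun _ _ => rfl, ?_, ?_, ?_, ?_, ?_, ?_, ?_, fun _ _ => rfl, trivial⟩
    · simp
    · simp
    · simp
    · simpa using h14
    · simp [hd.vhead]
    · simp
    · simp
    · simp

theorem emitBlock_runs {s : State} (hM : 10 * (n + m + 1) ≤ M) (hW : 1000 * M ≤ W)
    (hs : s.Bdd M) (hd : OutputData n A lab ord P lead vhead vnext ehead enext s) {b pos : ℕ}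
    {V E : List ℕ} (h3 : s.reg 3 = b) (h14 : s.reg 14 = pos) (hb : b + 1 ≤ M)
    (hV : Follows vnext (vhead (b + 1)) V) (hE : Follows enext (ehead (b + 1)) E)
    (hEm : ∀ a ∈ E, a ≤ m) (hpos : pos + 4 + 2 * V.length + 3 * E.length ≤ M) :
    Runs W M emitBlock s (500 * (1 + V.length + E.length)) (fun s' =>
      OutputData n A lab ord P lead vhead vnext ehead enext s' ∧ s'.reg 3 = b + 1 ∧
      s'.reg 13 = s.reg 13 ∧
      s'.reg 14 = pos + (blockCode ord lab A n (withParent (P (lead (b + 1))) V) E).length ∧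
      (∀ i < pos, s'.arr 1 i = s.arr 1 i) ∧
      HoldsAt (s'.arr 1) pos (blockCode ord lab A n (withParent (P (lead (b + 1))) V) E)) := by
  set D := OutputData n A lab ord P lead vhead vnext ehead enext with hD
  have hpl := length_withParent_le (P (lead (b + 1))) []
  rw [List.length_nil] at hpl
  have hwp : withParent (P (lead (b + 1))) V = withParent (P (lead (b + 1))) [] ++ V := by
    simp [withParent]
  have hW' : ∀ d ≤ 1000, d * M ≤ W := fun d h => (Nat.mul_le_mul_right M h).trans hW
  have hM' : ∀ d ≤ 10, d ≤ M := fun d h => h.trans (by omega)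
  refine (Runs.seq (Runs.of_wp hs (hW' _ (by decide)) (hM' _ (by decide))
    (startBlock_wp hd h3 h14 hb (by omega) fun _ h => h)) fun s₁ hs₁ ⟨hd₁, h3₁, h13₁, h14₁, h6₁, h17₁, hem₁⟩ =>
    Runs.seq (Runs.frame (emit_loop_runs (cnt := 16) (f := vertexCode ord lab) (Inv := D)
      (D := fun _ => True) (next := vnext) (L := V) (hW' _ (by decide)) (hM' _ (by decide)) ?_ hs₁ hd₁ (h6₁ ▸ hV)
      (fun _ _ => trivial) ?_ ?_)) fun s₂ hs₂ ⟨⟨hd₂, hem₂⟩, hreg₂, harr₂⟩ => ?_).mono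
        (T := startBlock.size + (((Program.seq emitVertex (.assign 6 (.load 16 (.reg 6)))).size + 2) *
          V.length + 2 + (3 + (((Program.seq emitEdge (.assign 6 (.load 18 (.reg 6)))).size + 2) *
          E.length + 2 + finishBlock.size)))) ?_ fun _ _ h => h
  · intro s hs hd _ hlen hcnt
    rw [Program.wp]
    refine emitVertex_wp hd.lab hd.ord hlen hcnt fun s' hreg harr hem => ?_
    simp only [Program.wp, Expr.Bounded, Expr.eval, true_and]
    refine ⟨hd.congr (by simp [hreg]) harr, ?_, ⟨?_, ?_, hem.before, hem.holds⟩⟩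
    · simp [harr, hd.vnext, hreg]
    · simpa using hem.pos
    · simpa using hem.count
  · rw [hem₁.pos, length_flatMap_vertexCode, length_flatMap_vertexCode]
    simp
    omega
  · rw [hem₁.count]
    simp
    omega
  · have e1 : startBlock.size ≤ 100 := by decide
    have e2 : (Program.seq emitVertex (.assign 6 (.load 16 (.reg 6)))).size + 2 ≤ 100 := by decide
    have e3 : (Program.seq emitEdge (.assign 6 (.load 18 (.reg 6)))).size + 2 ≤ 100 := by decide
    have e4 : finishBlock.size ≤ 100 := by decide
    have e5 := Nat.mul_le_mul_right V.length e2
    have e6 := Nat.mul_le_mul_right E.length e3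
    omega
  · have hem := hem₁.append hem₂
    rw [← List.flatMap_append, ← List.length_append, ← hwp] at hem
    have h15₂ := hem.pos
    have h16₂ := hem.count
    simp only [ne_eq, Nat.reduceEqDiff, not_false_eq_true, Function.update_of_ne,
      Function.update_self, length_flatMap_vertexCode, Nat.zero_add] at h15₂ h16₂
    have hwl : (withParent (P (lead (b + 1))) V).length ≤ V.length + 1 := length_withParent_le _ V
    have h3₂ : s₂.reg 3 = b + 1 := (hreg₂ 3 (by decide)).trans h3₁
    have h13₂ : s₂.reg 13 = s.reg 13 := (hreg₂ 13 (by decide)).trans h13₁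
    have h14₂ : s₂.reg 14 = pos := (hreg₂ 14 (by decide)).trans h14₁
    have h17₂ : s₂.reg 17 = 0 := (hreg₂ 17 (by decide)).trans h17₁
    refine Runs.seq (Runs.of_wp (Q := fun s' => s' = ⟨Function.update s₂.reg 6 (ehead (b + 1)),
      s₂.arr⟩) hs₂ (hW' _ (by decide)) (hM' _ (by decide)) ?_) ?_
    · simp only [Program.wp, Expr.Bounded, Expr.eval, true_and, hd₂.ehead, h3₂]
    · rintro s₃ hs₃ rfl
      refine Runs.seq (Runs.frame (emit_loop_runs (cnt := 17) (f := edgeCode A n) (Inv := D)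
        (D := fun a => a ≤ m) (next := enext) (L := E) (hW' _ (by decide)) (hM' _ (by decide)) ?_ hs₃
        (hd₂.congr ?_ fun _ _ => rfl) ?_ hEm ?_ ?_))
        fun s₄ hs₄ ⟨⟨hd₄, hem₄⟩, hreg₄, harr₄⟩ => Runs.of_wp hs₄ (hW' _ (by decide))
        (hM' _ (by decide)) ?_
      · intro s hs hd ha hlen hcnt
        rw [Program.wp]
        refine emitEdge_wp hd.num hd.input (by omega) hlen hcnt fun s' hreg harr hem => ?_
        simp only [Program.wp, Expr.Bounded, Expr.eval, true_and]
        refine ⟨hd.congr (by simp [hreg]) harr, ?_, ⟨?_, ?_, hem.before, hem.holds⟩⟩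
        · simp [harr, hd.enext, hreg]
        · simpa using hem.pos
        · simpa using hem.count
      · simp
      · simpa using hE
      · simp only [ne_eq, Nat.reduceEqDiff, not_false_eq_true, Function.update_of_ne,
          length_flatMap_edgeCode]
        omega
      · simp only [ne_eq, Nat.reduceEqDiff, not_false_eq_true, Function.update_of_ne]
        omega
      · have h14₄ : s₄.reg 14 = pos := (hreg₄ 14 (by decide)).trans (by simpa using h14₂)
        have h3₄ : s₄.reg 3 = b + 1 := (hreg₄ 3 (by decide)).trans (by simpa using h3₂)
        have h13₄ : s₄.reg 13 = s.reg 13 := (hreg₄ 13 (by decide)).trans (by simpa using h13₂)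
        have h16₄ : s₄.reg 16 = (withParent (P (lead (b + 1))) V).length :=
          (hreg₄ 16 (by decide)).trans (by simpa using h16₂)
        have h15₄ := hem₄.pos
        have h17₄ := hem₄.count
        simp only [ne_eq, Nat.reduceEqDiff, not_false_eq_true, Function.update_of_ne, h17₂,
          Nat.zero_add, h15₂, length_flatMap_edgeCode] at h15₄ h17₄
        have hb1 := hem.before
        have hh1 := hem.holds
        have hb2 := hem₄.before
        have hh2 := hem₄.holds
        simp only [ne_eq, Nat.reduceEqDiff, not_false_eq_true, Function.update_of_ne,
          Function.update_self, h15₂] at hb1 hh1 hb2 hh2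
        simp only [finishBlock, Program.wp, Expr.Bounded, Expr.eval, true_and, h14₄, h16₄, h17₄,
          Function.update_self]
        -- Filling in the two counts touches only the reserved cells, so the words written behind
        -- them survive.
        have hold : ∀ i, pos + 2 ≤ i → Function.update (Function.update (s₄.arr 1) pos
            (withParent (P (lead (b + 1))) V).length) (pos + 1) E.length i = s₄.arr 1 i := fun i hi => by
          rw [Function.update_of_ne (by omega), Function.update_of_ne (by omega)]
        refine ⟨hd₄.congr ?_ fun a ha => ?_, ?_, ?_, ?_, fun i hi => ?_, ?_, ?_, ?_⟩
        · simp
        · simp [ha]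
        · simpa using h3₄
        · simpa using h13₄
        · rw [length_blockCode, h15₄]
          omega
        · rw [Function.update_of_ne (by omega), Function.update_of_ne (by omega),
            hb2 i (by omega), hb1 i (by omega)]
        · rw [Function.update_of_ne (by omega), Function.update_self]
        · rw [Function.update_self]
        · refine ((hh1.congr fun i hi hi' => ?_).append ?_).congr fun i hi hi' => hold i hi
          · rw [length_flatMap_vertexCode] at hi'
            exact hb2 i (by omega)
          · rwa [length_flatMap_vertexCode]

/-- `R b` and `S b` count the vertices and edges in blocks with numbers above `b`. With the number
of remaining blocks they form the potential that pays for a block in proportion to its lists, so the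
total time is linear although single blocks may be large. -/
theorem emitBlocks_runs {s : State} (hM : 10 * (n + m + 1) ≤ M) (hW : 1000 * M ≤ W)
    (hs : s.Bdd M) (hd : OutputData n A lab ord P lead vhead vnext ehead enext s)
    (h3 : s.reg 3 = 0) (h13 : s.reg 13 = nb) (h14 : s.reg 14 = 1) (hnb : nb ≤ n)
    {V E : ℕ → List ℕ} {R S : ℕ → ℕ}
    (hV : ∀ b, b ≠ 0 → Follows vnext (vhead b) (V b))
    (hE : ∀ b, b ≠ 0 → Follows enext (ehead b) (E b)) (hEm : ∀ b, ∀ a ∈ E b, a ≤ m)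
    (hR : ∀ b, R b = (V (b + 1)).length + R (b + 1)) (hS : ∀ b, S b = (E (b + 1)).length + S (b + 1))
    (hR0 : R 0 ≤ n) (hS0 : S 0 ≤ m) :
    Runs W M emitBlocks s (1000 * (2 * n + m + 1) + 100) (fun s' => ∃ X : List ℕ,
      X = nb :: (List.range nb).flatMap
        (fun b => blockCode ord lab A n (withParent (P (lead (b + 1))) (V (b + 1))) (E (b + 1))) ∧
      s'.reg 0 = X.length ∧ HoldsAt (s'.arr 1) 0 X) := by
  set code := fun b => blockCode ord lab A n (withParent (P (lead (b + 1))) (V (b + 1))) (E (b + 1))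
    with hcode
  have hW' : ∀ d ≤ 1000, d * M ≤ W := fun d h => (Nat.mul_le_mul_right M h).trans hW
  have hM' : ∀ d ≤ 10, d ≤ M := fun d h => h.trans (by omega)
  -- The bound on the position reserves, for the blocks still to come, 4 cells each (two counts and
  -- the extra parent), 2 per listed vertex and 3 per edge. The initial position is 1, since cell 0
  -- is kept for the number of blocks.
  let Inv : ℕ → State → Prop := fun k s => ∃ b, b ≤ nb ∧ nb - b + R b + S b = k ∧
    OutputData n A lab ord P lead vhead vnext ehead enext s ∧ s.reg 3 = b ∧ s.reg 13 = nb ∧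
    s.reg 14 = 1 + ((List.range b).flatMap code).length ∧
    s.reg 14 + 4 * (nb - b) + 2 * R b + 3 * S b ≤ 1 + 4 * nb + 2 * n + 3 * m ∧
    HoldsAt (s.arr 1) 1 ((List.range b).flatMap code)
  refine (Runs.seq (Runs.loop (Inv := Inv) (B := 1000) (k := nb + R 0 + S 0) (hW' _ (by decide))
    (hM' _ (by decide)) (by decide) ?_ hs ?_) (fun s' hs' h => Runs.of_wp hs' (hW' _ (by decide))
    (hM' _ (by decide)) ?_)).mono ?_ fun _ _ h => h
  · rintro k s hs ⟨b, hb, rfl, hd, r3, r13, r14, hbound, hX⟩ hcond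
    simp only [Expr.eval, r3, r13] at hcond
    have hRb := hR b
    have hSb := hS b
    have hlen := length_withParent_le (P (lead (b + 1))) (V (b + 1))
    have hcl : (code b).length ≤ 4 + 2 * (V (b + 1)).length + 3 * (E (b + 1)).length := by
      rw [hcode]
      simp only [length_blockCode]
      omega
    refine ⟨_, nb - (b + 1) + R (b + 1) + S (b + 1), (emitBlock_runs hM hW hs hd r3 rfl (by omega)
      (hV _ (by omega)) (hE _ (by omega)) (hEm _) (by omega)).mono le_rfl ?_, ?_⟩
    · rintro s' hs' ⟨hd', q3, q13, q14, hbef, hold⟩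
      change s'.reg 14 = s.reg 14 + (code b).length at q14
      change HoldsAt (s'.arr 1) (s.reg 14) (code b) at hold
      have hsucc : (List.range (b + 1)).flatMap code = (List.range b).flatMap code ++ code b := by
        rw [List.range_succ, List.flatMap_append, List.flatMap_singleton]
      refine ⟨b + 1, by omega, rfl, hd', q3, q13.trans r13, ?_, by omega, ?_⟩
      · rw [hsucc, List.length_append]
        omega
      · rw [hsucc]
        refine (hX.congr fun i _ hi => hbef i (by omega)).append ?_
        rwa [← r14]
    · simp only [Expr.cost]
      omega
  · exact ⟨0, Nat.zero_le _, by omega, hd, h3, h13, by simpa using h14, by omega, trivial⟩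
  · obtain ⟨k, ⟨b, hb, rfl, hd, r3, r13, r14, hbound, hX⟩, hcond⟩ := h
    simp only [Expr.eval, r3, r13] at hcond
    obtain rfl : b = nb := by omega
    simp only [Program.wp, Expr.Bounded, Expr.eval, true_and]
    refine ⟨_, rfl, ?_, ?_, ?_⟩
    · simp only [Function.update_self, r14, List.length_cons]
      omega
    · simp [r13]
    · refine hX.congr fun i hi _ => ?_
      rw [Function.update_self, Function.update_of_ne (by omega)]
  · have e1 : (Program.seq (.store 1 (.const 0) (.reg 13)) (.assign 0 (.reg 14))).size ≤ 100 := by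
      decide
    omega

end

end RAM

/-! ### The analysis phase as a composition of passes. -/

namespace RAM

open RAM.Expr RAM.Program

/-- Computes the numbers of vertices and edges and the position of the first vertex. -/
def readSizes : Program :=
  .seq (.assign 1 (.load 0 (.const 0))) <|
  .seq (.assign 2 (.load 0 (.const 1))) (.assign 4 (.const 2))

/-- Goes back to the first edge. -/
def rewind : Program :=
  .seq (.assign 3 (.const 0)) (.assign 4 (.add (.const 2) (.add (.reg 1) (.reg 1))))

/-- Assigns the vertices and the edges to the blocks. -/
def analyze : Program :=
  .seq readSizes <|
  .seq readVertices <|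
  .seq rewind <|
  .seq readEdges <|
  .seq search <|
  .seq rewind <|
  .seq edgeLows <|
  .seq (.assign 3 (.reg 1)) <|
  .seq treeLows <|
  .seq assignBlocks <|
  .seq rewind assignEdges

/-- The result of the analysis. -/
structure Analyzed (I : SefeInstance ℕ) (n m : ℕ) (A : ℕ → ℕ) (s : State) : Prop where
  num : s.reg 1 = n
  input : s.arr 0 = A
  label : ∀ v < n, SefeInstance.IsLabel (v ∈ I.G₁.verts) (v ∈ I.G₂.verts) (s.arr 2 (v + 1))
  search : IsSearchNumbering I n (s.arr 7) (s.arr 8) (s.arr 9)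
  low_le : ∀ x y, I.union.Adj x y → s.arr 7 (x + 1) < s.arr 7 (y + 1) →
    s.arr 11 (s.arr 7 (y + 1)) ≤ s.arr 7 (x + 1)
  low_attained : ∀ k, k ≠ 0 → k ≤ n → LowAttained I (s.arr 7) (s.arr 9) (s.arr 11) k
  low_parent_le : ∀ k, k ≠ 0 → k ≤ n → s.arr 11 (s.arr 9 k) ≤ s.arr 11 k
  blocks : IsBlockState I.union (fun v => s.arr 7 (v + 1)) (s.arr 9) (s.arr 11) (s.arr 13)
    (s.arr 14) n (s.reg 13)
  vertices : IsBucket (s.arr 13) (s.arr 15) (s.arr 16) n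
  edges : IsBucket (s.arr 19) (s.arr 17) (s.arr 18) m
  edge_block : ∀ j < m, s.arr 19 (j + 1) = s.arr 13 (max (s.arr 7 (A (2 + 2 * n + 3 * j) + 1))
    (s.arr 7 (A (2 + 2 * n + 3 * j + 1) + 1)))

section

variable {I : SefeInstance ℕ} {n m : ℕ} {A : ℕ → ℕ} {W M : ℕ}

theorem rewind_wp {s : State} {Q : State → Prop} (h1 : s.reg 1 = n) (hM : 10 * (n + m + 1) ≤ M)
    (hQ : ∀ s' : State, s'.reg 3 = 0 → s'.reg 4 = 2 + 2 * n →
      (∀ x, x ≠ 3 → x ≠ 4 → s'.reg x = s.reg x) → s'.arr = s.arr → Q s') :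
    rewind.wp M Q s := by
  simp only [rewind, Program.wp, Expr.Bounded, Expr.eval, true_and]
  refine ⟨?_, hQ _ ?_ ?_ ?_ rfl⟩
  · simp [h1]
    omega
  · simp
  · simp [h1]
    omega
  · intro x h3 h4
    simp [h3, h4]

/-- The passes are composed by carrying facts about arrays through those that do not write to them.
Arrays not yet used are still zero, which supplies the initial conditions of the later passes. -/
theorem analyze_runs (hA : IsInput I n m A) (hM : 10 * (n + m + 1) ≤ M) (hW : 1000 * M ≤ W)
    {s : State} (hs : s.Bdd M) (h0 : s.arr 0 = A) (hreg : ∀ x, x ≠ 0 → s.reg x = 0)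
    (harr : ∀ a, a ≠ 0 → ∀ i, s.arr a i = 0) :
    Runs W M analyze s (10000 * (n + m + 1)) (Analyzed I n m A) := by
  have hW' : ∀ d ≤ 1000, d * M ≤ W := fun d h => (Nat.mul_le_mul_right M h).trans hW
  have hM' : ∀ d ≤ 10, d ≤ M := fun d h => h.trans (by omega)
  refine Runs.mono (T := readSizes.size + (1000 * (n + 1) + (rewind.size + (1000 * (m + 1) +
    (1000 * (2 * n + 4 * m + 1) + (rewind.size + (1000 * (m + 1) + (2 + (1000 * (n + 1) +
    (1000 * (n + 1) + (rewind.size + 1000 * (m + 1)))))))))))) ?_ ?_ fun _ _ h => h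
  swap
  · have e1 : readSizes.size ≤ 100 := by decide
    have e2 : rewind.size ≤ 100 := by decide
    omega
  refine Runs.seq (Runs.of_wp (Q := fun s' => s'.reg 1 = n ∧ s'.reg 2 = m ∧ s'.reg 4 = 2 ∧
    (∀ x, x ≠ 1 → x ≠ 2 → x ≠ 4 → s'.reg x = s.reg x) ∧ s'.arr = s.arr) hs (hW' _ (by decide))
    (hM' _ (by decide)) ?_) fun s₁ hs₁ ⟨n₁, m₁, p₁, reg₁, arr₁⟩ => ?_
  · simp only [readSizes, Program.wp, Expr.Bounded, Expr.eval, true_and]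
    refine ⟨?_, ?_, ?_, ?_, trivial⟩
    · simp [h0, hA.num_verts]
    · simp [h0, hA.num_edges]
    · simp
    · intro x h1 h2 h4
      simp [h1, h2, h4]
  have reg₁' : ∀ x, x ≠ 0 → x ≠ 1 → x ≠ 2 → x ≠ 4 → s₁.reg x = 0 := fun x a b c d =>
    (reg₁ x b c d).trans (hreg x a)
  have arr₁' : ∀ a, a ≠ 0 → ∀ i, s₁.arr a i = 0 := fun a ha i => by rw [arr₁, harr a ha]
  have in₁ : s₁.arr 0 = A := by rw [arr₁, h0]
  refine Runs.seq (Runs.frame (readVertices_runs hA hM hW hs₁ in₁ n₁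
    (reg₁' 3 (by decide) (by decide) (by decide) (by decide)) p₁
    (reg₁' 5 (by decide) (by decide) (by decide) (by decide))
    (reg₁' 6 (by decide) (by decide) (by decide) (by decide)) (arr₁' 6 (by decide))))
    fun s₂ hs₂ ⟨⟨p₂, q₂, lab₂, low₂, arc₂⟩, reg₂, arr₂⟩ => ?_
  have n₂ := (reg₂ 1 (by decide)).trans n₁
  have m₂ := (reg₂ 2 (by decide)).trans m₁
  have in₂ := (arr₂ 0 (by decide)).trans in₁
  refine Runs.seq (Runs.of_wp hs₂ (hW' _ (by decide)) (hM' _ (by decide))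
    (rewind_wp (Q := fun s' => s'.reg 3 = 0 ∧ s'.reg 4 = 2 + 2 * n ∧
      (∀ x, x ≠ 3 → x ≠ 4 → s'.reg x = s₂.reg x) ∧ s'.arr = s₂.arr) n₂ hM
      fun _ a b c d => ⟨a, b, c, d⟩)) fun s₃ hs₃ ⟨z₃, p₃, reg₃, arr₃⟩ => ?_
  have n₃ := (reg₃ 1 (by decide) (by decide)).trans n₂
  have m₃ := (reg₃ 2 (by decide) (by decide)).trans m₂
  have q₃ := (reg₃ 5 (by decide) (by decide)).trans q₂
  rw [← arr₃] at lab₂ low₂ arc₂ arr₂ in₂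
  refine Runs.seq (Runs.frame (readEdges_runs hA hM hW hs₃ in₂ m₃ z₃ p₃ q₃ arc₂))
    fun s₄ hs₄ ⟨arc₄, reg₄, arr₄⟩ => ?_
  have n₄ := (reg₄ 1 (by decide)).trans n₃
  have m₄ := (reg₄ 2 (by decide)).trans m₃
  have in₄ := (arr₄ 0 (by decide)).trans in₂
  have r₄ : ∀ x, x = 8 ∨ x = 9 ∨ x = 13 → s₄.reg x = 0 := by
    rintro x (rfl | rfl | rfl)
    all_goals
      rw [reg₄ _ (by decide), reg₃ _ (by decide) (by decide), reg₂ _ (by decide)]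
      exact reg₁' _ (by decide) (by decide) (by decide) (by decide)
  have arr₄' : ∀ a, a ∉ readVertices.arrs → a ∉ readEdges.arrs → a ≠ 0 → ∀ i, s₄.arr a i = 0 := by
    intro a h h' h0 i
    rw [arr₄ a h', arr₂ a h]
    exact arr₁' a h0 i
  rw [← arr₄ 2 (by decide)] at lab₂
  rw [← arr₄ 11 (by decide)] at low₂
  refine Runs.seq (Runs.frame (search_runs hA hM hW hs₄ (r₄ 8 (by decide)) (r₄ 9 (by decide))
    (arr₄' 7 (by decide) (by decide) (by decide)) (arr₄' 9 (by decide) (by decide) (by decide))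
    (arr₄' 10 (by decide) (by decide) (by decide)) arc₄)) fun s₅ hs₅ ⟨hS, reg₅, arr₅⟩ => ?_
  have n₅ := (reg₅ 1 (by decide)).trans n₄
  have m₅ := (reg₅ 2 (by decide)).trans m₄
  have in₅ := (arr₅ 0 (by decide)).trans in₄
  have c₅ := (reg₅ 13 (by decide)).trans (r₄ 13 (by decide))
  rw [← arr₅ 2 (by decide)] at lab₂
  rw [← arr₅ 11 (by decide)] at low₂
  refine Runs.seq (Runs.of_wp hs₅ (hW' _ (by decide)) (hM' _ (by decide))
    (rewind_wp (Q := fun s' => s'.reg 3 = 0 ∧ s'.reg 4 = 2 + 2 * n ∧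
      (∀ x, x ≠ 3 → x ≠ 4 → s'.reg x = s₅.reg x) ∧ s'.arr = s₅.arr) n₅ hM
      fun _ a b c d => ⟨a, b, c, d⟩)) fun s₆ hs₆ ⟨z₆, p₆, reg₆, arr₆⟩ => ?_
  have n₆ := (reg₆ 1 (by decide) (by decide)).trans n₅
  have m₆ := (reg₆ 2 (by decide) (by decide)).trans m₅
  have c₆ := (reg₆ 13 (by decide) (by decide)).trans c₅
  rw [← arr₆] at in₅ hS lab₂ low₂ arr₅
  have arr₆' : ∀ a, a ∉ readVertices.arrs → a ∉ readEdges.arrs → a ∉ search.arrs → a ≠ 0 →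
      ∀ i, s₆.arr a i = 0 := by
    intro a h h' h'' h0 i
    rw [arr₅ a h'']
    exact arr₄' a h h' h0 i
  refine Runs.seq (Runs.frame (edgeLows_runs hA hS hM hW hs₆ in₅ rfl m₆ z₆ p₆ low₂
    (arr₆' 12 (by decide) (by decide) (by decide) (by decide))))
    fun s₇ hs₇ ⟨⟨low₇, att₇, has₇⟩, reg₇, arr₇⟩ => ?_
  have n₇ := (reg₇ 1 (by decide)).trans n₆
  have m₇ := (reg₇ 2 (by decide)).trans m₆
  have c₇ := (reg₇ 13 (by decide)).trans c₆
  have in₇ := (arr₇ 0 (by decide)).trans in₅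
  rw [← arr₇ 2 (by decide)] at lab₂
  rw [← arr₇ 7 (by decide)] at low₇ att₇ has₇ hS
  rw [← arr₇ 9 (by decide)] at att₇ hS
  rw [← arr₇ 8 (by decide)] at hS
  refine Runs.seq (Runs.of_wp (Q := fun s' => s'.reg 3 = n ∧
    (∀ x, x ≠ 3 → s'.reg x = s₇.reg x) ∧ s'.arr = s₇.arr) hs₇ (hW' _ (by decide))
    (hM' _ (by decide)) ?_) fun s₈ hs₈ ⟨z₈, reg₈, arr₈⟩ => ?_
  · simp only [Program.wp, Expr.Bounded, Expr.eval, true_and]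
    refine ⟨?_, fun x hx => ?_, trivial⟩
    · simp [n₇]
    · simp [hx]
  have n₈ := (reg₈ 1 (by decide)).trans n₇
  have m₈ := (reg₈ 2 (by decide)).trans m₇
  have c₈ := (reg₈ 13 (by decide)).trans c₇
  rw [← arr₈] at in₇ lab₂ low₇ att₇ has₇ hS arr₇
  refine Runs.seq (Runs.frame (treeLows_runs hS hM hW hs₈ rfl z₈ low₇ att₇))
    fun s₉ hs₉ ⟨⟨z₉, low₉, att₉, par₉⟩, reg₉, arr₉⟩ => ?_
  have n₉ := (reg₉ 1 (by decide)).trans n₈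
  have m₉ := (reg₉ 2 (by decide)).trans m₈
  have c₉ := (reg₉ 13 (by decide)).trans c₈
  have in₉ := (arr₉ 0 (by decide)).trans in₇
  rw [← arr₉ 2 (by decide)] at lab₂
  rw [← arr₉ 7 (by decide)] at low₉ att₉ has₇ hS
  rw [← arr₉ 9 (by decide)] at att₉ hS par₉
  rw [← arr₉ 8 (by decide)] at hS
  rw [← arr₉ 12 (by decide)] at has₇
  have arr₉' : ∀ a, a ∉ readVertices.arrs → a ∉ readEdges.arrs → a ∉ search.arrs →
      a ∉ edgeLows.arrs → a ∉ treeLows.arrs → a ≠ 0 → ∀ i, s₉.arr a i = 0 := by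
    intro a h1 h2 h3 h4 h5 h0 i
    rw [arr₉ a h5, arr₇ a h4]
    exact arr₆' a h1 h2 h3 h0 i
  refine Runs.seq (Runs.frame (assignBlocks_runs hS hM hW hs₉ rfl rfl n₉ z₉ c₉ has₇
    (arr₉' 15 (by decide) (by decide) (by decide) (by decide) (by decide) (by decide))))
    fun t₁ ht₁ ⟨⟨blk₁, vlist⟩, reg₁, arr₁⟩ => ?_
  have k₁ := (reg₁ 1 (by decide)).trans n₉
  have m₁ := (reg₁ 2 (by decide)).trans m₉
  have in₁ := (arr₁ 0 (by decide)).trans in₉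
  rw [← arr₁ 2 (by decide)] at lab₂
  rw [← arr₁ 7 (by decide)] at low₉ att₉ hS blk₁
  rw [← arr₁ 9 (by decide)] at att₉ hS par₉ blk₁
  rw [← arr₁ 8 (by decide)] at hS
  rw [← arr₁ 11 (by decide)] at low₉ att₉ par₉ blk₁
  have hd : ∀ i, t₁.arr 17 i = 0 := fun i => by
    rw [arr₁ 17 (by decide)]
    exact arr₉' 17 (by decide) (by decide) (by decide) (by decide) (by decide) (by decide) i
  refine Runs.seq (Runs.of_wp ht₁ (hW' _ (by decide)) (hM' _ (by decide))
    (rewind_wp (Q := fun s' => s'.reg 3 = 0 ∧ s'.reg 4 = 2 + 2 * n ∧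
      (∀ x, x ≠ 3 → x ≠ 4 → s'.reg x = t₁.reg x) ∧ s'.arr = t₁.arr) k₁ hM
      fun _ a b c d => ⟨a, b, c, d⟩)) fun t₂ ht₂ ⟨z₂, p₂, reg₂, arr₂⟩ => ?_
  have k₂ := (reg₂ 1 (by decide) (by decide)).trans k₁
  have m₂ := (reg₂ 2 (by decide) (by decide)).trans m₁
  rw [← reg₂ 13 (by decide) (by decide)] at blk₁
  rw [← arr₂] at in₁ lab₂ low₉ att₉ par₉ hS hd blk₁ vlist
  refine (Runs.frame (assignEdges_runs hM hW ht₂ in₁ rfl m₂ z₂ p₂ hd)).mono le_rfl ?_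
  rintro t₃ - ⟨⟨elist, key⟩, reg₃, arr₃⟩
  rw [← arr₃ 2 (by decide)] at lab₂
  rw [← arr₃ 7 (by decide)] at low₉ att₉ hS blk₁ key
  rw [← arr₃ 9 (by decide)] at att₉ hS par₉ blk₁
  rw [← arr₃ 8 (by decide)] at hS
  rw [← arr₃ 11 (by decide)] at low₉ att₉ par₉ blk₁
  rw [← arr₃ 13 (by decide)] at blk₁ vlist key
  rw [← arr₃ 14 (by decide), ← reg₃ 13 (by decide)] at blk₁
  rw [← arr₃ 15 (by decide), ← arr₃ 16 (by decide)] at vlist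
  exact ⟨(reg₃ 1 (by decide)).trans k₂, (arr₃ 0 (by decide)).trans in₁, lab₂, hS, low₉, att₉, par₉,
    blk₁, vlist, elist, key⟩

end

end RAM

/-! ### Codes of instances -/

theorem HoldsAt.left {f : ℕ → ℕ} {p : ℕ} {X Y : List ℕ} (h : HoldsAt f p (X ++ Y)) :
    HoldsAt f p X := by
  induction X generalizing p with
  | nil => trivial
  | cons a X ih => exact ⟨h.1, ih h.2⟩

theorem HoldsAt.right {f : ℕ → ℕ} {p : ℕ} {X Y : List ℕ} (h : HoldsAt f p (X ++ Y)) :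
    HoldsAt f (p + X.length) Y := by
  induction X generalizing p with
  | nil => exact h
  | cons a X ih =>
    rw [List.length_cons, Nat.add_comm X.length, ← Nat.add_assoc]
    exact ih h.2

theorem holdsAt_getD (w : List ℕ) : HoldsAt (fun i => w.getD i 0) 0 w := by
  suffices ∀ u v : List ℕ, HoldsAt (fun i => (u ++ v).getD i 0) u.length v from this [] w
  intro u v
  induction v generalizing u with
  | nil => trivial
  | cons a v ih =>
    refine ⟨by simp, ?_⟩
    simpa using ih (u ++ [a])

theorem HoldsAt.flatMap_pair {f : ℕ → ℕ} {p : ℕ} {vs : List (ℕ × ℕ)}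
    (h : HoldsAt f p (vs.flatMap fun a => [a.1, a.2])) (i : ℕ) (hi : i < vs.length) :
    f (p + 2 * i) = vs[i].1 ∧ f (p + 2 * i + 1) = vs[i].2 := by
  induction vs generalizing p i with
  | nil => exact absurd hi (Nat.not_lt_zero i)
  | cons a vs ih =>
    obtain ⟨h1, h2, h3⟩ := h
    cases i with
    | zero => exact ⟨h1, h2⟩
    | succ i =>
      have := ih h3 i (Nat.lt_of_succ_lt_succ hi)
      rwa [show p + 2 * (i + 1) = p + 1 + 1 + 2 * i by omega]

theorem HoldsAt.flatMap_triple {f : ℕ → ℕ} {p : ℕ} {es : List (ℕ × ℕ × ℕ)}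
    (h : HoldsAt f p (es.flatMap fun a => [a.1, a.2.1, a.2.2])) (i : ℕ) (hi : i < es.length) :
    f (p + 3 * i) = es[i].1 ∧ f (p + 3 * i + 1) = es[i].2.1 ∧ f (p + 3 * i + 2) = es[i].2.2 := by
  induction es generalizing p i with
  | nil => exact absurd hi (Nat.not_lt_zero i)
  | cons a es ih =>
    obtain ⟨h1, h2, h3, h4⟩ := h
    cases i with
    | zero => exact ⟨h1, h2, h3⟩
    | succ i =>
      have := ih h4 i (Nat.lt_of_succ_lt_succ hi)
      rwa [show p + 3 * (i + 1) = p + 1 + 1 + 1 + 3 * i by omega]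

theorem SefeInstance.IsLabel.le {p q : Prop} {ℓ : ℕ} (h : SefeInstance.IsLabel p q ℓ) :
    ℓ ≤ 3 := by
  rcases h with ⟨-, -, rfl⟩ | ⟨-, -, rfl⟩ | ⟨-, -, rfl⟩ <;> omega

theorem SefeInstance.IsLabel.congr {p q p' q' : Prop} {ℓ : ℕ} (h : SefeInstance.IsLabel p q ℓ)
    (hp : p' ↔ p) (hq : q' ↔ q) : SefeInstance.IsLabel p' q' ℓ := by
  rwa [SefeInstance.IsLabel, hp, hq]

/-- The entries of a code are counts, names below `n` and labels up to 3, so they are linear in its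
length; this bounds the initial memory. -/
theorem SefeInstance.IsCode.exists_isInput {I : SefeInstance ℕ} {n : ℕ} {w : List ℕ}
    (hI : I.union.verts = {v | v < n}) (hw : I.IsCode w) :
    ∃ m, IsInput I n m (fun i => w.getD i 0) ∧ n + m ≤ w.length ∧ ∀ a ∈ w, a ≤ w.length + 3 := by
  obtain ⟨vs, es, hwe, hvn, hv, hvl, hen, he, hel⟩ := hw
  have hmem : ∀ a ∈ vs, a.1 < n := fun a ha => by
    have : a.1 ∈ I.union.verts := (hvl a ha).or
    rwa [hI] at this
  have hadj : ∀ a ∈ es, I.union.Adj a.1 a.2.1 := fun a ha => (hel a ha).or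
  have hlt : ∀ v ∈ I.union.verts, v < n := fun v hv => by rwa [hI] at hv
  -- The listed names are distinct and are exactly the numbers below `n`, so the vertex list is a
  -- permutation of the range.
  have hlen : vs.length = n := by
    have : (vs.map (fun a => a.1)).Perm (List.range n) := by
      refine (List.perm_ext_iff_of_nodup hvn List.nodup_range).2 fun v => ?_
      rw [List.mem_map, List.mem_range]
      constructor
      · rintro ⟨a, ha, rfl⟩
        exact hmem a ha
      · intro h
        obtain ⟨a, ha, rfl⟩ := hv v (by rwa [hI])
        exact ⟨a, ha, rfl⟩
    simpa using this.length_eq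
  have hfl : (vs.flatMap fun a => [a.1, a.2]).length = 2 * n := by
    simp [hlen, Nat.mul_comm]
  have hel' : (es.flatMap fun a => [a.1, a.2.1, a.2.2]).length = 3 * es.length := by
    simp [Nat.mul_comm]
  have hwl : w.length = 2 + 2 * n + 3 * es.length := by
    rw [hwe, List.length_cons, List.length_cons, List.length_append, hfl, hel']
    omega
  have hold := holdsAt_getD w
  set A := fun i => w.getD i 0 with hA
  rw [hwe] at hold
  obtain ⟨h0, h1, hold⟩ := hold
  have hV := hold.left.flatMap_pair
  have hE := hold.right.flatMap_triple
  rw [hfl] at hE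
  refine ⟨es.length, ⟨hI, h0.trans hlen, h1, ?_, ?_, ?_, ?_, ?_⟩, by omega, ?_⟩
  · intro i hi
    rw [← hlen] at hi
    rw [(hV i hi).1, (hV i hi).2]
    exact hvl _ (List.getElem_mem hi)
  · intro v hvn
    obtain ⟨a, ha, rfl⟩ := hv v (by rwa [hI])
    obtain ⟨i, hi, rfl⟩ := List.getElem_of_mem ha
    exact ⟨i, by rwa [← hlen], (hV i hi).1⟩
  · intro j hj
    obtain ⟨e1, e2, e3⟩ := hE j hj
    rw [e1, e2, e3]
    exact hel _ (List.getElem_mem hj)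
  · intro u v huv
    obtain ⟨a, ha, hav⟩ := he s(u, v) huv
    obtain ⟨j, hj, rfl⟩ := List.getElem_of_mem ha
    obtain ⟨e1, e2, -⟩ := hE j hj
    exact ⟨j, hj, by rw [e1, e2]; exact hav⟩
  · intro i hi j hj hij
    obtain ⟨e1, e2, -⟩ := hE i hi
    obtain ⟨e3, e4, -⟩ := hE j hj
    rw [e1, e2, e3, e4] at hij
    refine (hen.getElem_inj_iff (hi := by simpa using hi) (hj := by simpa using hj)).1 ?_
    simpa using hij
  · intro a ha
    rw [hwe, List.mem_cons, List.mem_cons, List.mem_append, List.mem_flatMap, List.mem_flatMap] at ha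
    rcases ha with rfl | rfl | ⟨b, hb, hab⟩ | ⟨b, hb, hab⟩
    · omega
    · omega
    · have h1 := hmem b hb
      have h2 := (hvl b hb).le
      simp only [List.mem_cons, List.not_mem_nil, or_false] at hab
      omega
    · have h1 := hlt _ (hadj b hb).fst_mem
      have h2 := hlt _ (hadj b hb).snd_mem
      have h3 := (hel b hb).le
      simp only [List.mem_cons, List.not_mem_nil, or_false] at hab
      omega

/-- The items with key above `b` are those with key `b + 1` and those with a larger one. This is the
recursion required of the remaining amounts in `RAM.emitBlocks_runs`. -/
theorem card_filter_lt_key {key : ℕ → ℕ} {k b : ℕ} {L : List ℕ} (hL : L.Nodup)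
    (hmem : ∀ a, a ∈ L ↔ a ≠ 0 ∧ a ≤ k ∧ key a = b + 1) :
    ((Finset.Icc 1 k).filter fun a => b < key a).card =
      L.length + ((Finset.Icc 1 k).filter fun a => b + 1 < key a).card := by
  rw [← List.toFinset_card_of_nodup hL, ← Finset.card_union_of_disjoint]
  · congr 1
    ext a
    simp only [Finset.mem_filter, Finset.mem_Icc, Finset.mem_union, List.mem_toFinset, hmem]
    omega
  · rw [Finset.disjoint_left]
    intro a ha ha'
    rw [List.mem_toFinset, hmem] at ha
    rw [Finset.mem_filter] at ha'
    omega

/-! ### The complete program and the correctness of its output. -/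

namespace RAM

open RAM.Expr RAM.Program

/-- The list `L` consists of the items `1, …, k` with key `b`. -/
structure Lists (key : ℕ → ℕ) (k b : ℕ) (L : List ℕ) : Prop where
  nodup : L.Nodup
  mem_iff : ∀ a, a ∈ L ↔ a ≠ 0 ∧ a ≤ k ∧ key a = b

/-- Splits an instance of SEFE at its union cutvertices. -/
def splitBlocks : Program :=
  .seq analyze <|
  .seq (.seq (.assign 3 (.const 0)) (.assign 14 (.const 1))) emitBlocks

section

variable {I : SefeInstance ℕ} {n m : ℕ} {A : ℕ → ℕ} {W M : ℕ}

theorem splitBlocks_runs (hA : IsInput I n m A) (hM : 10 * (n + m + 1) ≤ M) (hW : 1000 * M ≤ W)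
    {s : State} (hs : s.Bdd M) (h0 : s.arr 0 = A) (hreg : ∀ x, x ≠ 0 → s.reg x = 0)
    (harr : ∀ a, a ≠ 0 → ∀ i, s.arr a i = 0) :
    Runs W M splitBlocks s (15000 * (n + m + 1)) (fun s' => ∃ t, Analyzed I n m A t ∧
      ∃ V E : ℕ → List ℕ, (∀ b, Lists (t.arr 13) n b (V b)) ∧ (∀ b, Lists (t.arr 19) m b (E b)) ∧
      ∃ X : List ℕ, X = t.reg 13 :: (List.range (t.reg 13)).flatMap (fun b =>
        blockCode (t.arr 8) (t.arr 2) A n (withParent (t.arr 9 (t.arr 14 (b + 1))) (V (b + 1)))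
          (E (b + 1))) ∧ s'.reg 0 = X.length ∧ HoldsAt (s'.arr 1) 0 X) := by
  have hW' : ∀ d ≤ 1000, d * M ≤ W := fun d h => (Nat.mul_le_mul_right M h).trans hW
  have hM' : ∀ d ≤ 10, d ≤ M := fun d h => h.trans (by omega)
  refine Runs.mono (T := 10000 * (n + m + 1) + (4 + (1000 * (2 * n + m + 1) + 100))) ?_ (by omega)
    fun _ _ h => h
  refine Runs.seq (analyze_runs hA hM hW hs h0 hreg harr) fun t ht h => ?_
  refine Runs.seq (Runs.of_wp (Q := fun s' => s'.reg 3 = 0 ∧ s'.reg 14 = 1 ∧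
    s'.reg 13 = t.reg 13 ∧ s'.reg 1 = t.reg 1 ∧ s'.arr = t.arr) ht (hW' _ (by decide))
    (hM' _ (by decide)) ?_) fun t' ht' ⟨h3, h14, h13, h1, ha⟩ => ?_
  · simp [Program.wp, Expr.Bounded, Expr.eval]
  choose V hV hVn hVm using h.vertices.exists_follows
  choose E hE hEn hEm using h.edges.exists_follows
  -- Each vertex and each edge has a single key, so the lists of all blocks together have at most
  -- `n` and `m` entries. The parents of opening vertices are paid for separately, one for each
  -- block.
  refine (emitBlocks_runs (V := V) (E := E) (m := m) (nb := t.reg 13)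
    (R := fun b => ((Finset.Icc 1 n).filter fun a => b < t.arr 13 a).card)
    (S := fun b => ((Finset.Icc 1 m).filter fun a => b < t.arr 19 a).card) hM hW ht'
    ⟨h1.trans h.num, by rw [ha, h.input], by rw [ha], by rw [ha], by rw [ha], by rw [ha],
      by rw [ha], by rw [ha], by rw [ha], by rw [ha]⟩ h3 h13 h14 h.blocks.nb_le
    (fun b _ => hV b) (fun b _ => hE b) (fun b a hab => ((hEm b a).1 hab).2.1)
    (fun b => card_filter_lt_key (hVn _) (hVm _))
    (fun b => card_filter_lt_key (hEn _) (hEm _)) ?_ ?_).mono le_rfl ?_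
  · simpa using Finset.card_filter_le (Finset.Icc 1 n) fun a => 0 < t.arr 13 a
  · simpa using Finset.card_filter_le (Finset.Icc 1 m) fun a => 0 < t.arr 19 a
  · intro s' _ h'
    exact ⟨t, h, V, E, fun b => ⟨hVn b, hVm b⟩, fun b => ⟨hEn b, hEm b⟩, h'⟩

namespace Analyzed

variable {s : State} (hA : IsInput I n m A) (h : Analyzed I n m A s)

include hA h

/-- The search works on nodes `v + 1`, since 0 is its artificial root; vertices therefore get the
number of the shifted node. -/
theorem isBlockNumbering : IsBlockNumbering I.union n (s.reg 13) (fun v => s.arr 7 (v + 1))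
    (s.arr 9) (s.arr 11) (s.arr 13) (s.arr 14) := by
  have hS := h.search
  have hnum : ∀ v ∈ I.union.verts, s.arr 7 (v + 1) ≠ 0 := fun v hv =>
    hS.num_ne_zero _ (by omega) (hA.lt_of_mem hv)
  refine ⟨?_, hnum, fun v _ => hS.num_le _, ?_, hS.parent_lt, hS.parent_zero, ?_, ?_, h.low_le, ?_,
    h.low_attained, h.blocks.lead_spec, h.blocks.lead_blk, h.blocks.blk_root,
    h.blocks.blk_eq_parent⟩
  · intro u hu v hv huv
    have h1 := hS.ord_num _ (hnum u hu)
    have h2 := hS.ord_num _ (hnum v hv)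
    simp only at huv
    rw [huv] at h1
    omega
  · intro k hk0 hk
    obtain ⟨h1, h2⟩ := hS.ord_mem k hk0 hk
    refine ⟨s.arr 8 k - 1, ?_, ?_⟩
    · rw [hA.verts_eq]
      change s.arr 8 k - 1 < n
      omega
    · rw [Nat.sub_add_cancel (by omega), hS.num_ord k hk0 hk]
  · intro v hv hP
    obtain ⟨y, hy0, hy, hadj⟩ := hS.tree_adj (v + 1) (hnum v hv) hP
    refine ⟨y - 1, ?_, hadj⟩
    rw [Nat.sub_add_cancel (by omega), hy]
  · intro u v huv hlt
    rcases hS.comparable u v huv with ha | ha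
    · exact ha
    · have hP : ∀ k, s.arr 9 k ≤ k := fun k => by
        rcases eq_or_ne k 0 with rfl | hk
        · exact hS.parent_zero.le
        · exact (hS.parent_lt k hk).le
      exact absurd (ha.le hP) (by simpa using hlt)
  · intro k hk0 hk _
    exact h.low_parent_le k hk0 hk

/-- The vertex list of the block with the added parent, and its edge list, enumerate exactly the
subgraph `block b`. Labels are copied from the input, because restriction to the block preserves
membership in the two graphs. -/
theorem isCode_block {b : ℕ} (hb0 : b ≠ 0) (hb : b ≤ s.reg 13) {V E : List ℕ}
    (hV : Lists (s.arr 13) n b V) (hE : Lists (s.arr 19) m b E) :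
    (I.restrict ((h.isBlockNumbering hA).block b)).IsCode
      (blockCode (s.arr 8) (s.arr 2) A n (withParent (s.arr 9 (s.arr 14 b)) V) E) := by
  have hN := h.isBlockNumbering hA
  have hS := h.search
  set B := hN.block b with hB
  obtain ⟨hl0, hln, -, -⟩ := hN.lead_spec b hb0 hb
  have hPl := hN.parent_lt _ hl0
  set p := s.arr 9 (s.arr 14 b) with hp
  have hmem : ∀ k, k ∈ withParent p V ↔ k ≠ 0 ∧ k ≤ n ∧ (s.arr 13 k = b ∨ k = p) := by
    intro k
    rw [withParent, List.mem_append, hV.mem_iff]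
    split_ifs with hp0
    · rw [hp0]
      simp only [List.not_mem_nil, false_or]
      omega
    · simp only [List.mem_singleton]
      omega
  have hnodup : (withParent p V).Nodup := by
    rw [withParent]
    split_ifs with hp0
    · exact hV.nodup
    -- The added parent is not in the list already: a vertex with block number `b` descends from the
    -- opening vertex, whereas the parent has a smaller number.
    · refine List.nodup_cons.2 ⟨fun hpV => ?_, hV.nodup⟩
      have hpb := ((hV.mem_iff p).1 hpV).2.2
      have := (hN.lead_ancestor hp0 (by omega) (by rwa [hpb])).1.le hN.parent_le
      rw [hpb] at this
      omega
  have hvert : ∀ k ∈ withParent p V, s.arr 8 k ≠ 0 ∧ s.arr 8 k ≤ n ∧ s.arr 8 k - 1 ∈ B.verts := by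
    intro k hk
    obtain ⟨hk0, hkn, hkb⟩ := (hmem k).1 hk
    obtain ⟨ho0, hon⟩ := hS.ord_mem k hk0 hkn
    refine ⟨ho0, hon, ?_, ?_⟩
    · rw [hA.verts_eq]
      change s.arr 8 k - 1 < n
      omega
    · simp only [Nat.sub_add_cancel (Nat.one_le_iff_ne_zero.2 ho0), hS.num_ord k hk0 hkn]
      exact hkb
  -- Edges are numbered from 1 because 0 ends the linked lists, so edge `j = i + 1` starts at the
  -- cell `2 + 2 * n + 3 * i = 2 * n + 3 * j - 1`.
  have hedge : ∀ j ∈ E, ∃ i < m, j = i + 1 ∧ 2 * n + 3 * j - 1 = 2 + 2 * n + 3 * i ∧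
      B.Adj (A (2 + 2 * n + 3 * i)) (A (2 + 2 * n + 3 * i + 1)) := by
    intro j hj
    obtain ⟨hj0, hjm, hjb⟩ := (hE.mem_iff j).1 hj
    obtain ⟨i, rfl⟩ := Nat.exists_eq_succ_of_ne_zero hj0
    refine ⟨i, hjm, rfl, by omega, hA.adj hjm, ?_⟩
    rw [← hjb, h.edge_block i hjm]
  have hU : (I.restrict B).union = B := SefeInstance.union_restrict (hN.block_le b)
  refine ⟨(withParent p V).map fun k => (s.arr 8 k - 1, s.arr 2 (s.arr 8 k)),
    E.map fun j => (A (2 * n + 3 * j - 1), A (2 * n + 3 * j - 1 + 1), A (2 * n + 3 * j - 1 + 2)),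
    ?_, ?_, ?_, ?_, ?_, ?_, ?_⟩
  · rw [List.length_map, List.length_map, List.flatMap_map, List.flatMap_map]
    rfl
  · rw [List.map_map]
    refine hnodup.map_on fun k hk k' hk' hkk => ?_
    simp only [Function.comp_apply] at hkk
    have h1 := (hmem k).1 hk
    have h2 := (hmem k').1 hk'
    rw [← hS.num_ord k h1.1 h1.2.1, ← hS.num_ord k' h2.1 h2.2.1]
    have h3 := (hvert k hk).1
    have h4 := (hvert k' hk').1
    congr 1
    omega
  · rw [hU]
    rintro v ⟨hv, hvb⟩
    have hv0 := hN.num_ne_zero v hv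
    refine ⟨_, List.mem_map.2 ⟨s.arr 7 (v + 1), (hmem _).2 ⟨hv0, hS.num_le _, hvb⟩, rfl⟩, ?_⟩
    simp only [hS.ord_num _ hv0, Nat.add_sub_cancel]
  · intro a ha
    obtain ⟨k, hk, rfl⟩ := List.mem_map.1 ha
    obtain ⟨h1, h2, h3⟩ := hvert k hk
    have := h.label (s.arr 8 k - 1) (by omega)
    rw [Nat.sub_add_cancel (by omega)] at this
    exact this.congr (and_iff_left h3) (and_iff_left h3)
  · rw [List.map_map]
    refine hE.nodup.map_on fun j hj j' hj' hjj => ?_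
    obtain ⟨i, hi, rfl, he, -⟩ := hedge j hj
    obtain ⟨i', hi', rfl, he', -⟩ := hedge j' hj'
    simp only [Function.comp_apply, he, he'] at hjj
    rw [hA.edge_inj i hi i' hi' hjj]
  · rw [hU]
    intro e
    induction e using Sym2.ind with
    | _ u v =>
    rintro ⟨huv, hb⟩
    obtain ⟨i, hi, hiuv⟩ := hA.exists_edge u v huv
    refine ⟨_, List.mem_map.2 ⟨i + 1, (hE.mem_iff _).2 ⟨by omega, hi, ?_⟩, rfl⟩, ?_⟩
    · rw [h.edge_block i hi, ← hb]
      rcases Sym2.eq_iff.1 hiuv with ⟨h1, h2⟩ | ⟨h1, h2⟩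
      · rw [h1, h2]
      · rw [h1, h2, max_comm]
    · simp only [show 2 * n + 3 * (i + 1) - 1 = 2 + 2 * n + 3 * i by omega]
      exact hiuv
  · intro a ha
    obtain ⟨j, hj, rfl⟩ := List.mem_map.1 ha
    obtain ⟨i, hi, rfl, he, hBadj⟩ := hedge j hj
    simp only [he]
    exact (hA.edge_label i hi).congr (and_iff_left hBadj) (and_iff_left hBadj)

end Analyzed

end

end RAM

theorem mainTheorem5 :
    ∃ (c : RAM.Program) (K : ℕ), ∀ (I : SefeInstance ℕ) (n : ℕ) (w : List ℕ),
      I.union.verts = {v | v < n} → I.IsCode w →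
      ∃ (w' : List ℕ) (Js : List (SefeInstance ℕ)),
        RAM.OutputsWithin K c w w' ∧
        w'.length ≤ K * (w.length + 1) ∧
        SefeInstance.IsListCode Js w' ∧
        Js.Nodup ∧
        (∀ J, J ∈ Js ↔ ∃ B, IsBlock I.union B ∧ J = I.restrict B) ∧
        (∀ J ∈ Js, ∀ v, ¬ IsCutvertex J.union v) ∧
        (I.AdmitsSefe ↔ ∀ J ∈ Js, J.AdmitsSefe) := by
  -- The constant is that of the running time; as `n + m` is at most the input length, it suffices.
  -- It also leaves room for temporaries up to `1000 * M` with `M = 10 * (w.length + 1)`.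
  refine ⟨RAM.splitBlocks, 15000, fun I n w hI hw => ?_⟩
  obtain ⟨m, hA, hlen, hle⟩ := hw.exists_isInput hI
  have hinit : (RAM.init w).Bdd (10 * (w.length + 1)) := by
    refine ⟨fun x => ?_, fun a i => ?_⟩
    · simp only [RAM.init]
      split_ifs <;> omega
    · simp only [RAM.init]
      split_ifs
      · by_cases hi : i < w.length
        · have := hle _ (List.getElem_mem hi)
          rw [List.getD_eq_getElem _ _ hi]
          omega
        · rw [List.getD_eq_default _ _ (not_lt.1 hi)]
          omega
      · omega
  obtain ⟨t, s', hexec, ht, hs', s, hs, V, E, hV, hE, X, hX, hX0, hX1⟩ :=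
    RAM.splitBlocks_runs (W := 15000 * (w.length + 1)) (M := 10 * (w.length + 1)) hA (by omega)
      (by omega) hinit (by funext i; simp [RAM.init]) (fun x hx => by simp [RAM.init, hx])
      (fun a ha i => by simp [RAM.init, ha])
  have hN := hs.isBlockNumbering hA
  have hJs : ∀ J, J ∈ (List.range (s.reg 13)).map (fun b => I.restrict (hN.block (b + 1))) ↔
      ∃ B, IsBlock I.union B ∧ J = I.restrict B := by
    intro J
    simp only [List.mem_map, List.mem_range, hN.isBlock_iff]
    constructor
    · rintro ⟨b, hb, rfl⟩
      exact ⟨_, ⟨b + 1, by omega, hb, rfl⟩, rfl⟩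
    · rintro ⟨_, ⟨b, hb0, hb, rfl⟩, rfl⟩
      obtain ⟨b, rfl⟩ := Nat.exists_eq_succ_of_ne_zero hb0
      exact ⟨b, hb, rfl⟩
  refine ⟨X, (List.range (s.reg 13)).map fun b => I.restrict (hN.block (b + 1)),
    ⟨t, s', hexec, by omega, ?_⟩, ?_, ?_, ?_, hJs, ?_, ?_⟩
  · rw [RAM.output, hX0]
    exact hX1.map_range
  -- The output length stands in a register of the final state, so the bound on stored numbers
  -- bounds it as well.
  · rw [← hX0]
    exact (hs'.1 0).trans (by omega)
  · refine ⟨(List.range (s.reg 13)).map fun b => RAM.blockCode (s.arr 8) (s.arr 2)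
      (fun i => w.getD i 0) n
      (RAM.withParent (s.arr 9 (s.arr 14 (b + 1))) (V (b + 1))) (E (b + 1)), ?_, ?_⟩
    · rw [hX, List.length_map, List.length_range, List.flatMap_def]
    · rw [List.forall₂_map_left_iff, List.forall₂_map_right_iff, List.forall₂_same]
      intro b hb
      exact hs.isCode_block hA (by omega) (List.mem_range.1 hb) (hV _) (hE _)
  -- The union graph of the restricted instance is the block itself, so different blocks give
  -- different instances.
  · refine List.nodup_range.map_on fun b hb b' hb' hbb => ?_
    have := congrArg SefeInstance.union hbb
    rw [SefeInstance.union_restrict (hN.block_le _),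
      SefeInstance.union_restrict (hN.block_le _)] at this
    have := hN.eq_of_block_le (by omega) (List.mem_range.1 hb) (by omega) (List.mem_range.1 hb')
      this.le
    omega
  · intro J hJ v
    obtain ⟨B, hB, rfl⟩ := (hJs J).1 hJ
    rw [SefeInstance.union_restrict hB.prop.1]
    exact hB.prop.2.2 v
  · constructor
    · intro h J hJ
      obtain ⟨B, hB, rfl⟩ := (hJs J).1 hJ
      rw [← SefeInstance.restrict_union (I := I)] at h
      exact SefeInstance.restrict_mono hB.prop.1 h
    · intro h
      rw [← SefeInstance.restrict_union (I := I)]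
      -- The gluing induction asks for all biconnected subgraphs; each lies in a numbered block and
      -- inherits the embedding of that block.
      refine SefeInstance.restrict_admitsSefe_of_biconnected _ ?_ fun H hle hH => ?_
      · rw [hI]
        exact Set.finite_lt_nat n
      · obtain ⟨b, hb0, hb, hHb⟩ := hN.exists_le_block hH hle
        exact SefeInstance.restrict_mono hHb
          (h _ ((hJs _).2 ⟨_, hN.isBlock_iff.2 ⟨b, hb0, hb, rfl⟩, rfl⟩))
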